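/- **Setting.** Let $d,k\ge 1$, let $\Omega\subset\mathbb R^d$ be bounded and open, and consider a system of conservation laws $\sum_j\partial_{x_j} f_j(u)=0$, $u\in\mathcal D\subset\mathbb R^p$ ($\mathcal D$ open), with $f_j\in C^{k+1}(\mathcal D)$, an entropy $U\in C^1(\mathcal D)$ and entropy fluxes $g_j\in C^1(\mathcal D)$ with $\nabla U\cdot\nabla f_j=\nabla g_j$. Let $V\mapsto u(V)$ be a $C^{k+1}$ map from an open set $\mathcal W\subset\mathbb R^p$ to $\mathcal D$ with $\nabla U(u(V))=V$; write $f_j(V)=f_j(u(V))$, $g_j(V)=g_j(u(V))$, and let $\theta_j(V)=\langle V,f_j(V)\rangle-g_j(V)$ be the entropy potential. Let $\hat f_n(\cdot,\cdot)$ be a numerical flux that is consistent ($\hat f_n(V,V)=\sum_j n_jf_j(V)$) and Lipschitz on compact sets of states, uniformly in the unit vector $n$, and set $$\hat g_n(V,V^-)=\langle\{V\},\hat f_n(V,V^-)\rangle-\theta(\{V\})\cdot n,\qquad \{V\}=\tfrac12(V+V^-).$$ Let $\mathcal T_h$ be a simplicial mesh of $\Omega$ (not necessarily conforming; the skeleton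 is cut into $(d-1)$-simplices, each lying on the boundary of the element or of the two elements that it bounds), with $h_K=\operatorname{diam}K$, $h=\max_K h_K$. Let $(\varphi_\sigma)_\sigma$ be the basis of $\mathbb P^k$ on each element transported affinely from a fixed reference basis with $\sum_\sigma\varphi_\sigma=1$ (e.g. Lagrange or Bézier), and let $V^h_{|K}=\sum_{\sigma\in K} V_\sigma\varphi_\sigma$ on every $K$, possibly discontinuous across elements. Volume and face integrals are replaced by quadrature formulas $\oint_s v=|s|\sum_q\omega_q v(x_q)$ with nodes $x_q$ in the element or face $s$; on a face the formula is the same from both sides. The discontinuous Galerkin residuals are $$\Phi_\sigma^K=-\oint_K\nabla\varphi_\sigma\cdot f(V^h)\,dx+\oint_{\partial K}\varphi_\sigma\,\hat f_n(V^h_{|K},V^h_{|K^-})\,d\gamma,$$ where $V^h_{|K^-}$ is the value on the other side of the face, and $V^h_{|K^-}=V^h_{|K}$ on $\partial\Omega$. Put $$\mathcal E_K=\sum_{\sigma\in K}\langle V_\sigma,\Phi^K_\sigma\rangle-\oint_{\partial K}\hat g_n(V^h_{|K},V^h_{|K^-})\,d\gamma,\qquad \bar V=\frac1{\#K}\sum_{\sigma\in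 K}V_\sigma,$$ $$r_\sigma=-\frac{\mathcal E_K}{\sum_{\sigma'\in K}|V_{\sigma'}-\bar V|^2}\,(V_\sigma-\bar V),\qquad \Phi'_\sigma=\Phi_\sigma+r_\sigma ,$$ with $r_\sigma=0$ if all $V_{\sigma'}$ in $K$ are equal. **Proposition.** 1. *(Entropy flux.)* $\nabla_V\theta_j=f_j$ on $\mathcal W$, and $\hat g_n(V,V)=g(V)\cdot n$ for $V\in\mathcal W$ and unit vectors $n$. 2. *(Local conservation.)* For every mesh, quadrature, $V^h$ and element $K$: $\sum_{\sigma\in K}\Phi'_\sigma=\oint_{\partial K}\hat f_n\,d\gamma$, and, unless all $V_\sigma$, $\sigma\in K$, are equal, $\sum_{\sigma\in K}\langle V_\sigma,\Phi'_\sigma\rangle=\oint_{\partial K}\hat g_n\,d\gamma$. If $\hat f_{-n}(b,a)=-\hat f_n(a,b)$, the entropy fluxes through an interior face seen from its two sides are opposite. 3. *(Entropy defect.)* Let $V\in C^{k+1}$ on a neighbourhood of $\overline\Omega$ with $V(\overline\Omega)\subset\mathcal W$. For all $\kappa>0,A,M$ there are $C$ and $h_0>0$ such that $|\mathcal E_K|\le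 C\,h^{d+k+1}$ for all elements $K$ of all meshes with $h\le h_0$ in which every $K$ contains a ball of radius $h_K/\kappa$, all quadratures exact for polynomials of degree $\le k$ on elements and $\le k+1$ on faces and with $\sum_q|\omega_q|\le M$, and all $V^h$ with $|V^h-V|\le A\,h_K^{k+1}$ on every $K$. 4. *(Order at steady state.)* Assume moreover that $\nabla V$ vanishes nowhere on $\overline\Omega$ and that $h\le\kappa h_K$ for all $K$. Then for every $B$ there are $C$ and $h_0>0$ such that in the situation of 3, for $h\le h_0$: the $V_\sigma$ in an element are never all equal; $|r_\sigma|\le C h^{k+d}$; if the DG residuals satisfy the accuracy condition $|\Phi_\sigma^K|\le B h^{k+d}$ for all $K,\sigma$, then $|\Phi'_\sigma|\le Ch^{k+d}$ for all $K,\sigma$; and if, for given boundary data and a given boundary numerical flux, the weak truncation error $$\sum_K\sum_{\sigma\in K}\langle\varphi^h_\sigma,\Phi_\sigma^K\rangle+\sum_{\Gamma\subset\partial\Omega}\sum_{\sigma}\langle\varphi^h_\sigma,\Phi^\Gamma_\sigma\rangle,\qquad \Phi_\sigma^\Gamma=\oint_\Gamma\varphi_\sigma\big(\hat f^{\,b}_n(u(V^h),u_b)-f(V^h)\cdot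 n\big)\,d\gamma,$$ is bounded by $B\|\varphi^h\|_{H^1(\Omega)}h^{k+1}$ for all continuous piecewise $\mathbb P^k$ functions $\varphi^h$ with values in $\mathbb R^p$, then the same sum with $\Phi'_\sigma$ in place of $\Phi_\sigma^K$ is bounded by $C\|\varphi^h\|_{H^1(\Omega)}h^{k+1}$ for all such $\varphi^h$. That is, the corrected scheme keeps the order $k+1$. -/

import Mathlib

open MeasureTheory Set

noncomputable section

namespace DGEntropy

/-- Euclidean space `ℝⁿ`. -/
abbrev E (n : ℕ) := EuclideanSpace ℝ (Fin n)

/-- A system of `p` conservation laws `∑ⱼ ∂ⱼ fⱼ(u) = 0` in `d` space dimensions with an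
entropy–entropy flux pair `(U, g)`, of regularity `C^r`, together with the change of variables
`V ↦ u(V)` inverting `u ↦ V = ∇U(u)`.  Convexity of `U` is not required; only the invertibility
of the change of variables is. -/
structure EntropySystem (d p r : ℕ) where
  /-- admissible conserved states `u` -/
  stateDomain : Set (E p)
  isOpen_stateDomain : IsOpen stateDomain
  flux : Fin d → E p → E p
  contDiffOn_flux : ∀ j, ContDiffOn ℝ r (flux j) stateDomain
  entropy : E p → ℝ
  contDiffOn_entropy : ContDiffOn ℝ 1 entropy stateDomain
  entropyFlux : Fin d → E p → ℝ
  contDiffOn_entropyFlux : ∀ j, ContDiffOn ℝ 1 (entropyFlux j) stateDomain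
  /-- `∇U · ∇fⱼ = ∇gⱼ` -/
  compat : ∀ j, ∀ u ∈ stateDomain, ∀ w : E p,
    inner ℝ (gradient entropy u) (fderiv ℝ (flux j) u w) = fderiv ℝ (entropyFlux j) u w
  /-- admissible values of the entropy variable `V` -/
  varDomain : Set (E p)
  isOpen_varDomain : IsOpen varDomain
  /-- the conserved state `u(V)` -/
  state : E p → E p
  mapsTo_state : MapsTo state varDomain stateDomain
  contDiffOn_state : ContDiffOn ℝ r state varDomain
  gradient_entropy_state : ∀ v ∈ varDomain, gradient entropy (state v) = v

namespace EntropySystem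

variable {d p r : ℕ} (S : EntropySystem d p r)

/-- The flux as a function of the entropy variable, `fⱼ(V) = fⱼ(u(V))`. -/
def fluxV (j : Fin d) (v : E p) : E p := S.flux j (S.state v)

/-- The entropy potential `θⱼ(V) = ⟨V, fⱼ(V)⟩ - gⱼ(u(V))`. -/
def potential (j : Fin d) (v : E p) : ℝ :=
  inner ℝ v (S.fluxV j v) - S.entropyFlux j (S.state v)

end EntropySystem

/-- A consistent, (locally) Lipschitz continuous numerical flux `f̂ₙ(u, u⁻)`. -/
structure NumericalFlux {d p r : ℕ} (S : EntropySystem d p r) where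
  /-- `toFun n u u⁻ = f̂ₙ(u, u⁻)` -/
  toFun : E d → E p → E p → E p
  consistent : ∀ n : E d, ‖n‖ = 1 → ∀ u ∈ S.stateDomain,
    toFun n u u = ∑ j, n j • S.flux j u
  lipschitz : ∀ C : Set (E p), IsCompact C → C ⊆ S.stateDomain → ∃ L : ℝ,
    ∀ n : E d, ‖n‖ = 1 → ∀ a ∈ C, ∀ b ∈ C, ∀ a' ∈ C, ∀ b' ∈ C,
      ‖toFun n a b - toFun n a' b'‖ ≤ L * (‖a - a'‖ + ‖b - b'‖)

/-- The numerical flux is conservative: `f̂₋ₙ(b, a) = -f̂ₙ(a, b)`. -/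
def NumericalFlux.Conservative {d p r : ℕ} {S : EntropySystem d p r} (F : NumericalFlux S) :
    Prop := ∀ (n : E d) (a b : E p), F.toFun (-n) b a = -F.toFun n a b

/-- The numerical flux `f̂ₙ(u(V), u(V⁻))` as a function of entropy variables. -/
def NumericalFlux.onVar {d p r : ℕ} {S : EntropySystem d p r} (F : NumericalFlux S)
    (n : E d) (a b : E p) : E p := F.toFun n (S.state a) (S.state b)

/-- The entropy numerical flux `ĝₙ(V, V⁻) = ⟨{V}, f̂ₙ(V, V⁻)⟩ - θ({V}) · n`,
`{V} = (V + V⁻) / 2`. -/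
def NumericalFlux.entropyFlux {d p r : ℕ} {S : EntropySystem d p r} (F : NumericalFlux S)
    (n : E d) (a b : E p) : ℝ :=
  inner ℝ ((1 / 2 : ℝ) • (a + b)) (F.onVar n a b)
    - ∑ j, n j * S.potential j ((1 / 2 : ℝ) • (a + b))

/-- A simplicial mesh of `Ω`, not necessarily conforming.  The skeleton is cut into `(d-1)`-simplices
("facets"); each facet has an element `side f`, and an element `opp f` on its other side
unless it lies on the boundary of `Ω`. -/
structure Mesh (d : ℕ) (Ω : Set (E d)) where
  nElem : ℕ
  nFacet : ℕ
  elem : Fin nElem → Affine.Simplex ℝ (E d) d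
  facet : Fin nFacet → Affine.Simplex ℝ (E d) (d - 1)
  side : Fin nFacet → Fin nElem
  opp : Fin nFacet → Option (Fin nElem)
  /-- unit normal, pointing out of `side f` -/
  normal : Fin nFacet → E d
  cover : ⋃ K, (elem K).closedInterior = closure Ω
  disjoint_elem : ∀ K K', K ≠ K' →
    Disjoint (interior (elem K).closedInterior) (interior (elem K').closedInterior)
  opp_ne_side : ∀ f, opp f ≠ some (side f)
  /-- the facets of an element lie on its boundary, -/
  facet_subset : ∀ f K, (side f = K ∨ opp f = some K) →
    (facet f).closedInterior ⊆ frontier (elem K).closedInterior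
  /-- cover it, -/
  frontier_subset : ∀ K, frontier (elem K).closedInterior ⊆
    ⋃ f ∈ {f | side f = K ∨ opp f = some K}, (facet f).closedInterior
  /-- and do not overlap. -/
  disjoint_facet : ∀ f f', f ≠ f' →
    Disjoint (intrinsicInterior ℝ (facet f).closedInterior)
      (intrinsicInterior ℝ (facet f').closedInterior)
  boundary_subset : ∀ f, opp f = none → (facet f).closedInterior ⊆ frontier Ω
  norm_normal : ∀ f, ‖normal f‖ = 1
  normal_side : ∀ f, ∀ y ∈ (facet f).closedInterior, ∀ x ∈ (elem (side f)).closedInterior,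
    inner ℝ (x - y) (normal f) ≤ 0
  normal_opp : ∀ f K, opp f = some K → ∀ y ∈ (facet f).closedInterior,
    ∀ x ∈ (elem K).closedInterior, 0 ≤ inner ℝ (x - y) (normal f)

namespace Mesh

variable {d : ℕ} {Ω : Set (E d)} (T : Mesh d Ω)

/-- The element `K` as a set. -/
def elemSet (K : Fin T.nElem) : Set (E d) := (T.elem K).closedInterior

/-- The facet `f` as a set. -/
def facetSet (f : Fin T.nFacet) : Set (E d) := (T.facet f).closedInterior

/-- The facets making up `∂K`. -/
def bdry (K : Fin T.nElem) : Finset (Fin T.nFacet) :=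
  Finset.univ.filter fun f => T.side f = K ∨ T.opp f = some K

/-- The outward unit normal of `K` on the facet `f ⊆ ∂K`. -/
def outward (K : Fin T.nElem) (f : Fin T.nFacet) : E d :=
  if T.side f = K then T.normal f else -T.normal f

/-- The element on the other side of `f ⊆ ∂K`; it is `K` itself on boundary facets, so that there
`V⁻ = V`. -/
def neighbor (K : Fin T.nElem) (f : Fin T.nFacet) : Fin T.nElem :=
  if T.side f = K then (T.opp f).getD K else T.side f

/-- The diameter `h_K`. -/
def hElem (K : Fin T.nElem) : ℝ := Metric.diam (T.elemSet K)

/-- The mesh size `h = max_K h_K`. -/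
def size : ℝ := ⨆ K, T.hElem K

/-- Every element `K` contains a ball of radius `h_K / κ`. -/
def ShapeRegular (κ : ℝ) : Prop :=
  ∀ K, ∃ c, Metric.closedBall c (T.hElem K / κ) ⊆ T.elemSet K

/-- All elements have size comparable to `h`. -/
def QuasiUniform (κ : ℝ) : Prop := ∀ K, T.size ≤ κ * T.hElem K

end Mesh

/-- A quadrature formula on a set `s`: finitely many weights and nodes. -/
structure QuadRule {d : ℕ} (s : Set (E d)) where
  N : ℕ
  weight : Fin N → ℝ
  node : Fin N → E d
  node_mem : ∀ q, node q ∈ s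

namespace QuadRule

variable {d : ℕ} {s : Set (E d)} (Q : QuadRule s)

/-- `∮ v = |s| ∑_q ω_q v(x_q)`, where `|s| = μ(s)`. -/
def integral (μ : Measure (E d)) {F : Type} [AddCommGroup F] [Module ℝ F] (v : E d → F) : F :=
  μ.real s • ∑ q, Q.weight q • v (Q.node q)

/-- The formula integrates all polynomials of degree at most `m` exactly. -/
def ExactDegree (μ : Measure (E d)) (m : ℕ) : Prop :=
  ∀ P : MvPolynomial (Fin d) ℝ, P.totalDegree ≤ m →
    Q.integral μ (fun x => MvPolynomial.eval (fun i => x i) P)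
      = ∫ x in s, MvPolynomial.eval (fun i => x i) P ∂μ

end QuadRule

/-- Quadrature formulas on all elements and all facets of a mesh.  The formula on a facet is the
same seen from both sides.  Facets carry the `(d-1)`-dimensional Euclidean (surface) measure. -/
structure Quadrature {d : ℕ} {Ω : Set (E d)} (T : Mesh d Ω) where
  onElem : (K : Fin T.nElem) → QuadRule (T.elemSet K)
  onFacet : (f : Fin T.nFacet) → QuadRule (T.facetSet f)

namespace Quadrature

variable {d : ℕ} {Ω : Set (E d)} {T : Mesh d Ω} (Q : Quadrature T)

/-- `∮_K` -/
def elemInt (K : Fin T.nElem) {F : Type} [AddCommGroup F] [Module ℝ F] (v : E d → F) : F :=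
  (Q.onElem K).integral volume v

/-- `∮_f` -/
def facetInt (f : Fin T.nFacet) {F : Type} [AddCommGroup F] [Module ℝ F] (v : E d → F) : F :=
  (Q.onFacet f).integral μHE[d - 1] v

/-- `∮_{∂K}`; the integrand may depend on the facet, through the normal and the neighbouring
element. -/
def bdryInt (K : Fin T.nElem) {F : Type} [AddCommGroup F] [Module ℝ F]
    (v : Fin T.nFacet → E d → F) : F :=
  ∑ f ∈ T.bdry K, Q.facetInt f (v f)

/-- Degree of exactness `m` on the elements and `m'` on the facets. -/
def HasOrder (m m' : ℕ) : Prop :=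
  (∀ K, (Q.onElem K).ExactDegree volume m) ∧ ∀ f, (Q.onFacet f).ExactDegree μHE[d - 1] m'

/-- The weights (relative to the measure of the element or facet) are bounded by `M` in `ℓ¹`. -/
def Stable (M : ℝ) : Prop :=
  (∀ K, ∑ q, |(Q.onElem K).weight q| ≤ M) ∧ ∀ f, ∑ q, |(Q.onFacet f).weight q| ≤ M

end Quadrature

/-- A finite element: a basis of the polynomials of degree at most `k` in the barycentric
coordinates `λ₁, …, λ_d` (equivalently, by duality, a unisolvent set of linear forms) that is a
partition of unity.  Lagrange and Bézier elements are examples. -/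
structure FiniteElement (d k : ℕ) where
  nDof : ℕ
  basis : Module.Basis (Fin nDof) ℝ (MvPolynomial.restrictTotalDegree (Fin d) ℝ k)
  sum_basis : ∑ σ, (basis σ : MvPolynomial (Fin d) ℝ) = 1

/-- The affine basis of `ℝᵈ` given by the vertices of a `d`-simplex. -/
def simplexBasis {d : ℕ} (s : Affine.Simplex ℝ (E d) d) : AffineBasis (Fin (d + 1)) ℝ (E d) :=
  ⟨s.points, s.independent, s.span_eq_top (by simp)⟩

section DG

variable {d p k r : ℕ} {Ω : Set (E d)} (FE : FiniteElement d k) (T : Mesh d Ω)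

/-- The shape function `φ_σ` of the element `K`. -/
def shape (K : Fin T.nElem) (σ : Fin FE.nDof) (x : E d) : ℝ :=
  MvPolynomial.eval (fun i : Fin d => (simplexBasis (T.elem K)).coord i.succ x)
    (FE.basis σ : MvPolynomial (Fin d) ℝ)

/-- Functions that are polynomials of degree at most `k` with values in `ℝᵖ` on each element and may
be discontinuous across elements, given by the coefficients `V_σ` in each element. -/
abbrev DGFun (p : ℕ) := Fin T.nElem → Fin FE.nDof → E p

variable {FE T}

/-- The restriction `V^h_{|K}` (a polynomial, hence defined everywhere). -/
def DGFun.val (v : DGFun FE T p) (K : Fin T.nElem) (x : E d) : E p :=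
  ∑ σ, shape FE T K σ x • v K σ

/-- `v` approximates `V` to order `k+1`: `|V^h - V| ≤ A h_K^{k+1}` on every element `K`. -/
def DGFun.Approximates (v : DGFun FE T p) (V : E d → E p) (A : ℝ) : Prop :=
  ∀ K, ∀ x ∈ T.elemSet K, ‖v.val K x - V x‖ ≤ A * T.hElem K ^ (k + 1)

/-- `v` is continuous across elements. -/
def DGFun.IsContinuous (v : DGFun FE T p) : Prop :=
  ∀ K K', ∀ x ∈ T.elemSet K ∩ T.elemSet K', v.val K x = v.val K' x

/-- The `H¹` norm (elementwise for discontinuous functions). -/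
def DGFun.normH1 (v : DGFun FE T p) : ℝ :=
  Real.sqrt (∑ K, ∫ x in T.elemSet K,
    (‖v.val K x‖ ^ 2 + ∑ j, ‖fderiv ℝ (v.val K) x (EuclideanSpace.single j 1)‖ ^ 2))

/-- The mean value `V̄` of the coefficients in `K`. -/
def DGFun.mean (v : DGFun FE T p) (K : Fin T.nElem) : E p :=
  ((FE.nDof : ℝ)⁻¹) • ∑ σ, v K σ

/-- `∑_σ |V_σ - V̄|²` -/
def DGFun.spread (v : DGFun FE T p) (K : Fin T.nElem) : ℝ :=
  ∑ σ, ‖v K σ - v.mean K‖ ^ 2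

variable {S : EntropySystem d p r} (F : NumericalFlux S) (Q : Quadrature T)

/-- The discontinuous Galerkin residual
`Φ_σ^K = -∮_K ∇φ_σ · f(V^h) + ∮_{∂K} φ_σ f̂ₙ(V^h_{|K}, V^h_{|K⁻})`. -/
def residual (v : DGFun FE T p) (K : Fin T.nElem) (σ : Fin FE.nDof) : E p :=
  -Q.elemInt K (fun x => ∑ j, fderiv ℝ (shape FE T K σ) x (EuclideanSpace.single j 1) •
      S.fluxV j (v.val K x))
  + Q.bdryInt K (fun f x => shape FE T K σ x •
      F.onVar (T.outward K f) (v.val K x) (v.val (T.neighbor K f) x))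

/-- `∮_{∂K} f̂ₙ(V^h_{|K}, V^h_{|K⁻})` -/
def totalFlux (v : DGFun FE T p) (K : Fin T.nElem) : E p :=
  Q.bdryInt K fun f x => F.onVar (T.outward K f) (v.val K x) (v.val (T.neighbor K f) x)

/-- `∮_f ĝₙ(V^h_{|K}, V^h_{|K⁻})` on a facet `f ⊆ ∂K`, seen from `K`. -/
def facetEntropyFlux (v : DGFun FE T p) (K : Fin T.nElem) (f : Fin T.nFacet) : ℝ :=
  Q.facetInt f fun x =>
    F.entropyFlux (T.outward K f) (v.val K x) (v.val (T.neighbor K f) x)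

/-- `∮_{∂K} ĝₙ(V^h_{|K}, V^h_{|K⁻})` -/
def totalEntropyFlux (v : DGFun FE T p) (K : Fin T.nElem) : ℝ :=
  ∑ f ∈ T.bdry K, facetEntropyFlux F Q v K f

/-- The entropy defect `𝓔 = ∑_σ ⟨V_σ, Φ_σ⟩ - ∮_{∂K} ĝₙ`. -/
def defect (v : DGFun FE T p) (K : Fin T.nElem) : ℝ :=
  ∑ σ, inner ℝ (v K σ) (residual F Q v K σ) - totalEntropyFlux F Q v K

/-- The correction `r_σ = α (V_σ - V̄)`, with
`α = (∮_{∂K} ĝₙ - ∑_σ ⟨V_σ, Φ_σ⟩) / ∑_σ |V_σ - V̄|²`. -/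
def correction (v : DGFun FE T p) (K : Fin T.nElem) (σ : Fin FE.nDof) : E p :=
  (-defect F Q v K / v.spread K) • (v K σ - v.mean K)

/-- The corrected residual `Φ'_σ = Φ_σ + r_σ`. -/
def correctedResidual (v : DGFun FE T p) (K : Fin T.nElem) (σ : Fin FE.nDof) : E p :=
  residual F Q v K σ + correction F Q v K σ

/-- The boundary residual `Φ_σ^Γ = ∮_Γ φ_σ (f̂ᵇₙ(u^h, u_b) - f(u^h) · n)`; the numerical flux
`fb` used on the boundary may differ from the one used inside. -/
def boundaryResidual (S : EntropySystem d p r) (fb : E d → E p → E p → E p) (ub : E d → E p)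
    (Q : Quadrature T) (v : DGFun FE T p) (f : Fin T.nFacet) (σ : Fin FE.nDof) : E p :=
  Q.facetInt f fun x => shape FE T (T.side f) σ x •
    (fb (T.normal f) (S.state (v.val (T.side f) x)) (ub x)
      - ∑ j, T.normal f j • S.fluxV j (v.val (T.side f) x))

/-- The weak truncation error of the scheme with element residuals `R` and the above boundary
residuals, tested against `φ`. -/
def truncationError (S : EntropySystem d p r) (fb : E d → E p → E p → E p) (ub : E d → E p)
    (Q : Quadrature T) (v : DGFun FE T p) (R : Fin T.nElem → Fin FE.nDof → E p)
    (φ : DGFun FE T p) : ℝ :=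
  ∑ K, ∑ σ, inner ℝ (φ K σ) (R K σ)
  + ∑ f ∈ Finset.univ.filter (fun f => T.opp f = none), ∑ σ,
      inner ℝ (φ (T.side f) σ) (boundaryResidual S fb ub Q v f σ)

end DG

end DGEntropy

end

/-!
Why the correction does not spoil the order. The residuals are corrected by a multiple of
`V_σ - V̄`, which has zero sum in each element (so conservation is kept) and is scaled to cancel the
entropy defect `𝓔_K`. Everything then depends on the size of `𝓔_K`, which has to be `O(h^(d+k+1))`.

*The defect.* Since `∇θ = f` (`EntropySystem.hasGradientAt_potential`), the volume part of
`∑_σ ⟨V_σ, Φ_σ⟩` is the quadrature of the divergence of `θ(V^h)`, and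
`𝓔_K = ∮_{∂K} (⟨V^h, f̂ₙ⟩ - ĝₙ) - ∮_K div θ(V^h)` (`defect_eq`). The facet integrand is
`θ(V^h) · n` up to the square of the jump, because the terms of first order cancel by `∇θ = f` and
consistency (`exists_jump_le`); the jump is `O(h^(k+1))`. What is left is the difference between the
quadratures and the integrals of `θ(V^h) · n` over `∂K` and of `div θ(V^h)` over `K`; the two
integrals cancel by the divergence theorem (`Mesh.divergence`). Exactness in degrees `k + 1` and
`k` makes the two errors `O(h^(k+2))` on a boundary of area `O(h^(d-1))`, and `O(h^(k+1))` on a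
volume `O(h^d)`. This uses bounds on `k + 2` derivatives of `θ(V^h)` that are uniform in the mesh.
The potential has `k + 2` derivatives, one more than `f`, again by `∇θ = f`, and the derivatives of
the polynomial `V^h` are bounded because `V^h` is close to the Taylor polynomial of `V`, by an
inverse estimate (`exists_iteratedFDeriv_le_of_near`). Together: `exists_defect_le`.

*The divergence theorem* is needed for a simplex whose boundary is cut arbitrarily into flat
pieces. From an interior point `c` such a convex body is the union of the cones over the pieces.
Orthogonal coordinates and Fubini's theorem give the integral over a cone (`setIntegral_coneOver`),
and the fundamental theorem of calculus along the rays gives the theorem for the radial fields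
`(x - c) Q` (`FlatBoundary.radial_divergence`). A constant direction times `Q` is a difference of
two of these, with different `c`. The radial field with `Q = 1` also bounds the area of the
boundary.

*The correction* is at most `|𝓔_K|` divided by the root of the spread `∑_σ |V_σ - V̄|²`. Where `∇V`
does not vanish, `V`, hence `V^h`, oscillates by at least a multiple of `h` in every element
(`exists_le_oscillation`), so that the root of the spread is at least a multiple of `h`. Hence
`r_σ = O(h^(k+d))` (`exists_correction_le`).

*The weak truncation error* changes by `∑_K ∑_σ ⟨φ_σ, r_σ⟩`. As `∑_σ r_σ = 0`, a value of `φ` in `K`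
may be subtracted from `φ_σ`, and the difference is at most `h^(1-d/2) ‖φ‖_{H¹(K)}`
(`exists_coeff_sub_le`). The Cauchy–Schwarz inequality over the `O(h^(-d))` elements gives the bound
`‖φ‖_{H¹} h^(k+1)` (`exists_sum_inner_correction_le`).
-/

namespace DGEntropy

open Filter Topology

/-! ### Polynomial functions and inverse estimates -/

/-- A linear functional on a finite-dimensional space is controlled by any family of linear forms
that separates points, because it is a linear combination of finitely many of them. -/
theorem exists_bound_of_separating {M α : Type*} [AddCommGroup M] [Module ℝ M]
    [FiniteDimensional ℝ M] (U : Set α) (ev : α → Module.Dual ℝ M)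
    (hsep : ∀ q, (∀ x ∈ U, ev x q = 0) → q = 0) (ℓ : Module.Dual ℝ M) :
    ∃ C, 0 ≤ C ∧ ∀ q B, (∀ x ∈ U, |ev x q| ≤ B) → |ℓ q| ≤ C * B := by
  have htop : Submodule.span ℝ (ev '' U) = ⊤ := by
    rw [← Subspace.dualCoannihilator_dualAnnihilator_eq (W := Submodule.span ℝ (ev '' U))]
    have : (Submodule.span ℝ (ev '' U)).dualCoannihilator = ⊥ := by
      rw [eq_bot_iff]
      intro q hq
      rw [Submodule.mem_dualCoannihilator] at hq
      exact hsep q fun x hx => hq _ (Submodule.subset_span ⟨x, hx, rfl⟩)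
    rw [this, Submodule.dualAnnihilator_bot]
  have hℓ : ℓ ∈ Submodule.span ℝ (ev '' U) := htop ▸ Submodule.mem_top
  induction hℓ using Submodule.span_induction with
  | mem x hx =>
    obtain ⟨a, ha, rfl⟩ := hx
    exact ⟨1, zero_le_one, fun q B h => by simpa using h a ha⟩
  | zero => exact ⟨0, le_rfl, fun q B _ => by simp⟩
  | add f g _ _ hf hg =>
    obtain ⟨C, hC, h1⟩ := hf
    obtain ⟨C', hC', h2⟩ := hg
    refine ⟨C + C', add_nonneg hC hC', fun q B h => ?_⟩
    rw [add_mul]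
    exact (abs_add_le _ _).trans (add_le_add (h1 q B h) (h2 q B h))
  | smul a f _ hf =>
    obtain ⟨C, hC, h1⟩ := hf
    refine ⟨|a| * C, by positivity, fun q B h => ?_⟩
    rw [LinearMap.smul_apply, smul_eq_mul, abs_mul, mul_assoc]
    exact mul_le_mul_of_nonneg_left (h1 q B h) (abs_nonneg a)

/-- Evaluation of polynomials at the points of `ℝᴺ`, as a linear map into functions. -/
noncomputable def evalFun (N : ℕ) : MvPolynomial (Fin N) ℝ →ₗ[ℝ] (E N → ℝ) :=
  LinearMap.pi fun x => (MvPolynomial.aeval (R := ℝ) fun i => x i).toLinearMap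

theorem evalFun_apply {N : ℕ} (P : MvPolynomial (Fin N) ℝ) (x : E N) :
    evalFun N P x = MvPolynomial.eval (fun i => x i) P := by
  simp [evalFun, MvPolynomial.aeval_eq_eval]

/-- The polynomial functions on `ℝᴺ` of total degree at most `m`. -/
noncomputable def polyFun (N m : ℕ) : Submodule ℝ (E N → ℝ) :=
  (MvPolynomial.restrictTotalDegree (Fin N) ℝ m).map (evalFun N)

instance (N m : ℕ) : FiniteDimensional ℝ (polyFun N m) := by
  unfold polyFun; infer_instance

theorem mem_polyFun {N m : ℕ} {q : E N → ℝ} : q ∈ polyFun N m ↔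
    ∃ P : MvPolynomial (Fin N) ℝ, P.totalDegree ≤ m ∧
      q = fun x => MvPolynomial.eval (fun i => x i) P := by
  simp only [polyFun, Submodule.mem_map, MvPolynomial.mem_restrictTotalDegree]
  refine exists_congr fun P => and_congr_right fun _ => ?_
  rw [eq_comm, funext_iff, funext_iff]
  simp [evalFun_apply]

theorem polyFun_mono {N m m' : ℕ} (h : m ≤ m') : polyFun N m ≤ polyFun N m' := fun q hq => by
  obtain ⟨P, hP, rfl⟩ := mem_polyFun.1 hq
  exact mem_polyFun.2 ⟨P, hP.trans h, rfl⟩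

theorem const_mem_polyFun {N m : ℕ} (a : ℝ) : (fun _ => a) ∈ polyFun N m :=
  mem_polyFun.2 ⟨MvPolynomial.C a, by simp, by simp⟩

theorem coord_mem_polyFun {N : ℕ} (i : Fin N) : (fun x : E N => x i) ∈ polyFun N 1 :=
  mem_polyFun.2 ⟨MvPolynomial.X i, by simp, by simp⟩

theorem mul_mem_polyFun {N m m' : ℕ} {q q' : E N → ℝ} (hq : q ∈ polyFun N m)
    (hq' : q' ∈ polyFun N m') : (fun x => q x * q' x) ∈ polyFun N (m + m') := by
  obtain ⟨P, hP, rfl⟩ := mem_polyFun.1 hq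
  obtain ⟨P', hP', rfl⟩ := mem_polyFun.1 hq'
  exact mem_polyFun.2 ⟨P * P', (MvPolynomial.totalDegree_mul _ _).trans (add_le_add hP hP'),
    by simp⟩

theorem pow_mem_polyFun {N m : ℕ} {q : E N → ℝ} (hq : q ∈ polyFun N m) (j : ℕ) :
    (fun x => q x ^ j) ∈ polyFun N (j * m) := by
  obtain ⟨P, hP, rfl⟩ := mem_polyFun.1 hq
  exact mem_polyFun.2 ⟨P ^ j, (MvPolynomial.totalDegree_pow _ _).trans
    (Nat.mul_le_mul_left j hP), by simp⟩

theorem prod_mem_polyFun {N : ℕ} {ι : Type*} (s : Finset ι) (e : ι → ℕ) (q : ι → E N → ℝ)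
    (hq : ∀ i ∈ s, q i ∈ polyFun N (e i)) :
    (fun x => ∏ i ∈ s, q i x) ∈ polyFun N (∑ i ∈ s, e i) := by
  classical
  induction s using Finset.induction_on with
  | empty => simpa using const_mem_polyFun (N := N) (m := 0) 1
  | insert a s ha ih =>
    simp only [Finset.prod_insert ha, Finset.sum_insert ha]
    exact mul_mem_polyFun (hq a (by simp)) (ih fun i hi => hq i (by simp [hi]))

/-- Substituting functions of degree at most one into a polynomial does not raise its degree. -/
theorem eval_mem_polyFun {N n m : ℕ} {P : MvPolynomial (Fin n) ℝ} (hP : P.totalDegree ≤ m)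
    (A : Fin n → E N → ℝ) (hA : ∀ i, A i ∈ polyFun N 1) :
    (fun x => MvPolynomial.eval (fun i => A i x) P) ∈ polyFun N m := by
  simp only [MvPolynomial.eval_eq']
  have : (fun x => ∑ d ∈ P.support, MvPolynomial.coeff d P * ∏ i, A i x ^ d i)
      = ∑ d ∈ P.support, MvPolynomial.coeff d P • fun x => ∏ i, A i x ^ d i := by
    ext x; simp
  rw [this]
  refine Submodule.sum_mem _ fun s hs => Submodule.smul_mem _ _ ?_
  refine polyFun_mono ?_ (prod_mem_polyFun Finset.univ (fun i => s i * 1) _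
    fun i _ => pow_mem_polyFun (hA i) (s i))
  refine le_trans ?_ ((MvPolynomial.le_totalDegree hs).trans hP)
  simp [Finsupp.sum_fintype]

theorem comp_affine_mem_polyFun {N m : ℕ} {q : E N → ℝ} (hq : q ∈ polyFun N m) (c : E N) (r : ℝ) :
    (fun x => q (c + r • x)) ∈ polyFun N m := by
  obtain ⟨P, hP, rfl⟩ := mem_polyFun.1 hq
  refine (eval_mem_polyFun (N := N) (m := m) hP (fun i x => (c + r • x) i) ?_ :)
  intro i
  have : (fun x : E N => (c + r • x) i) = (fun _ => c i) + r • fun x : E N => x i := by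
    ext x; simp
  rw [this]
  exact Submodule.add_mem _ (const_mem_polyFun _) (Submodule.smul_mem _ _ (coord_mem_polyFun i))

theorem contDiff_of_mem_polyFun {N m : ℕ} {q : E N → ℝ} (hq : q ∈ polyFun N m)
    {n : WithTop ℕ∞} : ContDiff ℝ n q := by
  obtain ⟨P, hP, rfl⟩ := mem_polyFun.1 hq
  simp only [MvPolynomial.eval_eq']
  refine ContDiff.sum fun s _ => contDiff_const.mul (contDiff_prod fun i _ => ?_)
  exact ContDiff.pow (by fun_prop) _

/-- The directional derivatives of a polynomial function are limits of difference quotients, which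
lie in the same (closed) finite-dimensional space. -/
theorem fderiv_mem_polyFun {N m : ℕ} {q : E N → ℝ} (hq : q ∈ polyFun N m) (e : E N) :
    (fun x => fderiv ℝ q x e) ∈ polyFun N m := by
  have hcl : IsClosed (polyFun N m : Set (E N → ℝ)) := Submodule.closed_of_finiteDimensional _
  have hlim : Tendsto (fun t : ℝ => fun x => t⁻¹ • (q (x + t • e) - q x)) (𝓝[≠] 0)
      (𝓝 fun x => fderiv ℝ q x e) := by
    rw [tendsto_pi_nhds]
    intro x
    have hd : HasFDerivAt q (fderiv ℝ q x) x :=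
      ((contDiff_of_mem_polyFun hq (n := 1)).differentiable (by simp) x).hasFDerivAt
    have := (hd.hasLineDerivAt e)
    rw [HasLineDerivAt, hasDerivAt_iff_tendsto_slope] at this
    refine this.congr' ?_
    filter_upwards with t
    simp [slope_def_module]
  refine hcl.mem_of_tendsto hlim (Eventually.of_forall fun t => ?_)
  have : (fun x => t⁻¹ • (q (x + t • e) - q x))
      = t⁻¹ • ((fun x => q (t • e + (1 : ℝ) • x)) - q) := by
    ext x; simp [add_comm]
  rw [this]
  exact Submodule.smul_mem _ _ (Submodule.sub_mem _ (comp_affine_mem_polyFun hq _ _) hq)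

/-- A polynomial that vanishes on a ball of positive radius is zero. -/
theorem mvPolynomial_eq_zero_of_closedBall {N : ℕ} {P : MvPolynomial (Fin N) ℝ} {ρ : ℝ}
    (hρ : 0 < ρ) (h : ∀ x ∈ Metric.closedBall (0 : E N) ρ,
      MvPolynomial.eval (fun i => x i) P = 0) : P = 0 := by
  have hopen : Metric.ball (0 : E N) ρ ∈ 𝓝 0 := Metric.ball_mem_nhds _ hρ
  have hcont : Continuous (fun y : Fin N → ℝ => (WithLp.toLp 2 y : E N)) := by fun_prop
  have h0 : {y : Fin N → ℝ | (WithLp.toLp 2 y : E N) ∈ Metric.ball 0 ρ} ∈ 𝓝 (0 : Fin N → ℝ) := by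
    refine hcont.continuousAt.preimage_mem_nhds ?_
    simpa using hopen
  obtain ⟨ε, hε, hsub⟩ := Metric.mem_nhds_iff.1 h0
  refine MvPolynomial.funext_set (fun _ => Ioo (-ε) ε) (fun _ => Ioo_infinite (by linarith))
    fun y hy => ?_
  rw [map_zero]
  have hy' : y ∈ Metric.ball (0 : Fin N → ℝ) ε := by
    rw [mem_ball_zero_iff, pi_norm_lt_iff hε]
    intro i
    have := hy i trivial
    rw [Real.norm_eq_abs, abs_lt]; exact this
  exact h (WithLp.toLp 2 y) (Metric.ball_subset_closedBall (hsub hy'))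

theorem eq_zero_of_closedBall {N m : ℕ} {q : E N → ℝ} (hq : q ∈ polyFun N m) {ρ : ℝ} (hρ : 0 < ρ)
    (h : ∀ x ∈ Metric.closedBall (0 : E N) ρ, q x = 0) : q = 0 := by
  obtain ⟨P, hP, rfl⟩ := mem_polyFun.1 hq
  rw [mvPolynomial_eq_zero_of_closedBall hρ h]
  ext; simp

/-- Inverse estimate on the unit ball. -/
theorem exists_iteratedFDeriv_le_unit (N m i : ℕ) {ρ : ℝ} (hρ : 0 < ρ) :
    ∃ C, 0 ≤ C ∧ ∀ q ∈ polyFun N m, ∀ B, (∀ y ∈ Metric.closedBall (0 : E N) ρ, |q y| ≤ B) →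
      ∀ y ∈ Metric.closedBall (0 : E N) 1, ‖iteratedFDeriv ℝ i q y‖ ≤ C * B := by
  let b := Module.finBasis ℝ (polyFun N m)
  have h1 : ∀ j, ∃ C, 0 ≤ C ∧ ∀ (q : polyFun N m) (B : ℝ),
      (∀ y ∈ Metric.closedBall (0 : E N) ρ, |q.1 y| ≤ B) → |b.coord j q| ≤ C * B := fun j =>
    exists_bound_of_separating (Metric.closedBall (0 : E N) ρ)
      (fun y => (LinearMap.proj y).comp (polyFun N m).subtype)
      (fun q hq => Subtype.ext (eq_zero_of_closedBall q.2 hρ hq)) (b.coord j)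
  choose C hC0 hC using h1
  have h2 : ∀ j, ∃ D, ∀ y ∈ Metric.closedBall (0 : E N) 1, ‖iteratedFDeriv ℝ i (b j).1 y‖ ≤ D :=
    fun j => (isCompact_closedBall _ _).exists_bound_of_continuousOn
      ((contDiff_of_mem_polyFun (b j).2 (n := i)).continuous_iteratedFDeriv le_rfl).continuousOn
  choose D hD using h2
  have hD0 : ∀ j, 0 ≤ D j := fun j => (norm_nonneg _).trans (hD j 0 (by simp))
  refine ⟨∑ j, C j * D j, Finset.sum_nonneg fun j _ => mul_nonneg (hC0 j) (hD0 j),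
    fun q hq B hB y hy => ?_⟩
  have hsum : q = ∑ j, b.coord j ⟨q, hq⟩ • (b j).1 := by
    have := congrArg Subtype.val (b.sum_repr ⟨q, hq⟩)
    rw [Submodule.coe_sum] at this
    exact this.symm
  have hB0 : 0 ≤ B := (abs_nonneg _).trans (hB 0 (by simp [hρ.le]))
  rw [hsum, iteratedFDeriv_sum_apply fun j _ =>
    (contDiff_of_mem_polyFun (Submodule.smul_mem _ _ (b j).2)).contDiffAt, Finset.sum_mul]
  refine (norm_sum_le _ _).trans (Finset.sum_le_sum fun j _ => ?_)
  rw [iteratedFDeriv_const_smul_apply (contDiff_of_mem_polyFun (b j).2).contDiffAt, norm_smul]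
  calc _ ≤ (C j * B) * D j := mul_le_mul (hC j ⟨q, hq⟩ B hB) (hD j y hy) (norm_nonneg _)
        (mul_nonneg (hC0 j) hB0)
    _ = _ := by ring

/-- Inverse estimate: on a ball of radius `h`, the `i`-th derivative of a polynomial is bounded by
`h⁻ⁱ` times its maximum on a concentric ball of radius proportional to `h`. -/
theorem exists_iteratedFDeriv_le (N m i : ℕ) {ρ : ℝ} (hρ : 0 < ρ) :
    ∃ C, 0 ≤ C ∧ ∀ q ∈ polyFun N m, ∀ (c : E N) (h B : ℝ), 0 < h →
      (∀ y ∈ Metric.closedBall c (h * ρ), |q y| ≤ B) →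
      ∀ x ∈ Metric.closedBall c h, ‖iteratedFDeriv ℝ i q x‖ ≤ C * B * h⁻¹ ^ i := by
  obtain ⟨C, hC0, hC⟩ := exists_iteratedFDeriv_le_unit N m i hρ
  refine ⟨C, hC0, fun q hq c h B hh hB x hx => ?_⟩
  have hx' : ‖x - c‖ ≤ h := by simpa [dist_eq_norm] using hx
  have key := hC _ (comp_affine_mem_polyFun hq c h) B (fun y hy => hB _ ?_) (h⁻¹ • (x - c)) ?_
  · have hq' : q = (fun z => q (c + h • (-(h⁻¹ • c) + z))) ∘
        ⇑(h⁻¹ • ContinuousLinearMap.id ℝ (E N)) := by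
      ext z; simp [smul_smul, hh.ne']
    have hp : ContDiff ℝ i (fun z => q (c + h • (-(h⁻¹ • c) + z))) :=
      (contDiff_of_mem_polyFun hq).comp (by fun_prop)
    have hxz : -(h⁻¹ • c) + h⁻¹ • x = h⁻¹ • (x - c) := by rw [smul_sub]; abel
    conv_lhs => rw [hq']
    rw [ContinuousLinearMap.iteratedFDeriv_comp_right _ hp x le_rfl]
    rw [iteratedFDeriv_comp_add_left (f := fun z => q (c + h • z))]
    refine (ContinuousMultilinearMap.norm_compContinuousLinearMap_le _ _).trans ?_
    have hn : ‖h⁻¹ • ContinuousLinearMap.id ℝ (E N)‖ ≤ h⁻¹ := by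
      rw [norm_smul, Real.norm_of_nonneg (by positivity)]
      exact mul_le_of_le_one_right (by positivity) ContinuousLinearMap.norm_id_le
    simp only [smul_apply, ContinuousLinearMap.id_apply, hxz,
      Finset.prod_const, Finset.card_univ, Fintype.card_fin]
    have hCB : 0 ≤ C * B := (norm_nonneg _).trans key
    gcongr
  · simp only [Metric.mem_closedBall, dist_zero_right] at hy
    simp only [Metric.mem_closedBall, dist_self_add_left, norm_smul, Real.norm_of_nonneg hh.le]
    gcongr
  · simp only [Metric.mem_closedBall, dist_zero_right, norm_smul, norm_inv,
      Real.norm_of_nonneg hh.le]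
    rw [inv_mul_le_iff₀ hh]; simpa using hx'

/-- Derivatives of order larger than the degree vanish: a polynomial of degree `m` is `O(hᵐ)` on a
ball of radius `h`, and the inverse estimate gains `h⁻ⁱ`, as `h → ∞`. -/
theorem iteratedFDeriv_eq_zero_of_mem_polyFun {N m i : ℕ} (hi : m < i) {q : E N → ℝ}
    (hq : q ∈ polyFun N m) (x : E N) : iteratedFDeriv ℝ i q x = 0 := by
  obtain ⟨C, hC0, hC⟩ := exists_iteratedFDeriv_le N m i one_pos
  -- growth of order `m` at infinity
  have hgrow : ∃ D, ∀ h : ℝ, 1 ≤ h → ∀ y ∈ Metric.closedBall x h, |q y| ≤ D * h ^ m := by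
    obtain ⟨P, hP, rfl⟩ := mem_polyFun.1 hq
    refine ⟨∑ d ∈ P.support, |MvPolynomial.coeff d P| * (1 + ‖x‖) ^ m, fun h hh y hy => ?_⟩
    simp only [MvPolynomial.eval_eq', Finset.sum_mul]
    refine (Finset.abs_sum_le_sum_abs _ _).trans (Finset.sum_le_sum fun s hs => ?_)
    have hy' : ‖y‖ ≤ (1 + ‖x‖) * h := by
      have h1 : ‖y - x‖ ≤ h := by simpa [dist_eq_norm] using hy
      have h2 : ‖y‖ ≤ ‖y - x‖ + ‖x‖ := by simpa using norm_add_le (y - x) x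
      nlinarith [norm_nonneg x]
    have h1 : 1 ≤ (1 + ‖x‖) * h := by nlinarith [norm_nonneg x]
    rw [abs_mul, mul_assoc, ← mul_pow, Finset.abs_prod]
    refine mul_le_mul_of_nonneg_left ?_ (abs_nonneg _)
    calc ∏ j, |y j ^ s j| ≤ ∏ j, ((1 + ‖x‖) * h) ^ s j := by
          refine Finset.prod_le_prod (fun _ _ => abs_nonneg _) fun j _ => ?_
          rw [abs_pow]
          exact pow_le_pow_left₀ (abs_nonneg _) ((PiLp.norm_apply_le y j).trans hy') _
      _ = ((1 + ‖x‖) * h) ^ ∑ j, s j := Finset.prod_pow_eq_pow_sum _ _ _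
      _ ≤ _ := pow_le_pow_right₀ h1 (le_trans (by simp [Finsupp.sum_fintype])
          ((MvPolynomial.le_totalDegree hs).trans hP))
  obtain ⟨D, hD⟩ := hgrow
  have hlim : Tendsto (fun h : ℝ => C * D * h⁻¹) atTop (𝓝 (C * D * 0)) :=
    tendsto_inv_atTop_zero.const_mul _
  have hle : ‖iteratedFDeriv ℝ i q x‖ ≤ C * D * 0 := by
    refine ge_of_tendsto hlim ?_
    filter_upwards [eventually_ge_atTop 1] with h hh
    have h0 : 0 < h := by linarith
    have := hC q hq x h (D * h ^ m) h0 (by simpa using hD h hh) x (by simp [h0.le])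
    have hD0 : 0 ≤ D := by simpa using (abs_nonneg _).trans (hD 1 le_rfl x (by simp))
    refine this.trans ?_
    obtain ⟨j, rfl⟩ : ∃ j, i = m + 1 + j := ⟨i - (m + 1), by omega⟩
    have h3 : h ^ m * h⁻¹ ^ (m + 1 + j) = h⁻¹ * h⁻¹ ^ j := by
      rw [pow_add, pow_succ, inv_pow, inv_pow]; field_simp
    have h4 : h⁻¹ ^ j ≤ 1 := pow_le_one₀ (by positivity) (inv_le_one_of_one_le₀ hh)
    calc C * (D * h ^ m) * h⁻¹ ^ (m + 1 + j) = C * D * (h ^ m * h⁻¹ ^ (m + 1 + j)) := by ring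
      _ = C * D * (h⁻¹ * h⁻¹ ^ j) := by rw [h3]
      _ ≤ C * D * (h⁻¹ * 1) := by gcongr
      _ = _ := by ring
  rw [mul_zero] at hle
  exact norm_le_zero_iff.1 hle

/-- Bound of a linear form on polynomials by the `L²` norm on a ball: such a form is the scalar
product with some polynomial. -/
theorem exists_sq_le_integral (N m : ℕ) {ρ : ℝ} (hρ : 0 < ρ) (ℓ : Module.Dual ℝ (polyFun N m)) :
    ∃ C, 0 ≤ C ∧ ∀ q : polyFun N m,
      ℓ q ^ 2 ≤ C * ∫ y in Metric.closedBall (0 : E N) ρ, q.1 y ^ 2 := by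
  set S := Metric.closedBall (0 : E N) ρ
  have hint : ∀ p q : polyFun N m, IntegrableOn (fun y => p.1 y * q.1 y) S := fun p q =>
    ((contDiff_of_mem_polyFun p.2 (n := 0)).continuous.mul
      (contDiff_of_mem_polyFun q.2 (n := 0)).continuous).continuousOn.integrableOn_compact
      (isCompact_closedBall _ _)
  let L : polyFun N m →ₗ[ℝ] Module.Dual ℝ (polyFun N m) :=
    LinearMap.mk₂ ℝ (fun p q => ∫ y in S, p.1 y * q.1 y)
      (fun p p' q => by
        rw [← integral_add (hint _ _) (hint _ _)]
        simp [add_mul])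
      (fun a p q => by
        rw [smul_eq_mul, ← integral_const_mul]
        simp [mul_assoc])
      (fun p q q' => by
        rw [← integral_add (hint _ _) (hint _ _)]
        simp [mul_add])
      (fun a p q => by
        rw [smul_eq_mul, ← integral_const_mul]
        simp [mul_left_comm])
  have hL : ∀ p q, L p q = ∫ y in S, p.1 y * q.1 y := fun _ _ => rfl
  have hpos : ∀ p, 0 ≤ L p p := fun p => by
    rw [hL]; exact integral_nonneg fun y => mul_self_nonneg _
  -- the `L²` scalar product is definite: a polynomial that vanishes on a ball is zero
  have hinj : Function.Injective L := by
    rw [← LinearMap.ker_eq_bot, eq_bot_iff]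
    intro p hp
    have h0 : ∫ y in S, p.1 y * p.1 y = 0 := by
      rw [← hL, LinearMap.mem_ker.1 hp]; rfl
    rw [setIntegral_eq_zero_iff_of_nonneg_ae
      (Eventually.of_forall fun y => mul_self_nonneg _) (hint p p)] at h0
    have hEq := Measure.eqOn_of_ae_eq h0
      (by have := (contDiff_of_mem_polyFun p.2 (n := 0)).continuous; fun_prop)
      continuousOn_const ?_
    · exact Subtype.ext (eq_zero_of_closedBall p.2 hρ fun y hy => by simpa using hEq hy)
    · rw [interior_closedBall _ hρ.ne', closure_ball _ hρ.ne']
  obtain ⟨p, hp⟩ := (LinearMap.injective_iff_surjective_of_finrank_eq_finrank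
    (Subspace.dual_finrank_eq (K := ℝ) (V := polyFun N m)).symm).1 hinj ℓ
  refine ⟨L p p, hpos p, fun q => ?_⟩
  have hcs : (L p q) ^ 2 ≤ L p p * L q q := by
    have hsymm : L q p = L p q := by simp only [hL, mul_comm]
    have := discrim_le_zero (a := L q q) (b := 2 * L p q) (c := L p p) fun t => by
      have h := hpos (p + t • q)
      simp only [map_add, map_smul, LinearMap.add_apply, LinearMap.smul_apply, smul_eq_mul,
        hsymm] at h
      linarith
    rw [discrim] at this
    nlinarith
  rw [← hp]
  refine hcs.trans_eq ?_
  simp only [hL, sq]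

/-- On the unit ball, the maximum of a polynomial is bounded by its `L²` norm on a concentric
ball. -/
theorem exists_sq_le_integral_unit (N m : ℕ) {ρ : ℝ} (hρ : 0 < ρ) :
    ∃ C, 0 ≤ C ∧ ∀ q ∈ polyFun N m, ∀ y ∈ Metric.closedBall (0 : E N) 1,
      q y ^ 2 ≤ C * ∫ y in Metric.closedBall (0 : E N) ρ, q y ^ 2 := by
  let b := Module.finBasis ℝ (polyFun N m)
  have h1 := fun j => exists_sq_le_integral N m hρ (b.coord j)
  choose C hC0 hC using h1
  have h2 : ∀ j, ∃ D, ∀ y ∈ Metric.closedBall (0 : E N) 1, ‖(b j).1 y‖ ≤ D :=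
    fun j => (isCompact_closedBall _ _).exists_bound_of_continuousOn
      (contDiff_of_mem_polyFun (b j).2 (n := 0)).continuous.continuousOn
  choose D hD using h2
  refine ⟨(∑ j, C j) * ∑ j, D j ^ 2, mul_nonneg (Finset.sum_nonneg fun j _ => hC0 j)
    (Finset.sum_nonneg fun j _ => sq_nonneg _), fun q hq y hy => ?_⟩
  have hsum : q y = ∑ j, b.coord j ⟨q, hq⟩ * (b j).1 y := by
    have := congrFun (congrArg Subtype.val (b.sum_repr ⟨q, hq⟩)) y
    rw [Submodule.coe_sum, Finset.sum_apply] at this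
    exact this.symm
  set I := ∫ y in Metric.closedBall (0 : E N) ρ, q y ^ 2
  have hI : 0 ≤ I := integral_nonneg fun y => sq_nonneg _
  rw [hsum]
  calc _ ≤ (∑ j, b.coord j ⟨q, hq⟩ ^ 2) * ∑ j, (b j).1 y ^ 2 :=
        Finset.sum_mul_sq_le_sq_mul_sq _ _ _
    _ ≤ (∑ j, C j * I) * ∑ j, D j ^ 2 := by
        refine mul_le_mul (Finset.sum_le_sum fun j _ => hC j ⟨q, hq⟩)
          (Finset.sum_le_sum fun j _ => ?_) (Finset.sum_nonneg fun j _ => sq_nonneg _)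
          (Finset.sum_nonneg fun j _ => mul_nonneg (hC0 j) hI)
        exact sq_le_sq' (by linarith [abs_le.1 (hD j y hy)]) (abs_le.1 (hD j y hy)).2
    _ = _ := by rw [← Finset.sum_mul]; ring

/-- A polynomial on a ball of radius `h` is bounded by `h^{-N/2}` times its `L²` norm on a
concentric ball of radius proportional to `h`. -/
theorem exists_sq_le_integral_ball (N m : ℕ) {ρ : ℝ} (hρ : 0 < ρ) :
    ∃ C, 0 ≤ C ∧ ∀ q ∈ polyFun N m, ∀ (c : E N) (h : ℝ), 0 < h →
      ∀ x ∈ Metric.closedBall c h,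
        q x ^ 2 ≤ C * (h ^ N)⁻¹ * ∫ y in Metric.closedBall c (h * ρ), q y ^ 2 := by
  obtain ⟨C, hC0, hC⟩ := exists_sq_le_integral_unit N m hρ
  refine ⟨C, hC0, fun q hq c h hh x hx => ?_⟩
  have hx' : ‖x - c‖ ≤ h := by simpa [dist_eq_norm] using hx
  have key := hC _ (comp_affine_mem_polyFun hq c h) (h⁻¹ • (x - c)) ?_
  · rw [smul_smul, mul_inv_cancel₀ hh.ne', one_smul, add_sub_cancel] at key
    rw [Measure.setIntegral_comp_smul_of_pos volume (fun y => q (c + y) ^ 2) _ hh,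
      finrank_euclideanSpace_fin, smul_eq_mul, ← mul_assoc] at key
    refine key.trans_eq ?_
    congr 1
    rw [smul_closedBall _ _ hρ.le, smul_zero, Real.norm_of_nonneg hh.le]
    have := (measurePreserving_add_left (volume : Measure (E N)) c).setIntegral_preimage_emb
      (measurableEmbedding_addLeft c) (fun y => q y ^ 2) (Metric.closedBall c (h * ρ))
    rw [← this, preimage_add_closedBall, sub_self]
  · simp only [Metric.mem_closedBall, dist_zero_right, norm_smul, norm_inv,
      Real.norm_of_nonneg hh.le]
    rw [inv_mul_le_iff₀ hh]; simpa using hx'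

/-! ### Taylor polynomials -/

/-- The diagonal of a multilinear form, centred at `c`, is a polynomial. -/
theorem multilinear_diag_mem_polyFun {N i : ℕ} (c : E N)
    (A : ContinuousMultilinearMap ℝ (fun _ : Fin i => E N) ℝ) :
    (fun x => A fun _ => x - c) ∈ polyFun N i := by
  have hx : ∀ x : E N, x - c = ∑ j, (x j - c j) • EuclideanSpace.single j (1 : ℝ) := fun x => by
    ext l
    simp [Finset.sum_apply, Pi.single_apply]
  have : (fun x => A fun _ => x - c) = ∑ s : Fin i → Fin N,
      A (fun l => EuclideanSpace.single (s l) (1 : ℝ)) •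
        fun x : E N => ∏ l, (x (s l) - c (s l)) := by
    ext x
    rw [hx x, A.map_sum, Finset.sum_apply]
    refine Finset.sum_congr rfl fun s _ => ?_
    rw [A.map_smul_univ]
    simp [mul_comm]
  rw [this]
  refine Submodule.sum_mem _ fun s _ => Submodule.smul_mem _ _ ?_
  have h1 := prod_mem_polyFun (N := N) Finset.univ (fun _ : Fin i => 1)
    (fun l x => x (s l) - c (s l)) fun l _ =>
      Submodule.sub_mem _ (coord_mem_polyFun (s l)) (const_mem_polyFun (c (s l)))
  simpa using h1

/-- Taylor's theorem with a polynomial of degree at most `m`, on a set that is star-shaped about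
`c`. -/
theorem exists_taylor_polyFun {N m : ℕ} {G : E N → ℝ} {K : Set (E N)} {c : E N} {M : ℝ}
    (hc : c ∈ K) (hK : StarConvex ℝ c K) (hG : ∀ x ∈ K, ContDiffAt ℝ (m + 1 : ℕ) G x)
    (hM : ∀ i ≤ m + 1, ∀ x ∈ K, ‖iteratedFDeriv ℝ i G x‖ ≤ M) :
    ∃ P ∈ polyFun N m, (∀ x ∈ K, |G x - P x| ≤ M * ‖x - c‖ ^ (m + 1)) ∧
      ∀ x ∈ Metric.closedBall c 1, |P x| ≤ (m + 1) * M := by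
  have hM0 : 0 ≤ M := (norm_nonneg _).trans (hM 0 (by omega) c hc)
  have hfact : ∀ i : ℕ, ((i.factorial : ℝ))⁻¹ ≤ 1 := fun i =>
    inv_le_one_of_one_le₀ (by exact_mod_cast Nat.factorial_pos i)
  refine ⟨∑ i ∈ Finset.range (m + 1), (i.factorial : ℝ)⁻¹ • fun x =>
    iteratedFDeriv ℝ i G c fun _ => x - c, ?_, fun x hx => ?_, fun x hx => ?_⟩
  · refine Submodule.sum_mem _ fun i hi => Submodule.smul_mem _ _ ?_
    exact polyFun_mono (by simp at hi; omega) (multilinear_diag_mem_polyFun c _)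
  · have hseg : ∀ t ∈ Icc (0 : ℝ) 1, c + t • (x - c) ∈ K := fun t ht =>
      hK.add_smul_sub_mem hx ht.1 ht.2
    have h := map_add_eq_sum_add_integral_iteratedFDeriv (f := G) (x := c) (y := x - c) (n := m)
      fun t ht => by exact_mod_cast hG _ (hseg t ht)
    rw [add_sub_cancel] at h
    rw [h, Finset.sum_apply]
    simp only [Pi.smul_apply, add_sub_cancel_left]
    rw [smul_eq_mul, abs_mul]
    have hb : ∀ t ∈ uIoc (0 : ℝ) 1,
        ‖(1 - t) ^ m • iteratedFDeriv ℝ (m + 1) G (c + t • (x - c)) fun _ => x - c‖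
          ≤ M * ‖x - c‖ ^ (m + 1) := by
      intro t ht
      rw [uIoc_of_le zero_le_one] at ht
      have h1 : |(1 - t) ^ m| ≤ 1 := by
        rw [abs_pow, abs_of_nonneg (by linarith [ht.2])]
        exact pow_le_one₀ (by linarith [ht.2]) (by linarith [ht.1])
      have h2 := (iteratedFDeriv ℝ (m + 1) G (c + t • (x - c))).le_opNorm fun _ => x - c
      rw [Finset.prod_const, Finset.card_univ, Fintype.card_fin] at h2
      rw [norm_smul, Real.norm_eq_abs]
      calc _ ≤ 1 * (M * ‖x - c‖ ^ (m + 1)) := by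
            refine mul_le_mul h1 (h2.trans ?_) (norm_nonneg _) zero_le_one
            gcongr
            exact hM _ le_rfl _ (hseg t ⟨ht.1.le, ht.2⟩)
        _ = _ := one_mul _
    have h3 := intervalIntegral.norm_integral_le_of_norm_le_const hb
    rw [sub_zero, abs_one, mul_one, Real.norm_eq_abs] at h3
    calc _ ≤ 1 * (M * ‖x - c‖ ^ (m + 1)) := by
          refine mul_le_mul ?_ h3 (abs_nonneg _) zero_le_one
          rw [abs_of_nonneg (by positivity)]
          exact hfact m
      _ = _ := one_mul _
  · have hx1 : ‖x - c‖ ≤ 1 := by simpa [dist_eq_norm] using hx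
    rw [Finset.sum_apply]
    refine (Finset.abs_sum_le_sum_abs _ _).trans ?_
    calc _ ≤ ∑ _i ∈ Finset.range (m + 1), M := by
          refine Finset.sum_le_sum fun i hi => ?_
          rw [Pi.smul_apply, smul_eq_mul, abs_mul, abs_of_nonneg (by positivity)]
          have h2 := (iteratedFDeriv ℝ i G c).le_opNorm fun _ => x - c
          rw [Finset.prod_const, Finset.card_univ, Fintype.card_fin, Real.norm_eq_abs] at h2
          calc _ ≤ 1 * (M * 1) := by
                refine mul_le_mul (hfact i) (h2.trans ?_) (abs_nonneg _) zero_le_one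
                refine mul_le_mul (hM _ (by simp at hi; omega) _ hc)
                  (pow_le_one₀ (norm_nonneg _) hx1) (by positivity) hM0
            _ = M := by ring
      _ = _ := by simp

/-- A bound for the derivatives of a function near which a polynomial lies: the distance of the
polynomial to the Taylor polynomial is small, and the inverse estimate applies to it. -/
theorem exists_iteratedFDeriv_le_of_near (N k : ℕ) {κ : ℝ} (hκ : 0 < κ) (A M : ℝ) :
    ∃ D, 0 ≤ D ∧ ∀ (G q : E N → ℝ) (K : Set (E N)) (c : E N) (h : ℝ), 0 < h → h ≤ 1 →
      Metric.closedBall c (h / κ) ⊆ K → K ⊆ Metric.closedBall c h → StarConvex ℝ c K →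
      (∀ x ∈ K, ContDiffAt ℝ (k + 1 : ℕ) G x) →
      (∀ i ≤ k + 1, ∀ x ∈ K, ‖iteratedFDeriv ℝ i G x‖ ≤ M) →
      q ∈ polyFun N k → (∀ x ∈ K, |q x - G x| ≤ A * h ^ (k + 1)) →
      ∀ i, ∀ x ∈ K, ‖iteratedFDeriv ℝ i q x‖ ≤ D := by
  have hκ' : (0 : ℝ) < κ⁻¹ := inv_pos.2 hκ
  choose C hC0 hC using fun i => exists_iteratedFDeriv_le N k i hκ'
  choose C' hC'0 hC' using fun i => exists_iteratedFDeriv_le N k i one_pos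
  -- only the orders `i ≤ k` matter, since `q` has degree `k`
  refine ⟨∑ i ∈ Finset.range (k + 1), (C' i * ((k + 1) * |M|) + C i * (|A| + |M|)),
    Finset.sum_nonneg fun i _ => add_nonneg (mul_nonneg (hC'0 i) (by positivity))
      (mul_nonneg (hC0 i) (by positivity)), ?_⟩
  intro G q K c h hh hh1 hball hKball hstar hG hM hq hA i x hx
  have hnn : ∀ i ∈ Finset.range (k + 1), 0 ≤ C' i * ((k + 1) * |M|) + C i * (|A| + |M|) :=
    fun i _ => add_nonneg (mul_nonneg (hC'0 i) (by positivity))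
      (mul_nonneg (hC0 i) (by positivity))
  rcases lt_or_ge k i with hi | hi
  · rw [iteratedFDeriv_eq_zero_of_mem_polyFun hi hq, norm_zero]
    exact Finset.sum_nonneg hnn
  refine le_trans ?_ (Finset.single_le_sum hnn (Finset.mem_range.2 (Nat.lt_succ_of_le hi)))
  have hc : c ∈ K := hball (Metric.mem_closedBall_self (by positivity))
  obtain ⟨P, hP, hPG, hP1⟩ := exists_taylor_polyFun hc hstar hG hM
  have hsum : q = P + (q - P) := by simp
  have hsub : q - P ∈ polyFun N k := Submodule.sub_mem _ hq hP
  have hxh : x ∈ Metric.closedBall c h := hKball hx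
  have hx1 : x ∈ Metric.closedBall c 1 := Metric.closedBall_subset_closedBall hh1 hxh
  rw [hsum, iteratedFDeriv_add_apply (contDiff_of_mem_polyFun hP).contDiffAt
    (contDiff_of_mem_polyFun hsub).contDiffAt]
  refine (norm_add_le _ _).trans (add_le_add ?_ ?_)
  · have := hC' i P hP c 1 ((k + 1) * |M|) one_pos
      (fun y hy => (hP1 y (by simpa using hy)).trans ?_) x hx1
    · simpa using this
    · gcongr; exact le_abs_self M
  · have := hC i _ hsub c h ((|A| + |M|) * h ^ (k + 1)) hh (fun y hy => ?_) x hxh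
    · refine this.trans ?_
      have h1 : h ^ (k + 1) * h⁻¹ ^ i ≤ 1 := by
        rw [inv_pow, ← div_eq_mul_inv, div_le_one (by positivity)]
        exact pow_le_pow_of_le_one hh.le hh1 (by omega)
      calc _ = C i * (|A| + |M|) * (h ^ (k + 1) * h⁻¹ ^ i) := by ring
        _ ≤ C i * (|A| + |M|) * 1 := by
            have := hC0 i
            gcongr
        _ = _ := mul_one _
    · have hyK : y ∈ K := hball (by rwa [div_eq_mul_inv])
      have hyh : ‖y - c‖ ≤ h := by simpa [dist_eq_norm] using hKball hyK
      have hM0 : 0 ≤ M := (norm_nonneg _).trans (hM 0 (by omega) c hc)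
      have h2 : |G y - P y| ≤ |M| * h ^ (k + 1) := (hPG y hyK).trans
        (mul_le_mul (le_abs_self M) (pow_le_pow_left₀ (norm_nonneg _) hyh _) (by positivity)
          (abs_nonneg _))
      have h3 : |q y - G y| ≤ |A| * h ^ (k + 1) := (hA y hyK).trans
        (mul_le_mul_of_nonneg_right (le_abs_self A) (by positivity))
      have : (q - P) y = (q y - G y) + (G y - P y) := by simp
      rw [this, add_mul]
      exact (abs_add_le _ _).trans (add_le_add h3 h2)

/-! ### The divergence theorem on a convex body with flat faces -/

section Cone

open Pointwise

variable {m : ℕ}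

/-- Orthogonal coordinates adapted to a unit vector `n` preserve the volume. -/
theorem measurePreserving_normalCoord {n : E (m + 1)} (hn : ‖n‖ = 1) (c : E (m + 1)) :
    MeasurePreserving (fun q : ℝ × (ℝ ∙ n)ᗮ => c + (q.1 • n + (q.2 : E (m + 1))))
      (volume.prod volume) volume ∧
    MeasurableEmbedding (fun q : ℝ × (ℝ ∙ n)ᗮ => c + (q.1 • n + (q.2 : E (m + 1)))) := by
  have h1 := ((ℝ ∙ n).measurePreserving_measurableEquivProd c).symm
  rw [InnerProductSpace.euclideanHausdorffMeasure_eq_volume] at h1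
  let e := LinearIsometryEquiv.toSpanUnitSingleton (𝕜 := ℝ) n hn
  have h2 : MeasurePreserving (Prod.map e (id : (ℝ ∙ n)ᗮ → _))
      (volume.prod volume) (volume.prod volume) :=
    e.measurePreserving.prod (MeasurePreserving.id _)
  have h3 : MeasurableEmbedding (Prod.map e (id : (ℝ ∙ n)ᗮ → _)) :=
    (MeasurableEquiv.prodCongr e.toHomeomorph.toMeasurableEquiv
      (MeasurableEquiv.refl _)).measurableEmbedding
  have heq : (fun q : ℝ × (ℝ ∙ n)ᗮ => c + (q.1 • n + (q.2 : E (m + 1))))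
      = ((ℝ ∙ n).measurableEquivProd c).symm ∘ Prod.map e id := by
    ext1 q
    simp [e, add_comm]
  rw [heq]
  exact ⟨h1.comp h2, ((ℝ ∙ n).measurableEquivProd c).symm.measurableEmbedding.comp h3⟩

theorem euclideanHausdorffMeasure_orthogonal {n : E (m + 1)} (hn : ‖n‖ = 1) :
    (μHE[m] : Measure (ℝ ∙ n)ᗮ) = volume := by
  have hfin : Module.finrank ℝ (ℝ ∙ n)ᗮ = m := by
    have h := (ℝ ∙ n).finrank_add_finrank_orthogonal
    rw [finrank_span_singleton (by rintro rfl; simp at hn), finrank_euclideanSpace_fin] at h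
    omega
  rw [← InnerProductSpace.euclideanHausdorffMeasure_eq_volume (V := (ℝ ∙ n)ᗮ), hfin]

theorem isometry_normalSection (n c : E (m + 1)) (t : ℝ) :
    Isometry (fun z : (ℝ ∙ n)ᗮ => c + (t • n + (z : E (m + 1)))) :=
  Isometry.of_dist_eq fun z w => by simp [Subtype.dist_eq]

theorem inner_normal_coe {n : E (m + 1)} (z : (ℝ ∙ n)ᗮ) : inner ℝ (z : E (m + 1)) n = 0 := by
  rw [real_inner_comm]
  exact Submodule.mem_orthogonal_singleton_iff_inner_right.1 z.2

/-- Points of the hyperplane `⟨y - c, n⟩ = t` in orthogonal coordinates. -/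
theorem exists_normalSection {n c y : E (m + 1)} {t : ℝ} (hn : ‖n‖ = 1)
    (hy : inner ℝ (y - c) n = t) : ∃ z : (ℝ ∙ n)ᗮ, c + (t • n + (z : E (m + 1))) = y := by
  refine ⟨⟨y - c - t • n, ?_⟩, by simp⟩
  rw [Submodule.mem_orthogonal_singleton_iff_inner_right, inner_sub_right, inner_smul_right,
    real_inner_self_eq_norm_sq, hn, real_inner_comm, hy]
  simp

/-- Surface integrals over a subset of a hyperplane, in orthogonal coordinates. -/
theorem setIntegral_hyperplane {n c : E (m + 1)} {t : ℝ} (hn : ‖n‖ = 1) {f : Set (E (m + 1))}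
    (hf : MeasurableSet f) (hft : ∀ y ∈ f, inner ℝ (y - c) n = t) (g : E (m + 1) → ℝ) :
    ∫ y in f, g y ∂μHE[m] = ∫ z in (fun z : (ℝ ∙ n)ᗮ => c + (t • n + (z : E (m + 1)))) ⁻¹' f,
      g (c + (t • n + (z : E (m + 1)))) := by
  have hiso := isometry_normalSection n c t
  have hemb : MeasurableEmbedding (fun z : (ℝ ∙ n)ᗮ => c + (t • n + (z : E (m + 1)))) :=
    hiso.isClosedEmbedding.measurableEmbedding
  have hrange : f ⊆ range (fun z : (ℝ ∙ n)ᗮ => c + (t • n + (z : E (m + 1)))) := fun y hy =>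
    exists_normalSection hn (hft y hy)
  have hmap := hiso.map_euclideanHausdorffMeasure (d := m)
  rw [euclideanHausdorffMeasure_orthogonal hn] at hmap
  rw [← hemb.setIntegral_map, hmap, Measure.restrict_restrict hf, inter_eq_left.2 hrange]

theorem measure_hyperplane_lt_top {n c : E (m + 1)} {t : ℝ} (hn : ‖n‖ = 1) {f : Set (E (m + 1))}
    (hf : IsCompact f) (hft : ∀ y ∈ f, inner ℝ (y - c) n = t) : μHE[m] f < ⊤ := by
  have hiso := isometry_normalSection n c t
  have hrange : f ⊆ range (fun z : (ℝ ∙ n)ᗮ => c + (t • n + (z : E (m + 1)))) := fun y hy =>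
    exists_normalSection hn (hft y hy)
  rw [← inter_eq_left.2 hrange, ← hiso.euclideanHausdorffMeasure_preimage,
    euclideanHausdorffMeasure_orthogonal hn]
  exact (hiso.isClosedEmbedding.isCompact_preimage hf).measure_lt_top

/-- The cone with apex `c` over the set `f`. -/
def coneOver {N : ℕ} (c : E N) (f : Set (E N)) : Set (E N) :=
  (fun q : ℝ × E N => c + q.1 • (q.2 - c)) '' (Icc 0 1 ×ˢ f)

theorem isCompact_coneOver {N : ℕ} {c : E N} {f : Set (E N)} (hf : IsCompact f) :
    IsCompact (coneOver c f) :=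
  (isCompact_Icc.prod hf).image (by fun_prop)

theorem mem_coneOver {N : ℕ} {c x : E N} {f : Set (E N)} :
    x ∈ coneOver c f ↔ ∃ s ∈ Icc (0 : ℝ) 1, ∃ y ∈ f, c + s • (y - c) = x := by
  simp [coneOver, and_assoc]

/-- Integration over the cone with apex `c` over a flat set `f` at distance `t` from `c`. -/
theorem setIntegral_coneOver {n c : E (m + 1)} {t : ℝ} (hn : ‖n‖ = 1) (ht : 0 < t)
    {f : Set (E (m + 1))} (hf : IsCompact f) (hft : ∀ y ∈ f, inner ℝ (y - c) n = t)
    {G : E (m + 1) → ℝ} (hG : ContinuousOn G (coneOver c f)) :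
    ∫ x in coneOver c f, G x
      = t * ∫ y in f, (∫ s in (0 : ℝ)..1, s ^ m * G (c + s • (y - c))) ∂μHE[m] := by
  obtain ⟨hmp, hemb⟩ := measurePreserving_normalCoord hn c
  set Φ := fun q : ℝ × (ℝ ∙ n)ᗮ => c + (q.1 • n + (q.2 : E (m + 1))) with hΦ
  set j := fun z : (ℝ ∙ n)ᗮ => c + (t • n + (z : E (m + 1))) with hj
  set F := j ⁻¹' f with hF
  have hFc : IsCompact F := (isometry_normalSection n c t).isClosedEmbedding.isCompact_preimage hf
  have hcone := isCompact_coneOver (c := c) hf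
  have hGi : IntegrableOn G (coneOver c f) := hG.integrableOn_compact hcone
  have hfinZ : Module.finrank ℝ (ℝ ∙ n)ᗮ = m := by
    have h := (ℝ ∙ n).finrank_add_finrank_orthogonal
    rw [finrank_span_singleton (by rintro rfl; simp at hn), finrank_euclideanSpace_fin] at h
    omega
  -- the cone in orthogonal coordinates
  have hmem : ∀ (τ : ℝ) (z : (ℝ ∙ n)ᗮ), Φ (τ, z) ∈ coneOver c f ↔
      τ ∈ Icc 0 t ∧ ∃ w ∈ F, z = (τ / t) • w := by
    intro τ z
    rw [mem_coneOver]
    constructor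
    · rintro ⟨s, hs, y, hy, h⟩
      obtain ⟨w, hw⟩ := exists_normalSection hn (hft y hy)
      have h1 : s • (y - c) = τ • n + (z : E (m + 1)) := by simpa [hΦ] using h
      have h2 : s * t = τ := by
        have := congrArg (fun v => inner ℝ v n) h1
        simpa [inner_smul_left, inner_add_left, hft y hy, inner_normal_coe,
          real_inner_self_eq_norm_sq, hn] using this
      refine ⟨⟨by rw [← h2]; exact mul_nonneg hs.1 ht.le, by
        rw [← h2]; exact mul_le_of_le_one_left ht.le hs.2⟩, w, by
        rw [hF, mem_preimage, hj]; simpa [hw] using hy, ?_⟩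
      apply Subtype.ext
      rw [← h2, mul_div_cancel_right₀ _ ht.ne', Submodule.coe_smul]
      rw [← hw, add_sub_cancel_left, smul_add, smul_smul, h2] at h1
      exact (add_left_cancel h1).symm
    · rintro ⟨hτ, w, hw, rfl⟩
      refine ⟨τ / t, ⟨div_nonneg hτ.1 ht.le, (div_le_one ht).2 hτ.2⟩, j w, hw, ?_⟩
      simp only [hj, hΦ, add_sub_cancel_left, smul_add, smul_smul, div_mul_cancel₀ _ ht.ne',
        Submodule.coe_smul]
  -- The slice at height `τ` is `F` scaled by `τ / t`. The height `τ = 0` of the apex is left out: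
  -- the indicator on the right vanishes there, and a single height is a null set.
  have hslice : ∀ τ : ℝ, (∫ z, (Φ ⁻¹' coneOver c f).indicator (fun q => G (Φ q)) (τ, z))
      = (Ioc 0 t).indicator
        (fun τ => (τ / t) ^ m * ∫ w in F, G (c + (τ / t) • (j w - c))) τ ∨ τ = 0 := by
    intro τ
    rcases eq_or_ne τ 0 with h0 | h0
    · exact Or.inr h0
    left
    by_cases hτ : τ ∈ Ioc 0 t
    · rw [indicator_of_mem hτ]
      have hs : 0 < τ / t := div_pos hτ.1 ht
      have hind : (fun z => (Φ ⁻¹' coneOver c f).indicator (fun q => G (Φ q)) (τ, z))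
          = ((τ / t) • F).indicator fun z => G (Φ (τ, z)) := by
        ext z
        by_cases hz : z ∈ (τ / t) • F
        · obtain ⟨w, hw, rfl⟩ := hz
          rw [indicator_of_mem (by exact (hmem _ _).2 ⟨⟨hτ.1.le, hτ.2⟩, w, hw, rfl⟩),
            indicator_of_mem (smul_mem_smul_set hw)]
        · rw [indicator_of_notMem hz, indicator_of_notMem]
          intro h
          obtain ⟨_, w, hw, rfl⟩ := (hmem _ _).1 h
          exact hz ⟨w, hw, rfl⟩
      rw [hind, integral_indicator (hFc.smul _).measurableSet]
      have := Measure.setIntegral_comp_smul_of_pos (volume : Measure (ℝ ∙ n)ᗮ)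
        (fun z => G (Φ (τ, z))) F hs
      rw [hfinZ, smul_eq_mul] at this
      have h2 : ∀ w : (ℝ ∙ n)ᗮ, Φ (τ, (τ / t) • w) = c + (τ / t) • (j w - c) := by
        intro w
        simp only [hj, hΦ, add_sub_cancel_left, smul_add, smul_smul, div_mul_cancel₀ _ ht.ne',
          Submodule.coe_smul]
      simp only [h2] at this
      rw [this, ← mul_assoc, mul_inv_cancel₀ (by positivity), one_mul]
    · rw [indicator_of_notMem hτ]
      have : ∀ z, (Φ ⁻¹' coneOver c f).indicator (fun q => G (Φ q)) (τ, z) = 0 := fun z => by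
        refine indicator_of_notMem (fun h => hτ ?_) _
        have := ((hmem _ _).1 h).1
        exact ⟨lt_of_le_of_ne this.1 (Ne.symm h0), this.2⟩
      simp [this]
  have hmeas : MeasurableSet (Φ ⁻¹' coneOver c f) :=
    hemb.measurable hcone.measurableSet
  have hint : Integrable ((Φ ⁻¹' coneOver c f).indicator fun q => G (Φ q))
      ((volume : Measure ℝ).prod (volume : Measure (ℝ ∙ n)ᗮ)) := by
    rw [integrable_indicator_iff hmeas]
    exact (hmp.integrableOn_comp_preimage hemb).2 hGi
  -- Fubini in the orthogonal coordinates, then rescaling of the slices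
  have h1 : ∫ x in coneOver c f, G x
      = ∫ τ in (0 : ℝ)..t, (τ / t) ^ m * ∫ w in F, G (c + (τ / t) • (j w - c)) := by
    rw [← hmp.setIntegral_preimage_emb hemb, ← integral_indicator hmeas, integral_prod _ hint,
      intervalIntegral.integral_of_le ht.le, ← integral_indicator measurableSet_Ioc]
    refine integral_congr_ae ?_
    have : ∀ᵐ τ : ℝ, τ ≠ 0 := by simp [ae_iff]
    filter_upwards [this] with τ hτ
    exact (hslice τ).resolve_right hτ
  have h2 := intervalIntegral.integral_comp_div
    (f := fun s => s ^ m * ∫ w in F, G (c + s • (j w - c))) (a := 0) (b := t) ht.ne'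
  rw [zero_div, div_self ht.ne', smul_eq_mul] at h2
  rw [h1, h2, setIntegral_hyperplane hn hf.measurableSet hft]
  congr 1
  have hcont : ContinuousOn (fun q : ℝ × (ℝ ∙ n)ᗮ => q.1 ^ m * G (c + q.1 • (j q.2 - c)))
      (Icc 0 1 ×ˢ F) := by
    refine ContinuousOn.mul (by fun_prop) (hG.comp ?_ ?_)
    · simp only [hj]; fun_prop
    · rintro ⟨s, w⟩ ⟨hs, hw⟩
      exact mem_coneOver.2 ⟨s, hs, j w, hw, rfl⟩
  have hi2 : IntegrableOn (fun q : ℝ × (ℝ ∙ n)ᗮ => q.1 ^ m * G (c + q.1 • (j q.2 - c)))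
      (Ioc 0 1 ×ˢ F) (volume.prod volume) :=
    (hcont.integrableOn_compact (isCompact_Icc.prod hFc)).mono_set
      (prod_mono Ioc_subset_Icc_self le_rfl)
  simp only [intervalIntegral.integral_of_le zero_le_one, ← integral_const_mul]
  refine integral_integral_swap (f := fun s w => s ^ m * G (c + s • (j w - c))) ?_
  rw [Measure.prod_restrict]
  exact hi2

end Cone

section ConvexBody

open Pointwise

variable {m : ℕ}

/-- From an interior point of a convex body, every other point of the body is seen on a segment that
ends at the boundary. -/
theorem exists_frontier_of_mem {N : ℕ} {K : Set (E N)} (hK : IsCompact K) {c x : E N}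
    (hx : x ∈ K) (hxc : x ≠ c) :
    ∃ s ∈ Icc (0 : ℝ) 1, ∃ y ∈ frontier K, c + s • (y - c) = x := by
  have hxc' : 0 < ‖x - c‖ := norm_pos_iff.2 (sub_ne_zero.2 hxc)
  obtain ⟨R, hR⟩ := hK.isBounded.subset_closedBall c
  have hcont : Continuous fun s : ℝ => c + s • (x - c) := by fun_prop
  let S := {s : ℝ | c + s • (x - c) ∈ K} ∩ Icc 1 (R / ‖x - c‖)
  have hS : IsCompact S := isCompact_Icc.inter_left (hK.isClosed.preimage hcont)
  have hbound : ∀ s : ℝ, 0 ≤ s → c + s • (x - c) ∈ K → s ≤ R / ‖x - c‖ := fun s hs hsK => by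
    have := hR hsK
    rw [Metric.mem_closedBall, dist_self_add_left, norm_smul, Real.norm_of_nonneg hs] at this
    rwa [le_div_iff₀ hxc']
  have h1 : (1 : ℝ) ∈ S :=
    ⟨by simpa using hx, le_rfl, hbound 1 zero_le_one (by simpa using hx)⟩
  obtain ⟨s, hs, hmax⟩ := hS.exists_isGreatest ⟨1, h1⟩
  have hs1 : 1 ≤ s := hs.2.1
  have hs0 : 0 < s := by linarith
  refine ⟨s⁻¹, ⟨by positivity, inv_le_one_of_one_le₀ hs1⟩, c + s • (x - c), ?_, ?_⟩
  · rw [hK.isClosed.frontier_eq]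
    refine ⟨hs.1, fun hint => ?_⟩
    have hnh : ∀ᶠ t in 𝓝 s, c + t • (x - c) ∈ K :=
      (hcont.continuousAt (x := s)).eventually (mem_interior_iff_mem_nhds.1 hint)
    obtain ⟨t, htK, hts⟩ := ((hnh.filter_mono nhdsWithin_le_nhds).and
      (self_mem_nhdsWithin : Ioi s ∈ 𝓝[>] s)).exists
    have ht1 : s < t := hts
    exact absurd (hmax ⟨htK, by linarith, hbound t (by linarith) htK⟩) (not_le.2 ht1)
  · rw [add_sub_cancel_left, smul_smul, inv_mul_cancel₀ hs0.ne', one_smul, add_sub_cancel]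

/-- A convex body whose boundary is covered by finitely many compact pieces, each lying in a
supporting hyperplane with unit outward normal `n i`; the pieces overlap in null sets only. -/
structure FlatBoundary {ι : Type*} (K : Set (E (m + 1))) (fc : ι → Set (E (m + 1)))
    (n : ι → E (m + 1)) : Prop where
  isCompact : IsCompact K
  convex : Convex ℝ K
  isCompact_face : ∀ i, IsCompact (fc i)
  nonempty_face : ∀ i, (fc i).Nonempty
  face_subset : ∀ i, fc i ⊆ K
  norm_normal : ∀ i, ‖n i‖ = 1
  support : ∀ i, ∀ y ∈ fc i, ∀ x ∈ K, inner ℝ (x - y) (n i) ≤ 0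
  cover : frontier K ⊆ ⋃ i, fc i
  null_inter : Pairwise fun i j => μHE[m] (fc i ∩ fc j) = 0

namespace FlatBoundary

variable {ι : Type*} {K : Set (E (m + 1))} {fc : ι → Set (E (m + 1))} {n : ι → E (m + 1)}
  (hB : FlatBoundary K fc n)

include hB

/-- A body that contains a ball lies on the inner side of its supporting hyperplanes, at a distance
at least the radius from the centre. -/
theorem le_inner_of_closedBall {c : E (m + 1)} {r : ℝ} (hr : 0 ≤ r)
    (hc : Metric.closedBall c r ⊆ K) {i : ι} {y : E (m + 1)} (hy : y ∈ fc i) :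
    r ≤ inner ℝ (y - c) (n i) := by
  have hx : c + r • n i ∈ K := hc (by
    rw [Metric.mem_closedBall, dist_self_add_left, norm_smul, hB.norm_normal,
      Real.norm_of_nonneg hr, mul_one])
  have h := hB.support i y hy _ hx
  have he : c + r • n i - y = r • n i - (y - c) := by abel
  rw [he, inner_sub_left, inner_smul_left, real_inner_self_eq_norm_sq, hB.norm_normal] at h
  simp at h
  linarith

theorem inner_eq {c : E (m + 1)} {i : ι} {y y' : E (m + 1)} (hy : y ∈ fc i) (hy' : y' ∈ fc i) :
    inner ℝ (y - c) (n i) = inner ℝ (y' - c) (n i) := by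
  have h1 := hB.support i y hy y' (hB.face_subset i hy')
  have h2 := hB.support i y' hy' y (hB.face_subset i hy)
  have e1 : y' - y = (y' - c) - (y - c) := by abel
  have e2 : y - y' = (y - c) - (y' - c) := by abel
  rw [e1, inner_sub_left] at h1
  rw [e2, inner_sub_left] at h2
  linarith

theorem measure_face_lt_top (i : ι) : μHE[m] (fc i) < ⊤ := by
  obtain ⟨y, hy⟩ := hB.nonempty_face i
  exact measure_hyperplane_lt_top (c := 0) (hB.norm_normal i) (hB.isCompact_face i)
    fun y' hy' => hB.inner_eq hy' hy

theorem integrableOn_face {i : ι} {g : E (m + 1) → ℝ} (hg : ContinuousOn g (fc i)) :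
    IntegrableOn g (fc i) μHE[m] := by
  obtain ⟨C, hC⟩ := (hB.isCompact_face i).exists_bound_of_continuousOn hg
  have : IsFiniteMeasure ((μHE[m] : Measure (E (m + 1))).restrict (fc i)) :=
    ⟨by simpa using hB.measure_face_lt_top i⟩
  exact Integrable.of_bound (hg.aestronglyMeasurable (hB.isCompact_face i).measurableSet) C
    ((ae_restrict_mem (hB.isCompact_face i).measurableSet).mono hC)

theorem exists_inner_pos {c : E (m + 1)} (hc : c ∈ interior K) (i : ι) :
    ∃ t, 0 < t ∧ ∀ y ∈ fc i, inner ℝ (y - c) (n i) = t := by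
  obtain ⟨y, hy⟩ := hB.nonempty_face i
  obtain ⟨r, hr, hsub⟩ := Metric.nhds_basis_closedBall.mem_iff.1 (mem_interior_iff_mem_nhds.1 hc)
  exact ⟨_, hr.trans_le (hB.le_inner_of_closedBall hr.le hsub hy), fun y' hy' => hB.inner_eq hy' hy⟩

theorem coneOver_subset {c : E (m + 1)} (hc : c ∈ K) (i : ι) : coneOver c (fc i) ⊆ K := by
  intro x hx
  obtain ⟨s, hs, y, hy, rfl⟩ := mem_coneOver.1 hx
  exact (hB.convex.starConvex hc).add_smul_sub_mem (hB.face_subset i hy) hs.1 hs.2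

/-- Two of the cones meet, apart from the apex, above the intersection of their bases only. -/
theorem coneOver_inter_subset {c : E (m + 1)} (hc : c ∈ interior K) (i j : ι) :
    coneOver c (fc i) ∩ coneOver c (fc j) ⊆ coneOver c (fc i ∩ fc j) ∪ {c} := by
  rintro x ⟨hx, hx'⟩
  obtain ⟨s, hs, y, hy, h⟩ := mem_coneOver.1 hx
  obtain ⟨s', hs', y', hy', h'⟩ := mem_coneOver.1 hx'
  -- the base `fc j` lies on the inner side of the hyperplane of `fc i`
  have key : ∀ (i j : ι) (s s' : ℝ) (y y' : E (m + 1)), 0 ≤ s' → y ∈ fc i → y' ∈ fc j →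
      s • (y - c) = s' • (y' - c) → s ≤ s' := by
    intro i j s s' y y' hs' hy hy' h
    obtain ⟨t, ht, hti⟩ := hB.exists_inner_pos hc i
    have h1 : s * t = s' * inner ℝ (y' - c) (n i) := by
      have := congrArg (fun v => inner ℝ v (n i)) h
      simpa [inner_smul_left, hti y hy] using this
    have h2 : inner ℝ (y' - c) (n i) ≤ t := by
      have h3 := hB.support i y hy y' (hB.face_subset j hy')
      have e1 : y' - y = (y' - c) - (y - c) := by abel
      rw [e1, inner_sub_left, hti y hy] at h3
      linarith
    have h4 : s * t ≤ s' * t := h1.trans_le (mul_le_mul_of_nonneg_left h2 hs')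
    exact le_of_mul_le_mul_right h4 ht
  have heq : s • (y - c) = s' • (y' - c) := add_left_cancel (h.trans h'.symm)
  have hss : s = s' := le_antisymm (key i j s s' y y' hs'.1 hy hy' heq)
    (key j i s' s y' y hs.1 hy' hy heq.symm)
  subst hss
  rcases eq_or_ne s 0 with h0 | h0
  · right; rw [← h, h0]; simp
  · left
    have hyy : y = y' := by simpa using smul_right_injective _ h0 heq
    exact mem_coneOver.2 ⟨s, hs, y, ⟨hy, hyy ▸ hy'⟩, h⟩

theorem setIntegral_eq_sum_coneOver [Fintype ι] {c : E (m + 1)} (hc : c ∈ interior K)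
    {G : E (m + 1) → ℝ} (hG : ContinuousOn G K) :
    ∫ x in K, G x = ∑ i, ∫ x in coneOver c (fc i), G x := by
  have hcK : c ∈ K := interior_subset hc
  have hsub : ⋃ i, coneOver c (fc i) ⊆ K := iUnion_subset (hB.coneOver_subset hcK)
  have hae : K =ᵐ[volume] ⋃ i, coneOver c (fc i) := by
    refine ae_eq_set.2 ⟨measure_mono_null ?_ (measure_singleton c), by
      rw [sdiff_eq_empty.2 hsub, measure_empty]⟩
    rintro x ⟨hx, hx'⟩
    by_contra hxc
    obtain ⟨s, hs, y, hy, h⟩ := exists_frontier_of_mem hB.isCompact hx hxc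
    obtain ⟨i, hi⟩ := mem_iUnion.1 (hB.cover hy)
    exact hx' (mem_iUnion.2 ⟨i, mem_coneOver.2 ⟨s, hs, y, hi, h⟩⟩)
  rw [setIntegral_congr_set hae, integral_iUnion_ae, tsum_fintype]
  · exact fun i => (isCompact_coneOver (hB.isCompact_face i)).measurableSet.nullMeasurableSet
  · intro i j hij
    refine measure_mono_null (hB.coneOver_inter_subset hc i j) (measure_union_null ?_ (by simp))
    -- the cone over a null base is null, by the cone formula for the constant function 1
    obtain ⟨t, ht, hti⟩ := hB.exists_inner_pos hc i
    have hcomp := (hB.isCompact_face i).inter (hB.isCompact_face j)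
    have h := setIntegral_coneOver (hB.norm_normal i) ht hcomp (fun y hy => hti y hy.1)
      (G := fun _ => 1) continuousOn_const
    rw [Measure.restrict_eq_zero.2 (hB.null_inter hij)] at h
    simp only [integral_zero_measure, mul_zero, setIntegral_const, smul_eq_mul, mul_one] at h
    exact (measureReal_eq_zero_iff (isCompact_coneOver hcomp).measure_lt_top.ne).1 h
  · exact (hG.integrableOn_compact hB.isCompact).mono_set hsub

/-- The divergence theorem for the radial field `(x - c) Q`: on the cone over a face, integrate
`d/ds (s^(m+1) Q(c + s(y - c)))` along the rays. -/
theorem radial_divergence [Fintype ι] {c : E (m + 1)} (hc : c ∈ interior K) {Q : E (m + 1) → ℝ}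
    (hQ : ∀ x ∈ K, ContDiffAt ℝ 1 Q x) :
    ∫ x in K, ((m + 1) * Q x + fderiv ℝ Q x (x - c))
      = ∑ i, ∫ y in fc i, inner ℝ (y - c) (n i) * Q y ∂μHE[m] := by
  have hcK : c ∈ K := interior_subset hc
  have hG : ContinuousOn (fun x => (m + 1) * Q x + fderiv ℝ Q x (x - c)) K := by
    intro x hx
    refine ContinuousAt.continuousWithinAt ?_
    have h1 : ContinuousAt (fderiv ℝ Q) x :=
      ((hQ x hx).fderiv_right (m := 0) (by simp)).continuousAt
    have h2 := (hQ x hx).continuousAt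
    fun_prop
  rw [hB.setIntegral_eq_sum_coneOver hc hG]
  refine Finset.sum_congr rfl fun i _ => ?_
  obtain ⟨t, ht, hti⟩ := hB.exists_inner_pos hc i
  rw [setIntegral_coneOver (hB.norm_normal i) ht (hB.isCompact_face i) hti
    (hG.mono (hB.coneOver_subset hcK i)), ← integral_const_mul]
  refine setIntegral_congr_fun (hB.isCompact_face i).measurableSet fun y hy => ?_
  simp only [hti y hy]
  congr 1
  have hmem : ∀ s ∈ uIcc (0 : ℝ) 1, c + s • (y - c) ∈ K := fun s hs => by
    rw [uIcc_of_le zero_le_one] at hs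
    exact hB.coneOver_subset hcK i (mem_coneOver.2 ⟨s, hs, y, hy, rfl⟩)
  have hderiv : ∀ s ∈ uIcc (0 : ℝ) 1, HasDerivAt (fun s : ℝ => s ^ (m + 1) * Q (c + s • (y - c)))
      (s ^ m * ((m + 1) * Q (c + s • (y - c))
        + fderiv ℝ Q (c + s • (y - c)) (c + s • (y - c) - c))) s := by
    intro s hs
    have h1 : HasFDerivAt Q (fderiv ℝ Q (c + s • (y - c))) (c + s • (y - c)) :=
      ((hQ _ (hmem s hs)).differentiableAt (by simp)).hasFDerivAt
    have h2 : HasDerivAt (fun s : ℝ => c + s • (y - c)) (y - c) s := by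
      simpa using ((hasDerivAt_id s).smul_const (y - c)).const_add c
    have h3 := (hasDerivAt_pow (m + 1) s).mul (h1.comp_hasDerivAt s h2)
    refine h3.congr_deriv ?_
    simp only [add_sub_cancel_left, map_smul, smul_eq_mul, Function.comp]
    push_cast
    ring
  rw [intervalIntegral.integral_eq_sub_of_hasDerivAt hderiv]
  · simp
  · refine ContinuousOn.intervalIntegrable (ContinuousOn.mul (by fun_prop) ?_)
    exact hG.comp (by fun_prop) hmem

/-- The divergence theorem. A constant field is a difference of two radial fields with different
centres. -/
theorem divergence [Fintype ι] (hint : (interior K).Nonempty) {Q : E (m + 1) → ℝ}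
    (hQ : ∀ x ∈ K, ContDiffAt ℝ 1 Q x) (e : E (m + 1)) :
    ∫ x in K, fderiv ℝ Q x e = ∑ i, inner ℝ e (n i) * ∫ y in fc i, Q y ∂μHE[m] := by
  obtain ⟨c, hc⟩ := hint
  -- the second centre, such that `ε e = (x - c) - (x - (c + ε e))`
  obtain ⟨ε, hε, hce⟩ : ∃ ε : ℝ, 0 < ε ∧ c + ε • e ∈ interior K := by
    have hcont : Continuous fun s : ℝ => c + s • e := by fun_prop
    have hnh : ∀ᶠ s in 𝓝 (0 : ℝ), c + s • e ∈ interior K :=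
      hcont.continuousAt.eventually (by simpa using isOpen_interior.mem_nhds hc)
    obtain ⟨t, ht, ht0⟩ := ((hnh.filter_mono nhdsWithin_le_nhds).and
      (self_mem_nhdsWithin : Ioi (0 : ℝ) ∈ 𝓝[>] 0)).exists
    exact ⟨t, ht0, ht⟩
  have hG : ∀ c : E (m + 1), ContinuousOn (fun x => (m + 1) * Q x + fderiv ℝ Q x (x - c)) K := by
    intro c x hx
    refine ContinuousAt.continuousWithinAt ?_
    have h1 : ContinuousAt (fderiv ℝ Q) x :=
      ((hQ x hx).fderiv_right (m := 0) (by simp)).continuousAt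
    have h2 := (hQ x hx).continuousAt
    fun_prop
  have hQc : ContinuousOn Q K := fun x hx => (hQ x hx).continuousAt.continuousWithinAt
  have hQi : ∀ (i : ι) (c : E (m + 1)),
      IntegrableOn (fun y => inner ℝ (y - c) (n i) * Q y) (fc i) μHE[m] := fun i c =>
    hB.integrableOn_face (ContinuousOn.mul (by fun_prop) (hQc.mono (hB.face_subset i)))
  have h1 := hB.radial_divergence hc hQ
  have h2 := hB.radial_divergence hce hQ
  have hsub : ∫ x in K, ε * fderiv ℝ Q x e
      = ∑ i, ∫ y in fc i, ε * inner ℝ e (n i) * Q y ∂μHE[m] := by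
    have e1 : ∀ x, ε * fderiv ℝ Q x e = ((m + 1) * Q x + fderiv ℝ Q x (x - c))
        - ((m + 1) * Q x + fderiv ℝ Q x (x - (c + ε • e))) := fun x => by
      have : x - (c + ε • e) = (x - c) - ε • e := by abel
      rw [this, map_sub (fderiv ℝ Q x) (x - c), map_smul, smul_eq_mul]; ring
    simp only [e1]
    rw [integral_sub ((hG _).integrableOn_compact hB.isCompact)
      ((hG _).integrableOn_compact hB.isCompact), h1, h2, ← Finset.sum_sub_distrib]
    refine Finset.sum_congr rfl fun i _ => ?_
    rw [← integral_sub (hQi i _) (hQi i _)]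
    refine integral_congr_ae (Eventually.of_forall fun y => ?_)
    have : y - (c + ε • e) = (y - c) - ε • e := by abel
    simp only [this, inner_sub_left, inner_smul_left, RCLike.conj_to_real]
    ring
  rw [integral_const_mul] at hsub
  simp only [integral_const_mul, mul_assoc, ← Finset.mul_sum] at hsub
  exact mul_left_cancel₀ hε.ne' hsub

/-- If the body contains a ball of radius `r`, the area of its boundary is at most `(m+1)/r` times
its volume. -/
theorem sum_area_le [Fintype ι] {c : E (m + 1)} {r : ℝ} (hr : 0 < r)
    (hc : Metric.closedBall c r ⊆ K) :
    r * ∑ i, (μHE[m] : Measure (E (m + 1))).real (fc i) ≤ (m + 1) * volume.real K := by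
  have hci : c ∈ interior K :=
    mem_interior_iff_mem_nhds.2 (Filter.mem_of_superset (Metric.closedBall_mem_nhds c hr) hc)
  have h := hB.radial_divergence hci (Q := fun _ => 1) fun x _ => contDiffAt_const
  simp only [fderiv_const_apply, zero_apply, add_zero, mul_one,
    setIntegral_const, smul_eq_mul] at h
  rw [mul_comm (_ + _), h, Finset.mul_sum]
  refine Finset.sum_le_sum fun i _ => ?_
  obtain ⟨t, ht, hti⟩ := hB.exists_inner_pos hci i
  rw [setIntegral_congr_fun (hB.isCompact_face i).measurableSet hti, setIntegral_const,
    smul_eq_mul, mul_comm]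
  obtain ⟨y, hy⟩ := hB.nonempty_face i
  gcongr
  rw [← hti y hy]
  exact hB.le_inner_of_closedBall hr.le hc hy

end FlatBoundary

/-- The relative boundary of a closed convex set of dimension `r` is null for the `r`-dimensional
measure. -/
theorem measure_diff_intrinsicInterior {N : ℕ} {s : Set (E N)} (hs : Convex ℝ s)
    (hcl : IsClosed s) (hne : s.Nonempty) :
    μHE[Module.finrank ℝ (affineSpan ℝ s).direction] (s \ intrinsicInterior ℝ s) = 0 := by
  set A := affineSpan ℝ s
  obtain ⟨p₀, hp₀⟩ := hne
  let p : A := ⟨p₀, subset_affineSpan ℝ s hp₀⟩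
  have : Nonempty A := ⟨p⟩
  have hset : s \ intrinsicInterior ℝ s
      = (↑) '' (frontier ((↑) ⁻¹' s : Set A)) := by
    rw [(hcl.preimage continuous_subtype_val).frontier_eq, image_sdiff Subtype.val_injective,
      intrinsicInterior, image_preimage_eq_of_subset (by simpa using subset_affineSpan ℝ s)]
  rw [hset, AffineSubspace.euclideanHausdorffMeasure_coe_image]
  have hmp := EuclideanGeometry.measurePreserving_vaddConst p
  have hfr : MeasurableSet (frontier ((↑) ⁻¹' s : Set A)) := isClosed_frontier.measurableSet
  rw [← hmp.measure_preimage hfr.nullMeasurableSet]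
  have h1 : (IsometryEquiv.vaddConst p) ⁻¹' frontier ((↑) ⁻¹' s : Set A)
      = frontier ((IsometryEquiv.vaddConst p) ⁻¹' ((↑) ⁻¹' s : Set A)) :=
    (IsometryEquiv.vaddConst p).toHomeomorph.preimage_frontier _
  rw [h1]
  refine Convex.addHaar_frontier volume ?_
  intro x hx y hy a b ha hb hab
  have hmem := hs (x := x.1 + p₀) hx (y := y.1 + p₀) hy ha hb hab
  have he : a • (x.1 + p₀) + b • (y.1 + p₀) = (a • x.1 + b • y.1) + p₀ := by
    rw [smul_add, smul_add, add_add_add_comm, ← add_smul, hab, one_smul]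
  rw [he] at hmem
  exact hmem

/-- Disjointness of the relative interiors of two simplices makes their overlap null. -/
theorem measure_facet_inter {s s' : Affine.Simplex ℝ (E (m + 1)) m}
    (h : Disjoint (intrinsicInterior ℝ s.closedInterior) (intrinsicInterior ℝ s'.closedInterior)) :
    μHE[m] (s.closedInterior ∩ s'.closedInterior) = 0 := by
  have key : ∀ s : Affine.Simplex ℝ (E (m + 1)) m,
      μHE[m] (s.closedInterior \ intrinsicInterior ℝ s.closedInterior) = 0 := by
    intro s
    have hconv : Convex ℝ s.closedInterior := by
      rw [← Affine.Simplex.convexHull_eq_closedInterior]; exact convex_convexHull ℝ _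
    have h1 := measure_diff_intrinsicInterior hconv s.isClosed_closedInterior
      s.nonempty_closedInterior
    have h2 : Module.finrank ℝ (affineSpan ℝ s.closedInterior).direction = m := by
      rw [← Affine.Simplex.convexHull_eq_closedInterior, affineSpan_convexHull,
        direction_affineSpan]
      exact s.independent.finrank_vectorSpan (by simp)
    rwa [h2] at h1
  refine measure_mono_null ?_ (measure_union_null (key s) (key s'))
  rintro x ⟨hx, hx'⟩
  by_cases hi : x ∈ intrinsicInterior ℝ s.closedInterior
  · exact Or.inr ⟨hx', fun hi' => disjoint_left.1 h hi hi'⟩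
  · exact Or.inl ⟨hx, hi⟩

end ConvexBody

/-! ### Geometry of a mesh -/

namespace Mesh

section General

variable {d : ℕ} {Ω : Set (E d)} (T : Mesh d Ω)

theorem isCompact_elemSet (K : Fin T.nElem) : IsCompact (T.elemSet K) :=
  (T.elem K).isCompact_closedInterior

theorem convex_elemSet (K : Fin T.nElem) : Convex ℝ (T.elemSet K) := by
  rw [elemSet, ← Affine.Simplex.convexHull_eq_closedInterior]; exact convex_convexHull ℝ _

theorem elemSet_subset (K : Fin T.nElem) : T.elemSet K ⊆ closure Ω := by
  rw [← T.cover]; exact subset_iUnion (fun K => (T.elem K).closedInterior) K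

theorem isCompact_facetSet (f : Fin T.nFacet) : IsCompact (T.facetSet f) :=
  (T.facet f).isCompact_closedInterior

theorem mem_bdry {K : Fin T.nElem} {f : Fin T.nFacet} :
    f ∈ T.bdry K ↔ T.side f = K ∨ T.opp f = some K := by simp [bdry]

theorem facetSet_subset {K : Fin T.nElem} {f : Fin T.nFacet} (hf : f ∈ T.bdry K) :
    T.facetSet f ⊆ T.elemSet K := by
  have h := T.facet_subset f K (T.mem_bdry.1 hf)
  exact h.trans (T.isCompact_elemSet K).isClosed.frontier_subset

theorem facetSet_subset_neighbor (K : Fin T.nElem) (f : Fin T.nFacet) :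
    T.facetSet f ⊆ T.elemSet (T.neighbor K f) := by
  apply T.facetSet_subset
  rw [mem_bdry, neighbor]
  split_ifs with h
  · cases ho : T.opp f with
    | none => left; simpa using h
    | some K' => right; simp
  · left; rfl

theorem norm_outward (K : Fin T.nElem) (f : Fin T.nFacet) : ‖T.outward K f‖ = 1 := by
  rw [outward]; split_ifs <;> simp [T.norm_normal]

theorem hElem_le_size (K : Fin T.nElem) : T.hElem K ≤ T.size :=
  le_ciSup (Set.finite_range T.hElem).bddAbove K

theorem size_nonneg : 0 ≤ T.size := Real.iSup_nonneg fun _ => Metric.diam_nonneg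

theorem hElem_nonneg (K : Fin T.nElem) : 0 ≤ T.hElem K := Metric.diam_nonneg

theorem elemSet_subset_closedBall {K : Fin T.nElem} {c : E d} (hc : c ∈ T.elemSet K) :
    T.elemSet K ⊆ Metric.closedBall c (T.hElem K) := fun _ hx =>
  Metric.dist_le_diam_of_mem (T.isCompact_elemSet K).isBounded hx hc

theorem hElem_pos (hd : 1 ≤ d) (K : Fin T.nElem) : 0 < T.hElem K := by
  have h01 : (T.elem K).points 0 ≠ (T.elem K).points (Fin.last d) := fun h => by
    have := congrArg Fin.val ((T.elem K).independent.injective h)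
    simp at this
    omega
  exact (dist_pos.2 h01).trans_le (Metric.dist_le_diam_of_mem (T.isCompact_elemSet K).isBounded
    ((T.elem K).point_mem_closedInterior _) ((T.elem K).point_mem_closedInterior _))

theorem real_closedBall (c : E d) {r : ℝ} (hr : 0 ≤ r) :
    volume.real (Metric.closedBall c r) = r ^ d * volume.real (Metric.closedBall (0 : E d) 1) := by
  have h := Measure.addHaar_real_closedBall' (volume : Measure (E d)) c hr
  rwa [finrank_euclideanSpace_fin] at h

/-- The volume of an element is at most that of a ball of radius `h_K`. -/
theorem volume_elemSet_le (K : Fin T.nElem) :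
    volume.real (T.elemSet K) ≤ T.hElem K ^ d * volume.real (Metric.closedBall (0 : E d) 1) := by
  obtain ⟨c, hc⟩ := (T.elem K).nonempty_closedInterior
  rw [← real_closedBall c (T.hElem_nonneg K)]
  exact measureReal_mono (T.elemSet_subset_closedBall hc)
    (isCompact_closedBall _ _).measure_lt_top.ne

/-- Elements do not overlap, so that the volume of `Ω` bounds the number of elements. -/
theorem sum_volume_le (hΩ : Bornology.IsBounded Ω) :
    ∑ K, volume.real (T.elemSet K) ≤ volume.real (closure Ω) := by
  have hfin : volume (closure Ω) ≠ ⊤ := hΩ.closure.measure_lt_top.ne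
  have h : ∀ K, volume.real (T.elemSet K) = volume.real (interior (T.elemSet K)) := fun K =>
    measureReal_congr (((T.convex_elemSet K).addHaar_frontier volume) |>
      fun h => (interior_ae_eq_of_null_frontier h).symm)
  simp only [h]
  have h2 := measureReal_biUnion_finset (μ := (volume : Measure (E d))) (s := Finset.univ)
    (f := fun K => interior (T.elemSet K)) (fun K _ K' _ hK => T.disjoint_elem K K' hK)
    (fun K _ => isOpen_interior.measurableSet)
    (fun K _ => ne_top_of_le_ne_top hfin
      (measure_mono (interior_subset.trans (T.elemSet_subset K))))
  rw [← h2]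
  exact measureReal_mono (iUnion₂_subset fun K _ => interior_subset.trans (T.elemSet_subset K)) hfin

theorem le_volume_elemSet {κ : ℝ} (hκ : 0 < κ) (hT : T.ShapeRegular κ) (K : Fin T.nElem) :
    (T.hElem K / κ) ^ d * volume.real (Metric.closedBall (0 : E d) 1)
      ≤ volume.real (T.elemSet K) := by
  obtain ⟨c, hc⟩ := hT K
  rw [← real_closedBall c (div_nonneg (T.hElem_nonneg K) hκ.le)]
  exact measureReal_mono hc (T.isCompact_elemSet K).measure_lt_top.ne

theorem real_closedBall_pos : 0 < volume.real (Metric.closedBall (0 : E d) 1) :=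
  ENNReal.toReal_pos (Metric.measure_closedBall_pos _ _ one_pos).ne'
    (isCompact_closedBall _ _).measure_lt_top.ne

/-- A quasi-uniform mesh has `O(h⁻ᵈ)` elements. -/
theorem nElem_mul_le (hΩ : Bornology.IsBounded Ω) {κ : ℝ} (hκ : 0 < κ)
    (hT : T.ShapeRegular κ) (hQ : T.QuasiUniform κ) :
    T.nElem * T.size ^ d ≤ (κ ^ 2) ^ d * volume.real (closure Ω)
      / volume.real (Metric.closedBall (0 : E d) 1) := by
  have hω := real_closedBall_pos (d := d)
  rw [le_div_iff₀ hω]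
  have h1 : ∀ K, T.size ^ d * volume.real (Metric.closedBall (0 : E d) 1)
      ≤ (κ ^ 2) ^ d * volume.real (T.elemSet K) := fun K => by
    have h2 := T.le_volume_elemSet hκ hT K
    have h3 : T.size ≤ κ ^ 2 * (T.hElem K / κ) := (hQ K).trans_eq (by field_simp)
    calc _ ≤ (κ ^ 2 * (T.hElem K / κ)) ^ d * volume.real (Metric.closedBall (0 : E d) 1) := by
          gcongr
          exact T.size_nonneg
      _ = (κ ^ 2) ^ d * ((T.hElem K / κ) ^ d * volume.real (Metric.closedBall (0 : E d) 1)) := by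
          rw [mul_pow]; ring
      _ ≤ _ := by gcongr
  calc _ = ∑ _K : Fin T.nElem, T.size ^ d * volume.real (Metric.closedBall (0 : E d) 1) := by
        simp [mul_assoc]
    _ ≤ ∑ K, (κ ^ 2) ^ d * volume.real (T.elemSet K) := Finset.sum_le_sum fun K _ => h1 K
    _ ≤ _ := by
        rw [← Finset.mul_sum]
        exact mul_le_mul_of_nonneg_left (T.sum_volume_le hΩ) (by positivity)

end General

variable {m : ℕ} {Ω : Set (E (m + 1))} (T : Mesh (m + 1) Ω)

/-- The facets of a mesh element make up its boundary in the sense of the divergence theorem. -/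
theorem flatBoundary (K : Fin T.nElem) :
    FlatBoundary (m := m) (T.elemSet K) (fun f : T.bdry K => T.facetSet f)
      (fun f => T.outward K f) where
  isCompact := T.isCompact_elemSet K
  convex := T.convex_elemSet K
  isCompact_face f := T.isCompact_facetSet f
  nonempty_face f := (T.facet f).nonempty_closedInterior
  face_subset f := T.facetSet_subset f.2
  norm_normal f := T.norm_outward K f
  support := by
    rintro ⟨f, hf⟩ y hy x hx
    rw [mem_bdry] at hf
    by_cases h : T.side f = K
    · subst h
      simpa [outward] using T.normal_side f y hy x hx
    · have := T.normal_opp f K (hf.resolve_left h) y hy x hx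
      simpa [outward, h, inner_neg_right] using this
  cover := by
    intro x hx
    obtain ⟨f, hf, hxf⟩ := mem_iUnion₂.1 (T.frontier_subset K hx)
    exact mem_iUnion.2 ⟨⟨f, T.mem_bdry.2 hf⟩, hxf⟩
  null_inter := by
    intro f f' hff
    exact measure_facet_inter (T.disjoint_facet f f' fun h => hff (Subtype.ext h))

/-- The area of the boundary of an element is `O(h_K^(d-1))`. -/
theorem area_le {κ : ℝ} (hκ : 0 < κ) (hT : T.ShapeRegular κ) (K : Fin T.nElem) :
    ∑ f ∈ T.bdry K, (μHE[m] : Measure (E (m + 1))).real (T.facetSet f)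
      ≤ (m + 1) * κ * volume.real (Metric.closedBall (0 : E (m + 1)) 1) * T.hElem K ^ m := by
  obtain ⟨c, hc⟩ := hT K
  have hh := T.hElem_pos (by omega) K
  have h := (T.flatBoundary K).sum_area_le (div_pos hh hκ) hc
  rw [Finset.univ_eq_attach,
    Finset.sum_attach (T.bdry K) fun f => (μHE[m] : Measure (E (m + 1))).real (T.facetSet f)] at h
  have h2 := T.volume_elemSet_le K
  rw [← mul_le_mul_iff_right₀ (div_pos hh hκ)]
  refine h.trans ?_
  calc _ ≤ ((m : ℝ) + 1) * (T.hElem K ^ (m + 1)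
        * volume.real (Metric.closedBall (0 : E (m + 1)) 1)) := by gcongr
    _ = _ := by field_simp; ring

theorem divergence {κ : ℝ} (hκ : 0 < κ) (hT : T.ShapeRegular κ) (K : Fin T.nElem)
    {Q : E (m + 1) → ℝ} (hQ : ∀ x ∈ T.elemSet K, ContDiffAt ℝ 1 Q x) (j : Fin (m + 1)) :
    ∫ x in T.elemSet K, fderiv ℝ Q x (EuclideanSpace.single j 1)
      = ∑ f ∈ T.bdry K, T.outward K f j * ∫ y in T.facetSet f, Q y ∂μHE[m] := by
  obtain ⟨c, hc⟩ := hT K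
  have hci : c ∈ interior (T.elemSet K) := mem_interior_iff_mem_nhds.2
    (Filter.mem_of_superset (Metric.closedBall_mem_nhds c
      (div_pos (T.hElem_pos (by omega) K) hκ)) hc)
  rw [(T.flatBoundary K).divergence ⟨c, hci⟩ hQ, Finset.univ_eq_attach,
    ← Finset.sum_attach (T.bdry K)]
  refine Finset.sum_congr rfl fun f _ => ?_
  rw [EuclideanSpace.inner_single_left]
  simp

end Mesh

/-! ### The entropy potential and the entropy flux -/

namespace EntropySystem

variable {d p k : ℕ} (S : EntropySystem d p (k + 1))

theorem contDiffOn_fluxV (j : Fin d) : ContDiffOn ℝ (k + 1 : ℕ) (S.fluxV j) S.varDomain := by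
  have := (S.contDiffOn_flux j).comp S.contDiffOn_state S.mapsTo_state
  exact this

/-- The terms with the derivative of the state `u(V)` cancel, because `∇U · ∇fⱼ = ∇gⱼ` and
`∇U(u(V)) = V`. -/
theorem hasGradientAt_potential (j : Fin d) {v : E p} (hv : v ∈ S.varDomain) :
    HasGradientAt (S.potential j) (S.fluxV j v) v := by
  have hne : ((k + 1 : ℕ) : WithTop ℕ∞) ≠ 0 := by simp
  have hu : HasFDerivAt S.state (fderiv ℝ S.state v) v :=
    ((S.contDiffOn_state.contDiffAt (S.isOpen_varDomain.mem_nhds hv)).differentiableAt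
      hne).hasFDerivAt
  have hmem : S.state v ∈ S.stateDomain := S.mapsTo_state hv
  have hf : HasFDerivAt (S.flux j) (fderiv ℝ (S.flux j) (S.state v)) (S.state v) :=
    (((S.contDiffOn_flux j).contDiffAt (S.isOpen_stateDomain.mem_nhds hmem)).differentiableAt
      hne).hasFDerivAt
  have hg : HasFDerivAt (S.entropyFlux j) (fderiv ℝ (S.entropyFlux j) (S.state v)) (S.state v) :=
    (((S.contDiffOn_entropyFlux j).contDiffAt
      (S.isOpen_stateDomain.mem_nhds hmem)).differentiableAt (by simp)).hasFDerivAt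
  have h := ((hasFDerivAt_id v).inner ℝ (hf.comp v hu)).sub (hg.comp v hu)
  rw [hasGradientAt_iff_hasFDerivAt]
  refine h.congr_fderiv ?_
  ext w
  have hc := S.compat j _ hmem (fderiv ℝ S.state v w)
  rw [S.gradient_entropy_state v hv] at hc
  simp [fderivInnerCLM_apply, hc, fluxV, real_inner_comm]

/-- The potential is one order smoother than the flux, which is its gradient. -/
theorem contDiffOn_potential (j : Fin d) :
    ContDiffOn ℝ (k + 2 : ℕ) (S.potential j) S.varDomain := by
  have h : ((k + 2 : ℕ) : WithTop ℕ∞) = ((k + 1 : ℕ) : WithTop ℕ∞) + 1 := by norm_cast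
  rw [h, contDiffOn_succ_iff_fderiv_of_isOpen S.isOpen_varDomain]
  refine ⟨fun v hv => ((S.hasGradientAt_potential j hv).hasFDerivAt
    ).differentiableAt.differentiableWithinAt, by simp, ?_⟩
  refine ((InnerProductSpace.toDual ℝ (E p)).toContinuousLinearEquiv.contDiff.comp_contDiffOn
    (S.contDiffOn_fluxV j)).congr fun v hv => ?_
  exact (S.hasGradientAt_potential j hv).hasFDerivAt.fderiv

end EntropySystem

theorem NumericalFlux.entropyFlux_self {d p k : ℕ} {S : EntropySystem d p (k + 1)}
    (F : NumericalFlux S) {n : E d} (hn : ‖n‖ = 1) {v : E p} (hv : v ∈ S.varDomain) :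
    F.entropyFlux n v v = ∑ j, n j * S.entropyFlux j (S.state v) := by
  have h : (1 / 2 : ℝ) • (v + v) = v := by
    rw [← two_smul ℝ v, smul_smul]; norm_num
  rw [NumericalFlux.entropyFlux, h, NumericalFlux.onVar,
    F.consistent n hn _ (S.mapsTo_state hv), inner_sum, ← Finset.sum_sub_distrib]
  refine Finset.sum_congr rfl fun j _ => ?_
  rw [inner_smul_right, EntropySystem.potential, EntropySystem.fluxV]
  ring

/-! ### Quadrature formulas -/

namespace QuadRule

variable {d : ℕ} {s : Set (E d)} (Q : QuadRule s) (μ : Measure (E d))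

section Linear

variable {V V' : Type} [AddCommGroup V] [Module ℝ V] [AddCommGroup V'] [Module ℝ V']

theorem map_integral (L : V →ₗ[ℝ] V') (v : E d → V) :
    L (Q.integral μ v) = Q.integral μ fun x => L (v x) := by
  simp [integral]

theorem integral_add (v w : E d → V) :
    Q.integral μ (fun x => v x + w x) = Q.integral μ v + Q.integral μ w := by
  simp [integral, Finset.sum_add_distrib]

theorem integral_sub (v w : E d → V) :
    Q.integral μ (fun x => v x - w x) = Q.integral μ v - Q.integral μ w := by
  simp [integral, Finset.sum_sub_distrib, smul_sub]

theorem integral_sum {ι : Type*} (t : Finset ι) (v : ι → E d → V) :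
    Q.integral μ (fun x => ∑ i ∈ t, v i x) = ∑ i ∈ t, Q.integral μ (v i) := by
  simp only [integral, Finset.smul_sum]
  rw [Finset.sum_comm]

theorem integral_congr {v w : E d → V} (h : ∀ x ∈ s, v x = w x) :
    Q.integral μ v = Q.integral μ w := by
  simp only [integral]
  congr 1
  exact Finset.sum_congr rfl fun q _ => by rw [h _ (Q.node_mem q)]

end Linear

theorem abs_integral_le {M B : ℝ} (hM : ∑ q, |Q.weight q| ≤ M) {v : E d → ℝ}
    (hv : ∀ x ∈ s, |v x| ≤ B) (hB : 0 ≤ B) : |Q.integral μ v| ≤ μ.real s * (M * B) := by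
  rw [integral, smul_eq_mul, abs_mul, abs_of_nonneg measureReal_nonneg]
  refine mul_le_mul_of_nonneg_left ?_ measureReal_nonneg
  calc _ ≤ ∑ q, |Q.weight q| * B := by
        refine (Finset.abs_sum_le_sum_abs _ _).trans (Finset.sum_le_sum fun q _ => ?_)
        rw [smul_eq_mul, abs_mul]
        exact mul_le_mul_of_nonneg_left (hv _ (Q.node_mem q)) (abs_nonneg _)
    _ = (∑ q, |Q.weight q|) * B := (Finset.sum_mul _ _ _).symm
    _ ≤ M * B := mul_le_mul_of_nonneg_right hM hB

/-- The error of a quadrature formula is bounded by the distance of the integrand to the polynomials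
that it integrates exactly. -/
theorem abs_integral_sub_le {m : ℕ} {M ε : ℝ} (hM : ∑ q, |Q.weight q| ≤ M)
    (hex : Q.ExactDegree μ m) (hs : IsCompact s) (hμ : μ s < ⊤) {g P : E d → ℝ}
    (hg : ContinuousOn g s) (hP : P ∈ polyFun d m) (hgP : ∀ x ∈ s, |g x - P x| ≤ ε)
    (hε : 0 ≤ ε) :
    |Q.integral μ g - ∫ x in s, g x ∂μ| ≤ μ.real s * ((M + 1) * ε) := by
  have hPc : ContinuousOn P s := (contDiff_of_mem_polyFun hP (n := 0)).continuous.continuousOn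
  have hint : ∀ {u : E d → ℝ}, ContinuousOn u s → IntegrableOn u s μ := fun {u} hu => by
    obtain ⟨C, hC⟩ := hs.exists_bound_of_continuousOn hu
    have : IsFiniteMeasure (μ.restrict s) := ⟨by simpa using hμ⟩
    exact Integrable.of_bound (hu.aestronglyMeasurable hs.measurableSet) C
      ((ae_restrict_mem hs.measurableSet).mono hC)
  have hPex : Q.integral μ P = ∫ x in s, P x ∂μ := by
    obtain ⟨p, hp, rfl⟩ := mem_polyFun.1 hP
    exact hex p hp
  have h1 := Q.abs_integral_le μ hM hgP hε
  rw [Q.integral_sub, hPex] at h1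
  have h2 : |∫ x in s, (P x - g x) ∂μ| ≤ ε * μ.real s := by
    rw [← Real.norm_eq_abs]
    refine norm_setIntegral_le_of_norm_le_const hμ fun x hx => ?_
    rw [Real.norm_eq_abs, abs_sub_comm]; exact hgP x hx
  rw [MeasureTheory.integral_sub (hint hPc) (hint hg)] at h2
  have h3 : Q.integral μ g - ∫ x in s, g x ∂μ = (Q.integral μ g - ∫ x in s, P x ∂μ)
      + ((∫ x in s, P x ∂μ) - ∫ x in s, g x ∂μ) := by ring
  rw [h3]
  refine (abs_add_le _ _).trans ((add_le_add h1 h2).trans_eq (by ring))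

end QuadRule

/-! ### Conservation -/

section Conservation

variable {d p k : ℕ} {Ω : Set (E d)} {FE : FiniteElement d k} {T : Mesh d Ω}

theorem affineMap_mem_polyFun {N : ℕ} (g : E N →ᵃ[ℝ] ℝ) : (fun x => g x) ∈ polyFun N 1 := by
  have : (fun x => g x) = (fun _ => g 0)
      + ∑ i, g.linear (EuclideanSpace.single i (1 : ℝ)) • fun x : E N => x i := by
    ext x
    have hx : x = ∑ j, x j • EuclideanSpace.single j (1 : ℝ) := by
      ext l; simp [Finset.sum_apply, Pi.single_apply]
    have h1 : g x = g.linear x + g 0 := congrFun g.decomp x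
    rw [h1]
    conv_lhs => rw [hx, map_sum]
    simp [add_comm, mul_comm]
  rw [this]
  exact Submodule.add_mem _ (const_mem_polyFun _)
    (Submodule.sum_mem _ fun i _ => Submodule.smul_mem _ _ (coord_mem_polyFun i))

theorem shape_mem_polyFun (K : Fin T.nElem) (σ : Fin FE.nDof) :
    shape FE T K σ ∈ polyFun d k :=
  eval_mem_polyFun ((MvPolynomial.mem_restrictTotalDegree _ _ _).1 (FE.basis σ).2) _
    fun i => affineMap_mem_polyFun ((simplexBasis (T.elem K)).coord i.succ)

theorem sum_shape (K : Fin T.nElem) (x : E d) : ∑ σ, shape FE T K σ x = 1 := by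
  simp only [shape, ← map_sum, FE.sum_basis, map_one]

theorem differentiable_shape (K : Fin T.nElem) (σ : Fin FE.nDof) :
    Differentiable ℝ (shape FE T K σ) :=
  (contDiff_of_mem_polyFun (shape_mem_polyFun K σ) (n := 1)).differentiable (by simp)

theorem sum_fderiv_shape (K : Fin T.nElem) (x e : E d) :
    ∑ σ, fderiv ℝ (shape FE T K σ) x e = 0 := by
  have h : fderiv ℝ (fun x => ∑ σ, shape FE T K σ x) x = 0 := by
    simp only [sum_shape, fderiv_const_apply]
  rw [fderiv_fun_sum fun σ _ => differentiable_shape K σ x] at h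
  simpa using congrArg (fun L : E d →L[ℝ] ℝ => L e) h

theorem DGFun.hasFDerivAt_val (v : DGFun FE T p) (K : Fin T.nElem) (x : E d) :
    HasFDerivAt (v.val K) (∑ σ, (fderiv ℝ (shape FE T K σ) x).smulRight (v K σ)) x := by
  have := HasFDerivAt.fun_sum (u := Finset.univ) fun σ (_ : σ ∈ Finset.univ) =>
    (differentiable_shape (FE := FE) K σ x).hasFDerivAt.smul_const (v K σ)
  exact this

theorem DGFun.fderiv_val (v : DGFun FE T p) (K : Fin T.nElem) (x e : E d) :
    fderiv ℝ (v.val K) x e = ∑ σ, fderiv ℝ (shape FE T K σ) x e • v K σ := by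
  rw [(v.hasFDerivAt_val K x).fderiv]
  simp

theorem DGFun.sum_sub_mean (v : DGFun FE T p) (K : Fin T.nElem) :
    ∑ σ, (v K σ - v.mean K) = 0 := by
  rcases Nat.eq_zero_or_pos FE.nDof with h | h
  · have : IsEmpty (Fin FE.nDof) := by rw [h]; infer_instance
    simp
  · rw [Finset.sum_sub_distrib, DGFun.mean, Finset.sum_const, Finset.card_univ, Fintype.card_fin,
      ← Nat.cast_smul_eq_nsmul ℝ, smul_smul, mul_inv_cancel₀ (by positivity), one_smul, sub_self]

variable {S : EntropySystem d p (k + 1)} (F : NumericalFlux S) (Q : Quadrature T)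

theorem sum_correction (v : DGFun FE T p) (K : Fin T.nElem) :
    ∑ σ, correction F Q v K σ = 0 := by
  simp only [correction, ← Finset.smul_sum, v.sum_sub_mean, smul_zero]

theorem sum_residual (v : DGFun FE T p) (K : Fin T.nElem) :
    ∑ σ, residual F Q v K σ = totalFlux F Q v K := by
  simp only [residual, Finset.sum_add_distrib, Finset.sum_neg_distrib, Quadrature.elemInt,
    ← QuadRule.integral_sum]
  -- the gradients of a partition of unity sum to zero
  have h1 : ∀ x, ∑ σ, ∑ j, fderiv ℝ (shape FE T K σ) x (EuclideanSpace.single j 1) •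
      S.fluxV j (v.val K x) = 0 := fun x => by
    rw [Finset.sum_comm]
    simp only [← Finset.sum_smul, sum_fderiv_shape, zero_smul, Finset.sum_const_zero]
  simp only [h1, Quadrature.bdryInt, totalFlux]
  rw [Finset.sum_comm]
  simp only [Quadrature.facetInt, ← QuadRule.integral_sum, ← Finset.sum_smul, sum_shape, one_smul]
  simp [QuadRule.integral]

theorem sum_correctedResidual (v : DGFun FE T p) (K : Fin T.nElem) :
    ∑ σ, correctedResidual F Q v K σ = totalFlux F Q v K := by
  simp only [correctedResidual, Finset.sum_add_distrib, sum_correction, sum_residual, add_zero]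

theorem sum_inner_correction (v : DGFun FE T p) (K : Fin T.nElem) (hv : v.spread K ≠ 0) :
    ∑ σ, inner ℝ (v K σ) (correction F Q v K σ) = -defect F Q v K := by
  have h : ∑ σ, inner ℝ (v K σ) (v K σ - v.mean K) = v.spread K := by
    have h0 : ∑ σ, inner ℝ (v.mean K) (v K σ - v.mean K) = 0 := by
      rw [← inner_sum, v.sum_sub_mean, inner_zero_right]
    rw [DGFun.spread, ← sub_zero (∑ σ, inner ℝ _ _), ← h0, ← Finset.sum_sub_distrib]
    refine Finset.sum_congr rfl fun σ _ => ?_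
    rw [← inner_sub_left, real_inner_self_eq_norm_sq]
  simp only [correction, inner_smul_right, ← Finset.mul_sum, h]
  field_simp

theorem sum_inner_correctedResidual (v : DGFun FE T p) (K : Fin T.nElem) (hv : v.spread K ≠ 0) :
    ∑ σ, inner ℝ (v K σ) (correctedResidual F Q v K σ) = totalEntropyFlux F Q v K := by
  simp only [correctedResidual, inner_add_right, Finset.sum_add_distrib,
    sum_inner_correction F Q v K hv, defect]
  ring

theorem facetEntropyFlux_add_eq_zero (hF : F.Conservative) (v : DGFun FE T p) {f : Fin T.nFacet}
    {K : Fin T.nElem} (hf : T.opp f = some K) :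
    facetEntropyFlux F Q v (T.side f) f + facetEntropyFlux F Q v K f = 0 := by
  have hne : T.side f ≠ K := fun h => T.opp_ne_side f (by rw [hf, h])
  simp only [facetEntropyFlux, Quadrature.facetInt, ← QuadRule.integral_add]
  have h : ∀ x, F.entropyFlux (T.outward (T.side f) f) (v.val (T.side f) x)
      (v.val (T.neighbor (T.side f) f) x)
      + F.entropyFlux (T.outward K f) (v.val K x) (v.val (T.neighbor K f) x) = 0 := fun x => by
    simp only [Mesh.outward, Mesh.neighbor, if_true, hne, if_false, hf, Option.getD_some,
      NumericalFlux.entropyFlux, NumericalFlux.onVar, hF _ (S.state (v.val (T.side f) x)),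
      add_comm (v.val K x), PiLp.neg_apply, neg_mul, Finset.sum_neg_distrib, inner_neg_right]
    ring
  simp [h, QuadRule.integral]

end Conservation

/-! ### Bounds on compact sets -/

section Bounds

variable {X Y Z : Type*} [NormedAddCommGroup X] [NormedSpace ℝ X] [NormedAddCommGroup Y]
  [NormedSpace ℝ Y] [NormedAddCommGroup Z] [NormedSpace ℝ Z]

theorem exists_iteratedFDeriv_bound {f : X → Y} {O C : Set X} (hO : IsOpen O) {r : ℕ}
    (hf : ContDiffOn ℝ r f O) (hC : IsCompact C) (hCO : C ⊆ O) :
    ∃ M, 0 ≤ M ∧ ∀ i ≤ r, ∀ x ∈ C, ‖iteratedFDeriv ℝ i f x‖ ≤ M := by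
  have h : ∀ i, ∃ M, 0 ≤ M ∧ (i ≤ r → ∀ x ∈ C, ‖iteratedFDeriv ℝ i f x‖ ≤ M) := by
    intro i
    by_cases hi : i ≤ r
    · have hc : ContinuousOn (iteratedFDeriv ℝ i f) O :=
        (hf.continuousOn_iteratedFDerivWithin (by exact_mod_cast hi) hO.uniqueDiffOn).congr
          fun x hx => (iteratedFDerivWithin_of_isOpen i hO hx).symm
      obtain ⟨M, hM⟩ := hC.exists_bound_of_continuousOn (hc.mono hCO)
      exact ⟨max M 0, le_max_right _ _, fun _ x hx => (hM x hx).trans (le_max_left _ _)⟩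
    · exact ⟨0, le_rfl, fun h => absurd h hi⟩
  choose M hM0 hM using h
  refine ⟨∑ i ∈ Finset.range (r + 1), M i, Finset.sum_nonneg fun i _ => hM0 i, fun i hi x hx => ?_⟩
  exact (hM i hi x hx).trans (Finset.single_le_sum (f := M) (fun i _ => hM0 i)
    (Finset.mem_range.2 (Nat.lt_succ_of_le hi)))

/-- A `C¹` function is Lipschitz, uniformly, on the balls contained in a compact set. -/
theorem exists_lipschitz_ball {f : X → Y} {O C : Set X} (hO : IsOpen O)
    (hf : ContDiffOn ℝ 1 f O) (hC : IsCompact C) (hCO : C ⊆ O) :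
    ∃ L, 0 ≤ L ∧ ∀ v δ, Metric.closedBall v δ ⊆ C → ∀ a ∈ Metric.closedBall v δ,
      ∀ b ∈ Metric.closedBall v δ, ‖f a - f b‖ ≤ L * ‖a - b‖ := by
  obtain ⟨M, hM0, hM⟩ := exists_iteratedFDeriv_bound (r := 1) hO hf hC hCO
  refine ⟨M, hM0, fun v δ hsub a ha b hb => ?_⟩
  refine (convex_closedBall v δ).norm_image_sub_le_of_norm_fderiv_le (𝕜 := ℝ) (fun x hx => ?_)
    (fun x hx => ?_) hb ha
  · exact (hf.contDiffAt (hO.mem_nhds (hCO (hsub hx)))).differentiableAt (by simp)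
  · have := hM 1 le_rfl x (hsub hx)
    rwa [← norm_iteratedFDeriv_one]

/-- Bound for the derivatives of a composition whose inner function takes its value in a compact
set. -/
theorem exists_iteratedFDeriv_comp_le {f : Y → Z} {O C : Set Y} (hO : IsOpen O) {r : ℕ}
    (hf : ContDiffOn ℝ r f O) (hC : IsCompact C) (hCO : C ⊆ O) {D : ℝ} (hD : 1 ≤ D) :
    ∃ M, 0 ≤ M ∧ ∀ (q : X → Y) (x : X), ContDiff ℝ r q → q x ∈ C →
      (∀ i, ‖iteratedFDeriv ℝ i q x‖ ≤ D) →
      ∀ i ≤ r, ‖iteratedFDeriv ℝ i (f ∘ q) x‖ ≤ M := by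
  obtain ⟨M, hM0, hM⟩ := exists_iteratedFDeriv_bound hO hf hC hCO
  refine ⟨r.factorial * M * D ^ r, by positivity, fun q x hq hx hqD i hi => ?_⟩
  have hop : IsOpen (q ⁻¹' O) := hO.preimage hq.continuous
  have hxO : x ∈ q ⁻¹' O := hCO hx
  have hi' : (i : WithTop ℕ∞) ≤ r := by exact_mod_cast hi
  have h := norm_iteratedFDerivWithin_comp_le (n := i) hf hq.contDiffOn hi'
    hO.uniqueDiffOn hop.uniqueDiffOn (mapsTo_preimage q O) hxO (C := M) (D := D)
    (fun j hj => by
      rw [iteratedFDerivWithin_of_isOpen j hO (hCO hx)]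
      exact hM j (hj.trans hi) _ hx)
    (fun j hj _ => by
      rw [iteratedFDerivWithin_of_isOpen j hop hxO]
      exact (hqD j).trans (le_self_pow₀ hD (by omega)))
  rw [iteratedFDerivWithin_of_isOpen i hop hxO] at h
  refine h.trans ?_
  have h1 : (i.factorial : ℝ) ≤ r.factorial := by exact_mod_cast Nat.factorial_le hi
  have h2 : D ^ i ≤ D ^ r := pow_le_pow_right₀ hD hi
  gcongr

end Bounds

/-- Vector-valued form of `exists_iteratedFDeriv_le_of_near`. -/
theorem exists_iteratedFDeriv_vec_le (N k p : ℕ) {κ : ℝ} (hκ : 0 < κ) (A M : ℝ) :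
    ∃ D, 1 ≤ D ∧ ∀ (V q : E N → E p) (K : Set (E N)) (c : E N) (h : ℝ), 0 < h → h ≤ 1 →
      Metric.closedBall c (h / κ) ⊆ K → K ⊆ Metric.closedBall c h → StarConvex ℝ c K →
      (∀ x ∈ K, ContDiffAt ℝ (k + 1 : ℕ) V x) →
      (∀ i ≤ k + 1, ∀ x ∈ K, ‖iteratedFDeriv ℝ i V x‖ ≤ M) →
      (∀ l, (fun x => q x l) ∈ polyFun N k) → (∀ x ∈ K, ‖q x - V x‖ ≤ A * h ^ (k + 1)) →
      ∀ i, ∀ x ∈ K, ‖iteratedFDeriv ℝ i q x‖ ≤ D := by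
  obtain ⟨D, hD0, hD⟩ := exists_iteratedFDeriv_le_of_near N k hκ A M
  refine ⟨max 1 (p * D), le_max_left _ _, ?_⟩
  intro V q K c h hh hh1 hball hKball hstar hV hM hq hA i x hx
  refine le_trans ?_ (le_max_right _ _)
  have hproj : ∀ l : Fin p, ‖(EuclideanSpace.proj l : E p →L[ℝ] ℝ)‖ ≤ 1 := fun l =>
    ContinuousLinearMap.opNorm_le_bound _ zero_le_one fun v => by
      simpa using PiLp.norm_apply_le v l
  have hcomp : ∀ l, ‖iteratedFDeriv ℝ i (fun x => q x l) x‖ ≤ D := fun l => by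
    refine hD (fun x => V x l) _ K c h hh hh1 hball hKball hstar (fun y hy => ?_)
      (fun j hj y hy => ?_) (hq l) (fun y hy => ?_) i x hx
    · exact (EuclideanSpace.proj l : E p →L[ℝ] ℝ).contDiff.contDiffAt.comp y (hV y hy)
    · have h1 := (EuclideanSpace.proj l : E p →L[ℝ] ℝ).norm_iteratedFDeriv_comp_left (hV y hy)
        (n := j) (by exact_mod_cast hj)
      refine h1.trans ((mul_le_of_le_one_left (norm_nonneg _) (hproj l)).trans (hM j hj y hy))
    · exact (PiLp.norm_apply_le (q y - V y) l).trans (hA y hy)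
  have hsum : q = fun x => ∑ l, (ContinuousLinearMap.toSpanSingleton ℝ
      (EuclideanSpace.single l (1 : ℝ)) ∘ fun x => q x l) x := by
    ext y j
    simp [Finset.sum_apply, Pi.single_apply]
  have hcd : ∀ l, ContDiff ℝ i (fun x => q x l) := fun l => contDiff_of_mem_polyFun (hq l)
  rw [hsum, iteratedFDeriv_fun_sum_apply fun l _ =>
    ((ContinuousLinearMap.contDiff _).comp (hcd l)).contDiffAt]
  refine (norm_sum_le _ _).trans ?_
  calc _ ≤ ∑ _l : Fin p, D := Finset.sum_le_sum fun l _ => by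
        have h1 := (ContinuousLinearMap.toSpanSingleton ℝ
          (EuclideanSpace.single l (1 : ℝ))).norm_iteratedFDeriv_comp_left
          (hcd l).contDiffAt (x := x) (n := i) le_rfl
        rw [ContinuousLinearMap.norm_toSpanSingleton, PiLp.norm_single, norm_one,
          one_mul] at h1
        exact h1.trans (hcomp l)
    _ = p * D := by simp

/-! ### The entropy defect -/

section Jump

variable {d p k : ℕ} {S : EntropySystem d p (k + 1)}

/-- The integrand of the boundary part of the entropy defect differs from the normal entropy
potential of the inner state by the square of the jump: the first order terms cancel since
`∇θ = f` and the numerical flux is consistent. -/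
theorem exists_jump_le (F : NumericalFlux S) {C : Set (E p)} (hC : IsCompact C)
    (hCW : C ⊆ S.varDomain) :
    ∃ L, 0 ≤ L ∧ ∀ (n : E d) (v : E p) (δ : ℝ), ‖n‖ = 1 → Metric.closedBall v δ ⊆ C →
      ∀ a ∈ Metric.closedBall v δ, ∀ b ∈ Metric.closedBall v δ,
      |inner ℝ a (F.onVar n a b) - F.entropyFlux n a b - ∑ j, n j * S.potential j a|
        ≤ L * ‖a - b‖ ^ 2 := by
  have h1k : (1 : WithTop ℕ∞) ≤ (k + 1 : ℕ) := by exact_mod_cast Nat.le_add_left 1 k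
  obtain ⟨Lu, hLu0, hLu⟩ := exists_lipschitz_ball S.isOpen_varDomain
    (S.contDiffOn_state.of_le h1k) hC hCW
  choose Lf hLf0 hLf using fun j => exists_lipschitz_ball S.isOpen_varDomain
    ((S.contDiffOn_fluxV j).of_le h1k) hC hCW
  obtain ⟨LF, hLF⟩ := F.lipschitz (S.state '' C)
    (hC.image_of_continuousOn (S.contDiffOn_state.continuousOn.mono hCW))
    (image_subset_iff.2 fun x hx => S.mapsTo_state (hCW hx))
  refine ⟨|LF| * Lu + ∑ j, Lf j, add_nonneg (by positivity) (Finset.sum_nonneg fun j _ => hLf0 j),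
    ?_⟩
  intro n v δ hn hball a ha b hb
  set mid := (1 / 2 : ℝ) • (a + b) with hmid
  have hmidB : mid ∈ Metric.closedBall v δ := by
    have := (convex_closedBall v δ) ha hb (by norm_num : (0 : ℝ) ≤ 1 / 2)
      (by norm_num : (0 : ℝ) ≤ 1 / 2) (by norm_num)
    rwa [← smul_add] at this
  have hmida : ‖mid - a‖ ≤ ‖a - b‖ := by
    have : mid - a = (1 / 2 : ℝ) • (b - a) := by
      rw [hmid]; module
    rw [this, norm_smul, norm_sub_rev]
    norm_num
    linarith [norm_nonneg (a - b)]
  have hn1 : ∀ j, |n j| ≤ 1 := fun j => by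
    rw [← hn]; exact PiLp.norm_apply_le n j
  -- consistency and Lipschitz continuity of the numerical flux
  have hflux : ‖F.onVar n a b - ∑ j, n j • S.fluxV j a‖ ≤ |LF| * Lu * ‖a - b‖ := by
    have hcons : F.onVar n a a = ∑ j, n j • S.fluxV j a :=
      F.consistent n hn _ (S.mapsTo_state (hCW (hball ha)))
    rw [← hcons]
    have haC := mem_image_of_mem S.state (hball ha)
    have h := hLF n hn _ haC _ (mem_image_of_mem S.state (hball hb)) _ haC _ haC
    rw [sub_self, norm_zero, zero_add] at h
    refine h.trans ?_
    have h2 := hLu v δ hball b hb a ha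
    rw [norm_sub_rev b a] at h2
    calc _ ≤ |LF| * (Lu * ‖a - b‖) :=
          mul_le_mul (le_abs_self _) h2 (norm_nonneg _) (abs_nonneg _)
      _ = _ := by ring
  -- second order Taylor expansion of the potential
  have hpot : ∀ j, |S.potential j mid - S.potential j a - inner ℝ (S.fluxV j a) (mid - a)|
      ≤ Lf j * ‖a - b‖ ^ 2 := by
    intro j
    have hseg : segment ℝ a mid ⊆ Metric.closedBall v δ :=
      (convex_closedBall v δ).segment_subset ha hmidB
    have h := (convex_segment a mid).norm_image_sub_le_of_norm_hasFDerivWithin_le (𝕜 := ℝ)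
      (f := fun w => S.potential j w - inner ℝ (S.fluxV j a) w)
      (f' := fun w => InnerProductSpace.toDual ℝ (E p) (S.fluxV j w)
        - InnerProductSpace.toDual ℝ (E p) (S.fluxV j a)) (C := Lf j * ‖a - b‖)
      (fun w hw => by
        have h1 := (S.hasGradientAt_potential j (hCW (hball (hseg hw)))).hasFDerivAt
        have h2 := (InnerProductSpace.toDual ℝ (E p) (S.fluxV j a)).hasFDerivAt (x := w)
        exact (h1.sub h2).hasFDerivWithinAt)
      (fun w hw => by
        rw [← map_sub, LinearIsometryEquiv.norm_map]
        refine (hLf j v δ hball w (hseg hw) a ha).trans ?_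
        have : ‖w - a‖ ≤ ‖mid - a‖ := by
          obtain ⟨t, ht, rfl⟩ := (segment_eq_image' ℝ a mid ▸ hw :)
          rw [add_sub_cancel_left, norm_smul, Real.norm_of_nonneg ht.1]
          exact mul_le_of_le_one_left (norm_nonneg _) ht.2
        exact mul_le_mul_of_nonneg_left (this.trans hmida) (hLf0 j))
      (left_mem_segment ℝ a mid) (right_mem_segment ℝ a mid)
    rw [Real.norm_eq_abs] at h
    have e : S.potential j mid - S.potential j a - inner ℝ (S.fluxV j a) (mid - a)
        = S.potential j mid - inner ℝ (S.fluxV j a) mid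
          - (S.potential j a - inner ℝ (S.fluxV j a) a) := by
      rw [inner_sub_right]; ring
    rw [e]
    refine h.trans ?_
    calc _ ≤ Lf j * ‖a - b‖ * ‖a - b‖ :=
          mul_le_mul_of_nonneg_left hmida (mul_nonneg (hLf0 j) (norm_nonneg _))
      _ = _ := by ring
  -- up to these two remainders, the terms of first order in `mid - a` cancel
  have hid : inner ℝ a (F.onVar n a b) - F.entropyFlux n a b - ∑ j, n j * S.potential j a
      = -inner ℝ (mid - a) (F.onVar n a b - ∑ j, n j • S.fluxV j a)
        + ∑ j, n j * (S.potential j mid - S.potential j a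
          - inner ℝ (S.fluxV j a) (mid - a)) := by
    simp only [NumericalFlux.entropyFlux, ← hmid, mul_sub, Finset.sum_sub_distrib,
      inner_sub_right (mid - a), inner_sum, inner_smul_right, real_inner_comm (mid - a),
      inner_sub_left]
    ring
  rw [hid, add_mul, Finset.sum_mul]
  refine (abs_add_le _ _).trans (add_le_add ?_ ((Finset.abs_sum_le_sum_abs _ _).trans
    (Finset.sum_le_sum fun j _ => ?_)))
  · rw [abs_neg]
    refine (abs_real_inner_le_norm _ _).trans ?_
    calc _ ≤ ‖a - b‖ * (|LF| * Lu * ‖a - b‖) :=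
          mul_le_mul hmida hflux (norm_nonneg _) (norm_nonneg _)
      _ = _ := by ring
  · rw [abs_mul]
    calc _ ≤ 1 * (Lf j * ‖a - b‖ ^ 2) :=
          mul_le_mul (hn1 j) (hpot j) (abs_nonneg _) zero_le_one
      _ = _ := one_mul _

end Jump

section Defect

variable {d p k : ℕ} {Ω : Set (E d)} {FE : FiniteElement d k} {T : Mesh d Ω}
  {S : EntropySystem d p (k + 1)}

theorem DGFun.contDiff_val (v : DGFun FE T p) (K : Fin T.nElem) {n : WithTop ℕ∞} :
    ContDiff ℝ n (v.val K) :=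
  ContDiff.sum fun σ _ => (contDiff_of_mem_polyFun (shape_mem_polyFun K σ)).smul contDiff_const

theorem DGFun.val_apply_mem_polyFun (v : DGFun FE T p) (K : Fin T.nElem) (l : Fin p) :
    (fun x => v.val K x l) ∈ polyFun d k := by
  have : (fun x => v.val K x l) = ∑ σ, v K σ l • shape FE T K σ := by
    ext x
    simp [DGFun.val, Finset.sum_apply, mul_comm]
  rw [this]
  exact Submodule.sum_mem _ fun σ _ => Submodule.smul_mem _ _ (shape_mem_polyFun K σ)

/-- The entropy defect as boundary terms minus a volume term: by `∇θ = f`, the volume integrand is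
the divergence of the potential of `V^h`. -/
theorem defect_eq (F : NumericalFlux S) (Q : Quadrature T) (v : DGFun FE T p) (K : Fin T.nElem)
    (hv : ∀ x ∈ T.elemSet K, v.val K x ∈ S.varDomain) :
    defect F Q v K
      = ∑ f ∈ T.bdry K, Q.facetInt f (fun x =>
          inner ℝ (v.val K x) (F.onVar (T.outward K f) (v.val K x) (v.val (T.neighbor K f) x))
          - F.entropyFlux (T.outward K f) (v.val K x) (v.val (T.neighbor K f) x))
        - ∑ j, Q.elemInt K (fun x =>
          fderiv ℝ (S.potential j ∘ v.val K) x (EuclideanSpace.single j 1)) := by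
  have hvol : Q.elemInt K (fun x => ∑ j,
      fderiv ℝ (S.potential j ∘ v.val K) x (EuclideanSpace.single j 1))
      = ∑ σ, inner ℝ (v K σ) (Q.elemInt K (fun x => ∑ j,
        fderiv ℝ (shape FE T K σ) x (EuclideanSpace.single j 1) • S.fluxV j (v.val K x))) := by
    have h1 : ∀ (w : E p) (u : E d → E p), inner ℝ w (Q.elemInt K u)
        = Q.elemInt K fun x => inner ℝ w (u x) := fun w u =>
      (Q.onElem K).map_integral volume (innerₗ (E p) w) u
    simp only [h1]
    simp only [Quadrature.elemInt]
    rw [← QuadRule.integral_sum]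
    refine QuadRule.integral_congr _ _ fun x hx => ?_
    simp only [inner_sum]
    rw [Finset.sum_comm]
    refine Finset.sum_congr rfl fun j _ => ?_
    have h2 := (S.hasGradientAt_potential j (hv x hx)).hasFDerivAt.comp x
      ((v.contDiff_val K (n := 1)).differentiable (by simp) x).hasFDerivAt
    rw [h2.fderiv, ContinuousLinearMap.comp_apply, v.fderiv_val,
      InnerProductSpace.toDual_apply_apply, inner_sum]
    refine Finset.sum_congr rfl fun σ _ => ?_
    rw [inner_smul_right, inner_smul_right, real_inner_comm]
  have hbd : ∑ σ, inner ℝ (v K σ) (Q.bdryInt K (fun f x => shape FE T K σ x •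
      F.onVar (T.outward K f) (v.val K x) (v.val (T.neighbor K f) x)))
      = ∑ f ∈ T.bdry K, Q.facetInt f (fun x => inner ℝ (v.val K x)
        (F.onVar (T.outward K f) (v.val K x) (v.val (T.neighbor K f) x))) := by
    have h1 : ∀ (f : Fin T.nFacet) (w : E p) (u : E d → E p), inner ℝ w (Q.facetInt f u)
        = Q.facetInt f fun x => inner ℝ w (u x) := fun f w u =>
      (Q.onFacet f).map_integral _ (innerₗ (E p) w) u
    simp only [Quadrature.bdryInt, inner_sum, h1]
    rw [Finset.sum_comm]
    refine Finset.sum_congr rfl fun f _ => ?_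
    simp only [Quadrature.facetInt]
    rw [← QuadRule.integral_sum]
    refine QuadRule.integral_congr _ _ fun x hx => ?_
    rw [DGFun.val, sum_inner]
    refine Finset.sum_congr rfl fun σ _ => ?_
    rw [inner_smul_right, inner_smul_left]
    rfl
  simp only [defect, residual, inner_add_right, inner_neg_right, Finset.sum_add_distrib,
    Finset.sum_neg_distrib, ← hvol, hbd, totalEntropyFlux, facetEntropyFlux]
  simp only [Quadrature.facetInt, Quadrature.elemInt, QuadRule.integral_sub,
    QuadRule.integral_sum, Finset.sum_sub_distrib]
  ring

/-- A compact neighbourhood of the values of `V`, within the admissible values. -/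
theorem exists_compact_nhd {d p : ℕ} {Ω : Set (E d)} (hΩb : Bornology.IsBounded Ω)
    {O : Set (E p)} (hO : IsOpen O) {V : E d → E p} (hV : ContinuousOn V (closure Ω))
    (hVO : ∀ x ∈ closure Ω, V x ∈ O) :
    ∃ (δ : ℝ) (C : Set (E p)), 0 < δ ∧ IsCompact C ∧ C ⊆ O ∧
      ∀ x ∈ closure Ω, Metric.closedBall (V x) δ ⊆ C := by
  have hc : IsCompact (V '' closure Ω) := hΩb.isCompact_closure.image_of_continuousOn hV
  obtain ⟨δ, hδ, hsub⟩ := hc.exists_cthickening_subset_open hO (image_subset_iff.2 hVO)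
  exact ⟨δ, _, hδ, hc.cthickening, hsub, fun x hx =>
    Metric.closedBall_subset_cthickening (mem_image_of_mem V hx) δ⟩

end Defect

section DefectBound

variable {m p k : ℕ} {Ω : Set (E (m + 1))}

/-- The entropy defect is `O(h^(d+k+1))`: the volume and face quadratures differ from the integrals
by `O(h^(k+1))` and `O(h^(k+2))`, the integrals cancel by the divergence theorem, and the jumps
enter quadratically. -/
theorem exists_defect_le (hΩb : Bornology.IsBounded Ω)
    (S : EntropySystem (m + 1) p (k + 1)) (F : NumericalFlux S) (FE : FiniteElement (m + 1) k)
    {W : Set (E (m + 1))} (hW : IsOpen W) (hΩW : closure Ω ⊆ W) {V : E (m + 1) → E p}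
    (hV : ContDiffOn ℝ (k + 1 : ℕ) V W) (hVmem : ∀ x ∈ closure Ω, V x ∈ S.varDomain)
    {κ : ℝ} (hκ : 0 < κ) (A M : ℝ) :
    ∃ C h₀ : ℝ, 0 < h₀ ∧ ∀ (T : Mesh (m + 1) Ω) (Q : Quadrature T) (v : DGFun FE T p),
      T.ShapeRegular κ → Q.HasOrder k (k + 1) → Q.Stable M → v.Approximates V A →
      T.size ≤ h₀ → ∀ K, |defect F Q v K| ≤ C * T.size ^ (m + 1 + k + 1) := by
  have hΩc : IsCompact (closure Ω) := hΩb.isCompact_closure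
  obtain ⟨δ, C₀, hδ, hC₀, hC₀O, hball⟩ := exists_compact_nhd hΩb S.isOpen_varDomain
    (hV.continuousOn.mono hΩW) hVmem
  obtain ⟨MV, hMV0, hMV⟩ := exists_iteratedFDeriv_bound hW hV hΩc hΩW
  obtain ⟨D, hD1, hD⟩ := exists_iteratedFDeriv_vec_le (m + 1) k p hκ A MV
  choose MG' hMG'0 hMG' using fun j => exists_iteratedFDeriv_comp_le (X := E (m + 1))
    S.isOpen_varDomain (S.contDiffOn_potential j) hC₀ hC₀O hD1
  obtain ⟨L, hL0, hL⟩ := exists_jump_le F hC₀ hC₀O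
  set MG := ∑ j, MG' j with hMGdef
  have hMG0 : 0 ≤ MG := Finset.sum_nonneg fun j _ => hMG'0 j
  have hMGle : ∀ j, MG' j ≤ MG := fun j =>
    Finset.single_le_sum (fun j _ => hMG'0 j) (Finset.mem_univ j)
  set ω := volume.real (Metric.closedBall (0 : E (m + 1)) 1) with hω
  set Ca := (m + 1) * κ * ω with hCa
  have hω0 : 0 ≤ ω := measureReal_nonneg
  have hCa0 : 0 ≤ Ca := by positivity
  -- The first term of the constant is the quadrature error on the element; the others are the jumps
  -- and the quadrature error on the facets. The bound on `h` keeps `V^h` within `δ` of `V`.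
  refine ⟨(m + 1) * (ω * ((M + 1) * MG)) + Ca * (M * (L * (2 * |A|) ^ 2)
    + (m + 1) * ((M + 1) * MG)), min 1 (δ / (|A| + 1)), by positivity, ?_⟩
  intro T Q v hT hQ hQM hA hsize K
  set H := T.size with hH
  set h := T.hElem K with hh
  have hh0 : 0 < h := T.hElem_pos (by omega) K
  have hhH : h ≤ H := T.hElem_le_size K
  have hH0 : 0 ≤ H := hh0.le.trans hhH
  have hH1 : H ≤ 1 := hsize.trans (min_le_left _ _)
  have hM0 : 0 ≤ M := (Finset.sum_nonneg fun _ _ => abs_nonneg _).trans (hQM.1 K)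
  have hHδ : |A| * H ^ (k + 1) ≤ δ := by
    have h1 : H ≤ δ / (|A| + 1) := hsize.trans (min_le_right _ _)
    rw [le_div_iff₀ (by positivity)] at h1
    have h2 : H ^ (k + 1) ≤ H := pow_le_of_le_one hH0 hH1 (by omega)
    nlinarith [abs_nonneg A, mul_le_mul_of_nonneg_left h2 (abs_nonneg A)]
  -- all values lie in the balls of radius `δ` around the values of `V`
  have hApp : ∀ K', ∀ x ∈ T.elemSet K', ‖v.val K' x - V x‖ ≤ |A| * H ^ (k + 1) := by
    intro K' x hx
    refine (hA K' x hx).trans (mul_le_mul (le_abs_self A) ?_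
      (pow_nonneg (T.hElem_nonneg K') _) (abs_nonneg A))
    exact pow_le_pow_left₀ (T.hElem_nonneg K') (T.hElem_le_size K') _
  have hin : ∀ K', ∀ x ∈ T.elemSet K', v.val K' x ∈ Metric.closedBall (V x) δ := by
    intro K' x hx
    rw [mem_closedBall_iff_norm]
    exact (hApp K' x hx).trans hHδ
  have hinC : ∀ x ∈ T.elemSet K, v.val K x ∈ C₀ := fun x hx =>
    hball x (T.elemSet_subset K hx) (hin K x hx)
  -- regularity of the potentials of `V^h`
  obtain ⟨c, hc⟩ := hT K
  have hcK : c ∈ T.elemSet K := hc (Metric.mem_closedBall_self (by positivity))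
  have hKball : T.elemSet K ⊆ Metric.closedBall c h := T.elemSet_subset_closedBall hcK
  have hstar := (T.convex_elemSet K).starConvex hcK
  have hDq := hD V (v.val K) (T.elemSet K) c h hh0 (hhH.trans hH1) hc hKball hstar
    (fun x hx => hV.contDiffAt (hW.mem_nhds (hΩW (T.elemSet_subset K hx))))
    (fun i hi x hx => hMV i hi x (T.elemSet_subset K hx)) (v.val_apply_mem_polyFun K)
    (fun x hx => hA K x hx)
  set G := fun j => S.potential j ∘ v.val K with hG
  have hGd : ∀ j, ∀ x ∈ T.elemSet K, ContDiffAt ℝ (k + 2 : ℕ) (G j) x := fun j x hx =>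
    ((S.contDiffOn_potential j).contDiffAt
      (S.isOpen_varDomain.mem_nhds (hC₀O (hinC x hx)))).comp x (v.contDiff_val K).contDiffAt
  have hGM : ∀ j, ∀ i ≤ k + 2, ∀ x ∈ T.elemSet K, ‖iteratedFDeriv ℝ i (G j) x‖ ≤ MG :=
    fun j i hi x hx => (hMG' j (v.val K) x (v.contDiff_val K) (hinC x hx)
      (fun i => hDq i x hx) i hi).trans (hMGle j)
  have hdiv := fun j => T.divergence hκ hT K (Q := G j)
    (fun x hx => (hGd j x hx).of_le (by exact_mod_cast Nat.le_add_left 1 (k + 1))) j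
  have hxh : ∀ x ∈ T.elemSet K, ‖x - c‖ ≤ h := fun x hx => by
    rw [← mem_closedBall_iff_norm]; exact hKball hx
  -- quadrature error on the element
  have hvol : ∀ j, |Q.elemInt K (fun x => fderiv ℝ (G j) x (EuclideanSpace.single j 1))
      - ∫ x in T.elemSet K, fderiv ℝ (G j) x (EuclideanSpace.single j 1)|
      ≤ ω * ((M + 1) * MG) * H ^ (m + 1 + k + 1) := by
    intro j
    have hfd : ∀ x ∈ T.elemSet K, ContDiffAt ℝ (k + 1 : ℕ) (fderiv ℝ (G j)) x := fun x hx =>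
      (hGd j x hx).fderiv_right (by norm_cast)
    have hgd : ∀ x ∈ T.elemSet K, ContDiffAt ℝ (k + 1 : ℕ)
        (fun x => fderiv ℝ (G j) x (EuclideanSpace.single j 1)) x := fun x hx =>
      (hfd x hx).clm_apply contDiffAt_const
    -- the derivative of the potential has `k + 1` bounded derivatives
    obtain ⟨P, hP, hPG, -⟩ := exists_taylor_polyFun hcK hstar (m := k) (M := MG) hgd
      (fun i hi x hx => by
        have h1 := norm_iteratedFDeriv_clm_apply_const (c := EuclideanSpace.single j (1 : ℝ))
          (hfd x hx) (n := i) (by exact_mod_cast hi)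
        rw [PiLp.norm_single, norm_one, one_mul, norm_iteratedFDeriv_fderiv] at h1
        exact h1.trans (hGM j (i + 1) (by omega) x hx))
    have h2 := (Q.onElem K).abs_integral_sub_le volume (hQM.1 K) (hQ.1 K) (T.isCompact_elemSet K)
      (T.isCompact_elemSet K).measure_lt_top
      (fun x hx => (hgd x hx).continuousAt.continuousWithinAt) hP (ε := MG * h ^ (k + 1))
      (fun x hx => (hPG x hx).trans (mul_le_mul_of_nonneg_left
        (pow_le_pow_left₀ (norm_nonneg _) (hxh x hx) _) hMG0)) (by positivity)
    refine h2.trans ?_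
    calc _ ≤ (h ^ (m + 1) * ω) * ((M + 1) * (MG * h ^ (k + 1))) :=
          mul_le_mul_of_nonneg_right (T.volume_elemSet_le K) (by positivity)
      _ = ω * ((M + 1) * MG) * h ^ (m + 1 + k + 1) := by ring
      _ ≤ _ := by gcongr
  -- quadrature error and jumps on the facets
  set a := fun f => (μHE[m] : Measure (E (m + 1))).real (T.facetSet f) with ha
  have ha0 : ∀ f, 0 ≤ a f := fun f => measureReal_nonneg
  have hfac : ∀ f ∈ T.bdry K, |Q.facetInt f (fun x =>
        inner ℝ (v.val K x) (F.onVar (T.outward K f) (v.val K x) (v.val (T.neighbor K f) x))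
        - F.entropyFlux (T.outward K f) (v.val K x) (v.val (T.neighbor K f) x))
      - ∑ j, T.outward K f j * ∫ y in T.facetSet f, G j y ∂μHE[m]|
      ≤ a f * ((M * (L * (2 * |A|) ^ 2) + (m + 1) * ((M + 1) * MG)) * H ^ (k + 2)) := by
    intro f hf
    set b := fun x =>
      inner ℝ (v.val K x) (F.onVar (T.outward K f) (v.val K x) (v.val (T.neighbor K f) x))
        - F.entropyFlux (T.outward K f) (v.val K x) (v.val (T.neighbor K f) x) with hb
    have hfK := T.facetSet_subset hf
    have hmeas : (μHE[m] : Measure (E (m + 1))) (T.facetSet f) < ⊤ :=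
      (T.flatBoundary K).measure_face_lt_top ⟨f, hf⟩
    have h1 : |(Q.onFacet f).integral μHE[m] (fun x => b x - ∑ j, T.outward K f j * G j x)|
        ≤ a f * (M * (L * (2 * |A|) ^ 2 * H ^ (k + 2))) := by
      refine (Q.onFacet f).abs_integral_le μHE[m] (hQM.2 f) (fun x hx => ?_) (by positivity)
      have hxN := T.facetSet_subset_neighbor K f hx
      refine (hL (T.outward K f) (V x) δ (T.norm_outward K f)
        (hball x (T.elemSet_subset K (hfK hx))) _ (hin K x (hfK hx)) _ (hin _ x hxN)).trans ?_
      have hjump : ‖v.val K x - v.val (T.neighbor K f) x‖ ≤ 2 * |A| * H ^ (k + 1) := by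
        have e : v.val K x - v.val (T.neighbor K f) x
            = (v.val K x - V x) - (v.val (T.neighbor K f) x - V x) := by abel
        rw [e]
        refine (norm_sub_le _ _).trans ((add_le_add (hApp K x (hfK hx)) (hApp _ x hxN)).trans_eq ?_)
        ring
      calc _ ≤ L * (2 * |A| * H ^ (k + 1)) ^ 2 := by gcongr
        _ = L * (2 * |A|) ^ 2 * H ^ (2 * k + 2) := by ring
        _ ≤ _ := mul_le_mul_of_nonneg_left
            (pow_le_pow_of_le_one hH0 hH1 (by omega)) (by positivity)
    have h2 : ∀ j, |(Q.onFacet f).integral μHE[m] (G j) - ∫ y in T.facetSet f, G j y ∂μHE[m]|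
        ≤ a f * ((M + 1) * (MG * H ^ (k + 2))) := by
      intro j
      obtain ⟨P, hP, hPG, -⟩ := exists_taylor_polyFun hcK hstar (m := k + 1) (M := MG) (hGd j)
        (hGM j)
      refine (Q.onFacet f).abs_integral_sub_le μHE[m] (hQM.2 f) (hQ.2 f) (T.isCompact_facetSet f)
        hmeas (fun x hx => (hGd j x (hfK hx)).continuousAt.continuousWithinAt) hP
        (fun x hx => (hPG x (hfK hx)).trans (mul_le_mul_of_nonneg_left
          (pow_le_pow_left₀ (norm_nonneg _) ((hxh x (hfK hx)).trans hhH) _) hMG0)) (by positivity)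
    have hsplit : Q.facetInt f b - ∑ j, T.outward K f j * ∫ y in T.facetSet f, G j y ∂μHE[m]
        = (Q.onFacet f).integral μHE[m] (fun x => b x - ∑ j, T.outward K f j * G j x)
          + ∑ j, T.outward K f j * ((Q.onFacet f).integral μHE[m] (G j)
            - ∫ y in T.facetSet f, G j y ∂μHE[m]) := by
      have h3 : ∀ j, (Q.onFacet f).integral μHE[m] (fun x => T.outward K f j * G j x)
          = T.outward K f j * (Q.onFacet f).integral μHE[m] (G j) := fun j =>
        ((Q.onFacet f).map_integral μHE[m] (LinearMap.mulLeft ℝ (T.outward K f j)) (G j)).symm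
      rw [QuadRule.integral_sub, QuadRule.integral_sum]
      simp only [h3, mul_sub, Finset.sum_sub_distrib]
      rw [Quadrature.facetInt]
      simp only [Nat.add_sub_cancel]
      ring
    rw [hsplit]
    refine (abs_add_le _ _).trans ?_
    have h4 : |∑ j, T.outward K f j * ((Q.onFacet f).integral μHE[m] (G j)
        - ∫ y in T.facetSet f, G j y ∂μHE[m])|
        ≤ (m + 1) * (a f * ((M + 1) * (MG * H ^ (k + 2)))) := by
      refine (Finset.abs_sum_le_sum_abs _ _).trans ?_
      calc _ ≤ ∑ _j : Fin (m + 1), a f * ((M + 1) * (MG * H ^ (k + 2))) := by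
            refine Finset.sum_le_sum fun j _ => ?_
            rw [abs_mul]
            have hn1 : |T.outward K f j| ≤ 1 := by
              rw [← T.norm_outward K f]; exact PiLp.norm_apply_le (T.outward K f) j
            exact (mul_le_of_le_one_left (abs_nonneg _) hn1).trans (h2 j)
        _ = _ := by simp
    refine (add_le_add h1 h4).trans_eq ?_
    ring
  rw [defect_eq F Q v K fun x hx => hC₀O (hinC x hx)]
  -- the exact integrals cancel
  have hcancel : ∑ f ∈ T.bdry K, ∑ j, T.outward K f j * ∫ y in T.facetSet f, G j y ∂μHE[m]
      = ∑ j, ∫ x in T.elemSet K, fderiv ℝ (G j) x (EuclideanSpace.single j 1) := by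
    rw [Finset.sum_comm]
    exact Finset.sum_congr rfl fun j _ => (hdiv j).symm
  have hsum : ∀ X Y Z : ℝ, X - Y = (X - Z) - (Y - Z) := fun X Y Z => by ring
  rw [hsum _ _ (∑ j, ∫ x in T.elemSet K, fderiv ℝ (G j) x (EuclideanSpace.single j 1))]
  nth_rewrite 1 [← hcancel]
  rw [← Finset.sum_sub_distrib, ← Finset.sum_sub_distrib]
  refine (abs_sub _ _).trans ?_
  have hE : |∑ j, (Q.elemInt K (fun x => fderiv ℝ (G j) x (EuclideanSpace.single j 1))
      - ∫ x in T.elemSet K, fderiv ℝ (G j) x (EuclideanSpace.single j 1))|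
      ≤ (m + 1) * (ω * ((M + 1) * MG)) * H ^ (m + 1 + k + 1) := by
    refine (Finset.abs_sum_le_sum_abs _ _).trans ((Finset.sum_le_sum fun j _ => hvol j).trans_eq ?_)
    simp [mul_assoc]
  have hFsum := (Finset.abs_sum_le_sum_abs _ _).trans (Finset.sum_le_sum hfac)
  refine (add_le_add hFsum hE).trans ?_
  rw [← Finset.sum_mul]
  have harea : ∑ f ∈ T.bdry K, a f ≤ Ca * H ^ m := (T.area_le hκ hT K).trans
    (mul_le_mul_of_nonneg_left (pow_le_pow_left₀ hh0.le hhH _) hCa0)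
  calc _ ≤ Ca * H ^ m * ((M * (L * (2 * |A|) ^ 2) + (m + 1) * ((M + 1) * MG)) * H ^ (k + 2))
        + (m + 1) * (ω * ((M + 1) * MG)) * H ^ (m + 1 + k + 1) := by gcongr
    _ = _ := by ring

end DefectBound

/-! ### Coefficients and values of finite element functions -/

section Reference

variable {d k : ℕ} (FE : FiniteElement d k)

theorem simplexBasis_coord_combination {d : ℕ} (s : Affine.Simplex ℝ (E d) d) {w : Fin (d + 1) → ℝ}
    (hw : ∑ i, w i = 1) (i : Fin (d + 1)) :
    (simplexBasis s).coord i (Finset.univ.affineCombination ℝ s.points w) = w i :=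
  (simplexBasis s).coord_apply_combination_of_mem (Finset.mem_univ i) hw

theorem coord_mem_Icc {Ω : Set (E d)} (T : Mesh d Ω) {K : Fin T.nElem} {x : E d}
    (hx : x ∈ T.elemSet K) (i : Fin (d + 1)) :
    (simplexBasis (T.elem K)).coord i x ∈ Icc (0 : ℝ) 1 := by
  obtain ⟨w, hw, hw01, rfl⟩ := hx
  rw [simplexBasis_coord_combination _ hw]
  exact hw01 i

/-- The shape functions are bounded on their element, uniformly over all simplices. -/
theorem exists_shape_le : ∃ C, 0 ≤ C ∧ ∀ (Ω : Set (E d)) (T : Mesh d Ω) (K : Fin T.nElem),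
    ∀ x ∈ T.elemSet K, ∀ σ, |shape FE T K σ x| ≤ C := by
  have h : ∀ σ, ∃ C, ∀ y ∈ Icc (0 : Fin d → ℝ) 1,
      ‖MvPolynomial.eval y (FE.basis σ : MvPolynomial (Fin d) ℝ)‖ ≤ C := fun σ =>
    isCompact_Icc.exists_bound_of_continuousOn (MvPolynomial.continuous_eval _).continuousOn
  choose C hC using h
  have hC0 : ∀ σ, 0 ≤ C σ := fun σ =>
    (norm_nonneg _).trans (hC σ 0 (left_mem_Icc.2 zero_le_one))
  refine ⟨∑ σ, C σ, Finset.sum_nonneg fun σ _ => hC0 σ, fun Ω T K x hx σ => ?_⟩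
  refine (hC σ _ ⟨fun i => (coord_mem_Icc T hx i.succ).1,
    fun i => (coord_mem_Icc T hx i.succ).2⟩).trans ?_
  exact Finset.single_le_sum (f := C) (fun σ _ => hC0 σ) (Finset.mem_univ σ)

/-- The coefficients of a finite element function are bounded by its values on the element,
uniformly over all simplices. -/
theorem exists_coeff_le_scalar (σ : Fin FE.nDof) : ∃ C, 0 ≤ C ∧ ∀ (Ω : Set (E d)) (T : Mesh d Ω)
    (K : Fin T.nElem) (w : Fin FE.nDof → ℝ) (B : ℝ),
    (∀ x ∈ T.elemSet K, |∑ τ, w τ * shape FE T K τ x| ≤ B) → |w σ| ≤ C * B := by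
  -- in barycentric coordinates, a box contained in the simplex
  let U : Set (Fin d → ℝ) := Set.pi univ fun _ => Ioo (0 : ℝ) ((d + 1 : ℝ)⁻¹)
  let ev : (Fin d → ℝ) → Module.Dual ℝ (Fin FE.nDof → ℝ) := fun y =>
    ∑ τ, MvPolynomial.eval y (FE.basis τ : MvPolynomial (Fin d) ℝ) • LinearMap.proj τ
  have hev : ∀ y w, ev y w
      = ∑ τ, w τ * MvPolynomial.eval y (FE.basis τ : MvPolynomial (Fin d) ℝ) := fun y w => by
    simp [ev, LinearMap.sum_apply, mul_comm]
  have hsep : ∀ w, (∀ y ∈ U, ev y w = 0) → w = 0 := by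
    intro w hw
    have hP : ((∑ τ, w τ • FE.basis τ : MvPolynomial.restrictTotalDegree (Fin d) ℝ k) :
        MvPolynomial (Fin d) ℝ) = 0 := by
      refine MvPolynomial.funext_set (fun _ => Ioo (0 : ℝ) ((d + 1 : ℝ)⁻¹))
        (fun _ => Ioo_infinite (by positivity)) fun y hy => ?_
      have := hw y hy
      rw [hev] at this
      rw [map_zero, ← this, Submodule.coe_sum, map_sum]
      exact Finset.sum_congr rfl fun τ _ => by simp [MvPolynomial.smul_eval]
    have h0 : ∑ τ, w τ • FE.basis τ = 0 := Subtype.ext hP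
    ext τ
    exact Fintype.linearIndependent_iff.1 FE.basis.linearIndependent w h0 τ
  obtain ⟨C, hC0, hC⟩ := exists_bound_of_separating U ev hsep (LinearMap.proj σ)
  refine ⟨C, hC0, fun Ω T K w B hB => hC w B fun y hy => ?_⟩
  have hsum : ∑ i, Fin.cons (1 - ∑ i, y i) y i = (1 : ℝ) := by
    rw [Fin.sum_univ_succ]; simp
  have hy0 : ∀ i, 0 ≤ y i := fun i => (hy i trivial).1.le
  have hle : ∑ i, y i ≤ 1 := by
    calc ∑ i, y i ≤ ∑ _i : Fin d, ((d + 1 : ℝ)⁻¹) :=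
          Finset.sum_le_sum fun i _ => (hy i trivial).2.le
      _ = d * (d + 1 : ℝ)⁻¹ := by simp
      _ ≤ 1 := by
          rw [← div_eq_mul_inv, div_le_one (by positivity)]; linarith
  have hmem : Finset.univ.affineCombination ℝ (T.elem K).points
      (Fin.cons (1 - ∑ i, y i) y : Fin (d + 1) → ℝ) ∈ T.elemSet K := by
    refine (Affine.Simplex.affineCombination_mem_closedInterior_iff hsum).2 fun i => ?_
    refine Fin.cases ?_ (fun i => ?_) i
    · simp only [Fin.cons_zero]
      exact ⟨by linarith, by linarith [Finset.sum_nonneg fun i (_ : i ∈ Finset.univ) => hy0 i]⟩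
    · simp only [Fin.cons_succ]
      exact ⟨hy0 i, (Finset.single_le_sum (fun i _ => hy0 i) (Finset.mem_univ i)).trans hle⟩
  have h := hB _ hmem
  rw [hev]
  convert h using 4 with τ
  rw [shape]
  congr 1
  congr 1
  ext i
  rw [simplexBasis_coord_combination _ hsum, Fin.cons_succ]

theorem norm_le_sum_abs {p : ℕ} (w : E p) : ‖w‖ ≤ ∑ l, |w l| := by
  have hw : w = ∑ l, w l • EuclideanSpace.single l (1 : ℝ) := by
    ext j; simp [Finset.sum_apply, Pi.single_apply]
  conv_lhs => rw [hw]
  refine (norm_sum_le _ _).trans (Finset.sum_le_sum fun l _ => ?_)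
  rw [norm_smul, PiLp.norm_single, norm_one, mul_one, Real.norm_eq_abs]

theorem exists_coeff_le (p : ℕ) : ∃ C, 0 ≤ C ∧ ∀ (Ω : Set (E d)) (T : Mesh d Ω)
    (w : DGFun FE T p) (K : Fin T.nElem) (B : ℝ),
    (∀ x ∈ T.elemSet K, ‖w.val K x‖ ≤ B) → ∀ σ, ‖w K σ‖ ≤ C * B := by
  choose C hC0 hC using exists_coeff_le_scalar FE
  refine ⟨p * ∑ σ, C σ, mul_nonneg (Nat.cast_nonneg _) (Finset.sum_nonneg fun σ _ => hC0 σ),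
    fun Ω T w K B hB σ => ?_⟩
  refine (norm_le_sum_abs _).trans ?_
  obtain ⟨x₀, hx₀⟩ := (T.elem K).nonempty_closedInterior
  have hB0 : 0 ≤ B := (norm_nonneg _).trans (hB x₀ hx₀)
  calc _ ≤ ∑ _l : Fin p, C σ * B := by
        refine Finset.sum_le_sum fun l _ => hC σ Ω T K (fun τ => w K τ l) B fun x hx => ?_
        refine le_trans (le_of_eq ?_) ((PiLp.norm_apply_le (w.val K x) l).trans (hB x hx))
        rw [Real.norm_eq_abs]
        congr 1
        simp [DGFun.val, Finset.sum_apply, mul_comm]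
    _ = p * (C σ * B) := by simp
    _ ≤ _ := by
        rw [mul_assoc]
        have := Finset.single_le_sum (f := C) (fun σ _ => hC0 σ) (Finset.mem_univ σ)
        gcongr

end Reference

section Spread

variable {d p k : ℕ} {Ω : Set (E d)} {FE : FiniteElement d k} {T : Mesh d Ω}

theorem DGFun.val_sub_const (v : DGFun FE T p) (K : Fin T.nElem) (a : E p) (x : E d) :
    v.val K x - a = ∑ σ, shape FE T K σ x • (v K σ - a) := by
  simp only [smul_sub, Finset.sum_sub_distrib, ← Finset.sum_smul, sum_shape, one_smul]
  rfl

theorem DGFun.norm_sub_mean_le (v : DGFun FE T p) (K : Fin T.nElem) (σ : Fin FE.nDof) :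
    ‖v K σ - v.mean K‖ ≤ Real.sqrt (v.spread K) := by
  refine Real.le_sqrt_of_sq_le ?_
  exact Finset.single_le_sum (f := fun σ => ‖v K σ - v.mean K‖ ^ 2) (fun σ _ => sq_nonneg _)
    (Finset.mem_univ σ)

/-- The oscillation of a finite element function is bounded by the spread of its coefficients. -/
theorem DGFun.norm_val_sub_le (v : DGFun FE T p) (K : Fin T.nElem) {C : ℝ} {x y : E d}
    (hx : ∀ σ, |shape FE T K σ x| ≤ C) (hy : ∀ σ, |shape FE T K σ y| ≤ C) :
    ‖v.val K x - v.val K y‖ ≤ 2 * C * FE.nDof * Real.sqrt (v.spread K) := by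
  have h : ∀ z, (∀ σ, |shape FE T K σ z| ≤ C) →
      ‖v.val K z - v.mean K‖ ≤ C * FE.nDof * Real.sqrt (v.spread K) := by
    intro z hz
    rw [v.val_sub_const]
    refine (norm_sum_le _ _).trans ?_
    calc _ ≤ ∑ _σ : Fin FE.nDof, C * Real.sqrt (v.spread K) := by
          refine Finset.sum_le_sum fun σ _ => ?_
          rw [norm_smul, Real.norm_eq_abs]
          exact mul_le_mul (hz σ) (v.norm_sub_mean_le K σ) (norm_nonneg _)
            ((abs_nonneg _).trans (hz σ))
      _ = _ := by simp; ring
  have e : v.val K x - v.val K y = (v.val K x - v.mean K) - (v.val K y - v.mean K) := by abel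
  rw [e]
  refine (norm_sub_le _ _).trans ((add_le_add (h x hx) (h y hy)).trans_eq (by ring))

end Spread

section Oscillation

variable {d p k : ℕ} {Ω : Set (E d)}

/-- Where the gradient of `V` does not vanish, an approximation of `V` oscillates by at least a
multiple of the size of the element, in the direction in which `V` varies most. -/
theorem exists_le_oscillation (hk : 1 ≤ k) (hΩb : Bornology.IsBounded Ω) {W : Set (E d)}
    (hW : IsOpen W) (hΩW : closure Ω ⊆ W) {V : E d → E p}
    (hV : ContDiffOn ℝ (k + 1 : ℕ) V W) (hV' : ∀ x ∈ closure Ω, fderiv ℝ V x ≠ 0)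
    {κ : ℝ} (hκ : 0 < κ) (A : ℝ) :
    ∃ η h₀ : ℝ, 0 < η ∧ 0 < h₀ ∧ ∀ (q : E d → E p) (K : Set (E d)) (c : E d) (h : ℝ), 0 < h →
      h ≤ h₀ → K ⊆ closure Ω → Convex ℝ K → Metric.closedBall c (h / κ) ⊆ K →
      K ⊆ Metric.closedBall c h → (∀ x ∈ K, ‖q x - V x‖ ≤ A * h ^ (k + 1)) →
      ∃ y ∈ K, η * h ≤ ‖q y - q c‖ := by
  have hΩc : IsCompact (closure Ω) := hΩb.isCompact_closure
  obtain ⟨MV, hMV0, hMV⟩ := exists_iteratedFDeriv_bound hW hV hΩc hΩW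
  have hV1 : ContDiffOn ℝ 1 V W := hV.of_le (by exact_mod_cast Nat.le_add_left 1 k)
  obtain ⟨μ, hμ, hμV⟩ : ∃ μ : ℝ, 0 < μ ∧ ∀ x ∈ closure Ω, μ ≤ ‖fderiv ℝ V x‖ := by
    rcases (closure Ω).eq_empty_or_nonempty with he | hne
    · exact ⟨1, one_pos, by simp [he]⟩
    · have hc : ContinuousOn (fun x => ‖fderiv ℝ V x‖) (closure Ω) :=
        ((hV1.continuousOn_fderiv_of_isOpen hW (by simp)).mono hΩW).norm
      obtain ⟨x₀, hx₀, hmin⟩ := hΩc.exists_isMinOn hne hc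
      exact ⟨_, norm_pos_iff.2 (hV' x₀ hx₀), fun x hx => hmin hx⟩
  refine ⟨μ / (4 * κ), min 1 (μ / (4 * κ) / (MV + 2 * |A| + 1)), by positivity, by positivity, ?_⟩
  intro q K c h hh hh0 hKΩ hconv hball hKball hA
  have hh1 : h ≤ 1 := hh0.trans (min_le_left _ _)
  have hhη : (MV + 2 * |A| + 1) * h ≤ μ / (4 * κ) := by
    have := hh0.trans (min_le_right _ _)
    rwa [le_div_iff₀ (by positivity), mul_comm] at this
  have hcK : c ∈ K := hball (Metric.mem_closedBall_self (by positivity))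
  -- a direction in which the derivative at `c` is at least half of its norm
  obtain ⟨e, he, hμe⟩ := (fderiv ℝ V c).exists_lt_apply_of_lt_opNorm
    ((half_lt_self hμ).trans_le (hμV c (hKΩ hcK)))
  have hyK : c + (h / κ) • e ∈ K := hball (by
    rw [Metric.mem_closedBall, dist_self_add_left, norm_smul, Real.norm_of_nonneg (by positivity)]
    exact mul_le_of_le_one_right (by positivity) he.le)
  refine ⟨c + (h / κ) • e, hyK, ?_⟩
  set y := c + (h / κ) • e with hy
  have hyc : y - c = (h / κ) • e := by simp [hy]
  have hdist : ∀ x ∈ K, ‖x - c‖ ≤ h := fun x hx => by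
    rw [← mem_closedBall_iff_norm]; exact hKball hx
  have hVd : ∀ x ∈ K, ContDiffAt ℝ (k + 1 : ℕ) V x := fun x hx =>
    hV.contDiffAt (hW.mem_nhds (hΩW (hKΩ hx)))
  have h2d : ∀ x ∈ K, ContDiffAt ℝ 2 V x := fun x hx =>
    (hVd x hx).of_le (by exact_mod_cast Nat.succ_le_succ hk)
  have hfd : ∀ x ∈ K, ‖fderiv ℝ V x - fderiv ℝ V c‖ ≤ MV * h := by
    intro x hx
    have h1 := hconv.norm_image_sub_le_of_norm_fderiv_le (𝕜 := ℝ) (f := fderiv ℝ V) (C := MV)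
      (fun z hz => ((h2d z hz).fderiv_right (m := 1) (by norm_num)).differentiableAt (by simp))
      (fun z hz => by
        rw [← norm_iteratedFDeriv_one, norm_iteratedFDeriv_fderiv]
        exact hMV 2 (by omega) z (hKΩ hz)) hcK hx
    exact h1.trans (mul_le_mul_of_nonneg_left (hdist x hx) hMV0)
  -- `V` differs from its linearization, and `q` from `V`, by `O(h²)`
  have hlin := hconv.norm_image_sub_le_of_norm_fderiv_le' (𝕜 := ℝ) (f := V) (C := MV * h)
    (fun z hz => (hVd z hz).differentiableAt (by simp)) hfd hcK hyK
  have hlin' : ‖V y - V c - fderiv ℝ V c (y - c)‖ ≤ MV * h ^ 2 := hlin.trans (by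
    calc _ ≤ MV * h * h := mul_le_mul_of_nonneg_left (hdist y hyK) (by positivity)
      _ = _ := by ring)
  have hD : 2 * (μ / (4 * κ)) * h ≤ ‖fderiv ℝ V c (y - c)‖ := by
    rw [hyc, map_smul, norm_smul, Real.norm_of_nonneg (by positivity)]
    calc _ = h / κ * (μ / 2) := by field_simp; ring
      _ ≤ _ := mul_le_mul_of_nonneg_left hμe.le (by positivity)
  have hA' : ∀ x ∈ K, ‖q x - V x‖ ≤ |A| * h ^ 2 := fun x hx => (hA x hx).trans
    (mul_le_mul (le_abs_self A) (pow_le_pow_of_le_one hh.le hh1 (by omega)) (by positivity)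
      (abs_nonneg A))
  have e1 : fderiv ℝ V c (y - c) = (q y - q c) - ((q y - V y) - (q c - V c))
      - (V y - V c - fderiv ℝ V c (y - c)) := by abel
  have h3 : ‖fderiv ℝ V c (y - c)‖ ≤ ‖q y - q c‖ + (|A| * h ^ 2 + |A| * h ^ 2) + MV * h ^ 2 := by
    conv_lhs => rw [e1]
    refine (norm_sub_le _ _).trans (add_le_add ((norm_sub_le _ _).trans (add_le_add_right
      ((norm_sub_le _ _).trans (add_le_add (hA' y hyK) (hA' c hcK))) _)) hlin')
  nlinarith [mul_le_mul_of_nonneg_right hhη hh.le, sq_nonneg h]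

end Oscillation

/-! ### The correction -/

section Correction

variable {d p k : ℕ} {Ω : Set (E d)} {FE : FiniteElement d k} {T : Mesh d Ω}
  {S : EntropySystem d p (k + 1)}

theorem norm_correction_le (F : NumericalFlux S) (Q : Quadrature T) (v : DGFun FE T p)
    (K : Fin T.nElem) {s B : ℝ} (hs : 0 < s) (hsv : s ≤ Real.sqrt (v.spread K))
    (hB : |defect F Q v K| ≤ B) (σ : Fin FE.nDof) : ‖correction F Q v K σ‖ ≤ B / s := by
  have hsq : 0 < Real.sqrt (v.spread K) := hs.trans_le hsv
  have hspos : 0 < v.spread K := Real.sqrt_pos.1 hsq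
  have hB0 : 0 ≤ B := (abs_nonneg _).trans hB
  rw [correction, norm_smul, norm_div, norm_neg, Real.norm_eq_abs, Real.norm_of_nonneg hspos.le]
  calc _ ≤ B / v.spread K * Real.sqrt (v.spread K) := by
        gcongr
        exact v.norm_sub_mean_le K σ
    _ = B / Real.sqrt (v.spread K) := by
        nth_rewrite 1 [← Real.mul_self_sqrt hspos.le]
        field_simp
    _ ≤ B / s := by gcongr

/-- The square of the `H¹` norm of a finite element function on one element. -/
noncomputable def DGFun.energy (v : DGFun FE T p) (K : Fin T.nElem) : ℝ :=
  ∫ x in T.elemSet K,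
    (‖v.val K x‖ ^ 2 + ∑ j, ‖fderiv ℝ (v.val K) x (EuclideanSpace.single j 1)‖ ^ 2)

theorem DGFun.energy_nonneg (v : DGFun FE T p) (K : Fin T.nElem) : 0 ≤ v.energy K :=
  integral_nonneg fun _ => add_nonneg (sq_nonneg _) (Finset.sum_nonneg fun _ _ => sq_nonneg _)

theorem fderiv_val_apply_mem_polyFun (v : DGFun FE T p) (K : Fin T.nElem) (e : E d) (l : Fin p) :
    (fun x => fderiv ℝ (v.val K) x e l) ∈ polyFun d k := by
  have h : (fun x => fderiv ℝ (v.val K) x e l) = fun x => fderiv ℝ (fun y => v.val K y l) x e := by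
    ext x
    have h1 := (EuclideanSpace.proj l : E p →L[ℝ] ℝ).hasFDerivAt.comp x
      ((v.contDiff_val K (n := 1)).differentiable (by simp) x).hasFDerivAt
    have h2 : fderiv ℝ (fun y => v.val K y l) x = _ := h1.fderiv
    rw [h2]
    rfl
  rw [h]
  exact fderiv_mem_polyFun (v.val_apply_mem_polyFun K l) e

variable (FE p) in
/-- The coefficients of a finite element function in an element differ from its value at a point by
at most `h^(1-d/2)` times the `H¹` norm on the element: the oscillation of the function is at most
`h` times the maximum of the gradient, which is controlled by its `L²` norm. -/
theorem exists_coeff_sub_le {κ : ℝ} (hκ : 0 < κ) :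
    ∃ C, 0 ≤ C ∧ ∀ (Ω : Set (E d)) (T : Mesh d Ω) (v : DGFun FE T p) (K : Fin T.nElem) (c : E d),
      0 < T.hElem K → Metric.closedBall c (T.hElem K / κ) ⊆ T.elemSet K →
      ∀ σ, ‖v K σ - v.val K c‖
        ≤ C * T.hElem K * Real.sqrt ((T.hElem K ^ d)⁻¹ * v.energy K) := by
  obtain ⟨C₁, hC₁0, hC₁⟩ := exists_coeff_le FE p
  obtain ⟨C₂, hC₂0, hC₂⟩ := exists_sq_le_integral_ball d k (inv_pos.2 hκ)
  refine ⟨C₁ * (d * Real.sqrt C₂), by positivity, ?_⟩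
  intro Ω T v K c hh hball σ
  set h := T.hElem K with hhdef
  have hcK : c ∈ T.elemSet K := hball (Metric.mem_closedBall_self (by positivity))
  have hKball : T.elemSet K ⊆ Metric.closedBall c h := T.elemSet_subset_closedBall hcK
  set R := Real.sqrt ((h ^ d)⁻¹ * v.energy K) with hR
  have hcont1 : Continuous (v.val K) := (v.contDiff_val K (n := 0)).continuous
  have hcont2 : ∀ e : E d, Continuous fun x => fderiv ℝ (v.val K) x e := fun e =>
    ((v.contDiff_val K (n := 1)).continuous_fderiv (by simp)).clm_apply continuous_const
  -- the directional derivatives are polynomials, bounded by their `L²` norm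
  have hdir : ∀ j, ∀ x ∈ T.elemSet K,
      ‖fderiv ℝ (v.val K) x (EuclideanSpace.single j 1)‖ ≤ Real.sqrt C₂ * R := by
    intro j x hx
    rw [hR, ← Real.sqrt_mul hC₂0]
    refine Real.le_sqrt_of_sq_le ?_
    set e : E d := EuclideanSpace.single j 1 with he
    have hint : ∀ l : Fin p, IntegrableOn (fun y => fderiv ℝ (v.val K) y e l ^ 2)
        (Metric.closedBall c (h * κ⁻¹)) := fun l => by
      have := contDiff_of_mem_polyFun (fderiv_val_apply_mem_polyFun v K e l) (n := 0)
      exact (this.continuous.pow 2).continuousOn.integrableOn_compact (isCompact_closedBall _ _)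
    calc _ = ∑ l, fderiv ℝ (v.val K) x e l ^ 2 := by
          rw [EuclideanSpace.norm_sq_eq]; simp
      _ ≤ ∑ l, C₂ * (h ^ d)⁻¹ *
            ∫ y in Metric.closedBall c (h * κ⁻¹), fderiv ℝ (v.val K) y e l ^ 2 :=
          Finset.sum_le_sum fun l _ =>
            hC₂ _ (fderiv_val_apply_mem_polyFun v K e l) c h hh x (hKball hx)
      _ = C₂ * (h ^ d)⁻¹ *
            ∫ y in Metric.closedBall c (h * κ⁻¹), ‖fderiv ℝ (v.val K) y e‖ ^ 2 := by
          rw [← Finset.mul_sum, ← integral_finsetSum _ fun l _ => hint l]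
          congr 2
          ext y
          rw [EuclideanSpace.norm_sq_eq]; simp
      _ ≤ C₂ * (h ^ d)⁻¹ * v.energy K := by
          refine mul_le_mul_of_nonneg_left ?_ (by positivity)
          have hsub : Metric.closedBall c (h * κ⁻¹) ⊆ T.elemSet K := by
            rwa [← div_eq_mul_inv]
          have hcj : Continuous fun y => ‖fderiv ℝ (v.val K) y e‖ ^ 2 := (hcont2 e).norm.pow 2
          refine (setIntegral_mono_set (hcj.continuousOn.integrableOn_compact
            (T.isCompact_elemSet K)) (Eventually.of_forall fun y => sq_nonneg _)
            hsub.eventuallyLE).trans ?_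
          refine setIntegral_mono (hcj.continuousOn.integrableOn_compact
            (T.isCompact_elemSet K)) (ContinuousOn.integrableOn_compact (T.isCompact_elemSet K)
              (Continuous.continuousOn ?_)) fun y => ?_
          · exact (hcont1.norm.pow 2).add
              (continuous_finsetSum _ fun j _ => (hcont2 _).norm.pow 2)
          · have := Finset.single_le_sum (f := fun j =>
              ‖fderiv ℝ (v.val K) y (EuclideanSpace.single j 1)‖ ^ 2)
              (fun j _ => sq_nonneg _) (Finset.mem_univ j)
            have h2 := sq_nonneg ‖v.val K y‖
            linarith
      _ = _ := by ring
  have hgrad : ∀ x ∈ T.elemSet K, ‖fderiv ℝ (v.val K) x‖ ≤ d * (Real.sqrt C₂ * R) := by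
    intro x hx
    refine ContinuousLinearMap.opNorm_le_bound _ (by positivity) fun w => ?_
    have hw : w = ∑ j, w j • EuclideanSpace.single j (1 : ℝ) := by
      ext j; simp [Finset.sum_apply, Pi.single_apply]
    conv_lhs => rw [hw, map_sum]
    refine (norm_sum_le _ _).trans ?_
    calc _ ≤ ∑ _j : Fin d, ‖w‖ * (Real.sqrt C₂ * R) := by
          refine Finset.sum_le_sum fun j _ => ?_
          rw [map_smul, norm_smul]
          exact mul_le_mul (PiLp.norm_apply_le w j) (hdir j x hx) (norm_nonneg _) (norm_nonneg _)
      _ = _ := by simp; ring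
  have hosc : ∀ x ∈ T.elemSet K, ‖v.val K x - v.val K c‖ ≤ d * (Real.sqrt C₂ * R) * h := by
    intro x hx
    refine ((T.convex_elemSet K).norm_image_sub_le_of_norm_fderiv_le (𝕜 := ℝ)
      (fun z _ => (v.contDiff_val K (n := 1)).differentiable (by simp) z) hgrad hcK hx).trans ?_
    refine mul_le_mul_of_nonneg_left ?_ (by positivity)
    rw [← mem_closedBall_iff_norm]; exact hKball hx
  -- apply the bound of coefficients by values to the function minus a constant
  have := hC₁ Ω T (fun K' σ => v K' σ - v.val K c) K (d * (Real.sqrt C₂ * R) * h)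
    (fun x hx => by
      have h1 := hosc x hx
      rwa [v.val_sub_const] at h1) σ
  exact this.trans_eq (by ring)

theorem DGFun.normH1_eq (v : DGFun FE T p) : v.normH1 = Real.sqrt (∑ K, v.energy K) := rfl

theorem DGFun.normH1_nonneg (v : DGFun FE T p) : 0 ≤ v.normH1 := Real.sqrt_nonneg _

/-- The correction has zero sum in every element, so that only the variation of the test function
counts in the weak truncation error. -/
theorem exists_sum_inner_correction_le (hd : 1 ≤ d) (hΩb : Bornology.IsBounded Ω)
    (F : NumericalFlux S) (FE : FiniteElement d k) {κ : ℝ} (hκ : 0 < κ) {B : ℝ} (hB : 0 ≤ B) :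
    ∃ C, 0 ≤ C ∧ ∀ (T : Mesh d Ω) (Q : Quadrature T) (v : DGFun FE T p),
      T.ShapeRegular κ → T.QuasiUniform κ →
      (∀ K σ, ‖correction F Q v K σ‖ ≤ B * T.size ^ (k + d)) → ∀ φ : DGFun FE T p,
      |∑ K, ∑ σ, inner ℝ (φ K σ) (correction F Q v K σ)|
        ≤ C * φ.normH1 * T.size ^ (k + 1) := by
  obtain ⟨C₁, hC₁0, hC₁⟩ := exists_coeff_sub_le p FE hκ
  set C₂ := (κ ^ 2) ^ d * volume.real (closure Ω)
    / volume.real (Metric.closedBall (0 : E d) 1) with hC₂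
  have hC₂0 : 0 ≤ C₂ := by positivity
  refine ⟨FE.nDof * (B * (C₁ * Real.sqrt (κ ^ d) * Real.sqrt C₂)), by positivity, ?_⟩
  intro T Q v hT hQU hr φ
  -- an empty mesh has size zero, so that no power of the size can be divided by
  rcases Nat.eq_zero_or_pos T.nElem with h0 | hpos
  · have : IsEmpty (Fin T.nElem) := by rw [h0]; infer_instance
    rw [Finset.univ_eq_empty, Finset.sum_empty, abs_zero]
    have := φ.normH1_nonneg
    have := T.size_nonneg
    positivity
  set H := T.size with hHdef
  have hH : 0 < H := (T.hElem_pos hd ⟨0, hpos⟩).trans_le (T.hElem_le_size _)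
  have hK : ∀ K, |∑ σ, inner ℝ (φ K σ) (correction F Q v K σ)|
      ≤ FE.nDof * (B * H ^ (k + d) * (C₁ * H * (Real.sqrt (κ ^ d) * (Real.sqrt (H ^ d))⁻¹)))
        * Real.sqrt (φ.energy K) := by
    intro K
    obtain ⟨c, hc⟩ := hT K
    have hh := T.hElem_pos hd K
    -- the correction has zero sum
    have e1 : ∑ σ, inner ℝ (φ K σ) (correction F Q v K σ)
        = ∑ σ, inner ℝ (φ K σ - φ.val K c) (correction F Q v K σ) := by
      simp only [inner_sub_left, Finset.sum_sub_distrib, ← inner_sum, sum_correction,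
        inner_zero_right, sub_zero]
    have hcoef : ∀ σ, ‖φ K σ - φ.val K c‖
        ≤ C₁ * H * (Real.sqrt (κ ^ d) * (Real.sqrt (H ^ d))⁻¹) * Real.sqrt (φ.energy K) := by
      intro σ
      refine (hC₁ Ω T φ K c hh hc σ).trans ?_
      have h1 : (T.hElem K ^ d)⁻¹ ≤ κ ^ d * (H ^ d)⁻¹ := by
        rw [← div_eq_mul_inv, le_div_iff₀ (by positivity), inv_mul_le_iff₀ (by positivity),
          ← mul_pow, mul_comm (T.hElem K)]
        exact pow_le_pow_left₀ hH.le (hQU K) d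
      have h2 : Real.sqrt ((T.hElem K ^ d)⁻¹ * φ.energy K)
          ≤ Real.sqrt (κ ^ d) * (Real.sqrt (H ^ d))⁻¹ * Real.sqrt (φ.energy K) := by
        rw [← Real.sqrt_inv, ← Real.sqrt_mul (by positivity), ← Real.sqrt_mul (by positivity)]
        exact Real.sqrt_le_sqrt (mul_le_mul_of_nonneg_right h1 (φ.energy_nonneg K))
      calc _ ≤ C₁ * H * (Real.sqrt (κ ^ d) * (Real.sqrt (H ^ d))⁻¹ * Real.sqrt (φ.energy K)) := by
            refine mul_le_mul (mul_le_mul_of_nonneg_left (T.hElem_le_size K) hC₁0) h2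
              (Real.sqrt_nonneg _) (by positivity)
        _ = _ := by ring
    rw [e1]
    refine (Finset.abs_sum_le_sum_abs _ _).trans ?_
    calc _ ≤ ∑ _σ : Fin FE.nDof,
          (C₁ * H * (Real.sqrt (κ ^ d) * (Real.sqrt (H ^ d))⁻¹) * Real.sqrt (φ.energy K))
            * (B * H ^ (k + d)) := by
          refine Finset.sum_le_sum fun σ _ => (abs_real_inner_le_norm _ _).trans ?_
          exact mul_le_mul (hcoef σ) (hr K σ) (norm_nonneg _) (by positivity)
      _ = _ := by simp; ring
  -- Cauchy–Schwarz over the elements, of which there are `O(h⁻ᵈ)`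
  have hcs : ∑ K, Real.sqrt (φ.energy K) ≤ Real.sqrt C₂ * (Real.sqrt (H ^ d))⁻¹ * φ.normH1 := by
    have h1 : (∑ K, Real.sqrt (φ.energy K)) ^ 2 ≤ T.nElem * ∑ K, φ.energy K := by
      have := sq_sum_le_card_mul_sum_sq (s := (Finset.univ : Finset (Fin T.nElem)))
        (f := fun K => Real.sqrt (φ.energy K))
      simpa [Real.sq_sqrt (φ.energy_nonneg _)] using this
    have h2 : (T.nElem : ℝ) ≤ C₂ * (H ^ d)⁻¹ := by
      rw [← div_eq_mul_inv, le_div_iff₀ (by positivity)]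
      exact T.nElem_mul_le hΩb hκ hT hQU
    rw [φ.normH1_eq, ← Real.sqrt_inv, ← Real.sqrt_mul hC₂0, ← Real.sqrt_mul (by positivity)]
    refine Real.le_sqrt_of_sq_le (h1.trans ?_)
    exact mul_le_mul_of_nonneg_right h2 (Finset.sum_nonneg fun K _ => φ.energy_nonneg K)
  refine (Finset.abs_sum_le_sum_abs _ _).trans ((Finset.sum_le_sum fun K _ => hK K).trans ?_)
  rw [← Finset.mul_sum]
  have hsq : (Real.sqrt (H ^ d))⁻¹ * (Real.sqrt (H ^ d))⁻¹ = (H ^ d)⁻¹ := by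
    rw [← mul_inv, Real.mul_self_sqrt (by positivity)]
  calc _ ≤ FE.nDof * (B * H ^ (k + d) * (C₁ * H * (Real.sqrt (κ ^ d) * (Real.sqrt (H ^ d))⁻¹)))
        * (Real.sqrt C₂ * (Real.sqrt (H ^ d))⁻¹ * φ.normH1) :=
        mul_le_mul_of_nonneg_left hcs (by positivity)
    _ = FE.nDof * (B * (C₁ * Real.sqrt (κ ^ d) * Real.sqrt C₂)) * φ.normH1 * (H ^ (k + 1) * H ^ d
        * ((Real.sqrt (H ^ d))⁻¹ * (Real.sqrt (H ^ d))⁻¹)) := by ring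
    _ = _ := by
        rw [hsq, mul_assoc (H ^ (k + 1)), mul_inv_cancel₀ (by positivity), mul_one]

/-- The correction is of the order of the residuals: the defect is `O(h^(d+k+1))` and the spread of
the coefficients is bounded below by a multiple of `h²`. -/
theorem exists_correction_le {m : ℕ} {Ω : Set (E (m + 1))} (hk : 1 ≤ k)
    (hΩb : Bornology.IsBounded Ω) (S : EntropySystem (m + 1) p (k + 1)) (F : NumericalFlux S)
    (FE : FiniteElement (m + 1) k) {W : Set (E (m + 1))} (hW : IsOpen W) (hΩW : closure Ω ⊆ W)
    {V : E (m + 1) → E p} (hV : ContDiffOn ℝ (k + 1 : ℕ) V W)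
    (hVmem : ∀ x ∈ closure Ω, V x ∈ S.varDomain) (hV' : ∀ x ∈ closure Ω, fderiv ℝ V x ≠ 0)
    {κ : ℝ} (hκ : 0 < κ) (A M : ℝ) :
    ∃ C h₀ : ℝ, 0 ≤ C ∧ 0 < h₀ ∧ ∀ (T : Mesh (m + 1) Ω) (Q : Quadrature T) (v : DGFun FE T p),
      T.ShapeRegular κ → T.QuasiUniform κ → Q.HasOrder k (k + 1) → Q.Stable M →
      v.Approximates V A → T.size ≤ h₀ →
      (∀ K, v.spread K ≠ 0) ∧ ∀ K σ, ‖correction F Q v K σ‖ ≤ C * T.size ^ (k + (m + 1)) := by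
  obtain ⟨CD, h₁, hh₁, hCD⟩ := exists_defect_le hΩb S F FE hW hΩW hV hVmem hκ A M
  obtain ⟨η, h₂, hη, hh₂, hosc⟩ := exists_le_oscillation hk hΩb hW hΩW hV hV' hκ A
  obtain ⟨Cs, hCs0, hCs⟩ := exists_shape_le FE
  set D := 2 * Cs * FE.nDof + 1 with hD
  have hD0 : 0 < D := by positivity
  refine ⟨|CD| * κ * D / η, min h₁ h₂, by positivity, lt_min hh₁ hh₂, ?_⟩
  intro T Q v hT hQU hQ hQM hA hsize
  -- the oscillation bounds the spread from below
  have hs : ∀ K, 0 < η * T.hElem K / D ∧ η * T.hElem K / D ≤ Real.sqrt (v.spread K) := by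
    intro K
    have hh := T.hElem_pos (by omega) K
    refine ⟨by positivity, ?_⟩
    obtain ⟨c, hc⟩ := hT K
    have hcK : c ∈ T.elemSet K := hc (Metric.mem_closedBall_self (by positivity))
    obtain ⟨y, hy, hyc⟩ := hosc (v.val K) (T.elemSet K) c (T.hElem K) hh
      ((T.hElem_le_size K).trans (hsize.trans (min_le_right _ _))) (T.elemSet_subset K)
      (T.convex_elemSet K) hc (T.elemSet_subset_closedBall hcK) (hA K)
    rw [div_le_iff₀ hD0]
    have h1 := hyc.trans (v.norm_val_sub_le K (hCs Ω T K y hy) (hCs Ω T K c hcK))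
    have h2 := Real.sqrt_nonneg (v.spread K)
    nlinarith
  refine ⟨fun K h0 => ?_, fun K σ => ?_⟩
  · have := (hs K).1.trans_le (hs K).2
    rw [h0, Real.sqrt_zero] at this
    exact lt_irrefl _ this
  · have hh := T.hElem_pos (by omega) K
    have hH : 0 < T.size := hh.trans_le (T.hElem_le_size K)
    have hdef : |defect F Q v K| ≤ |CD| * T.size ^ (m + 1 + k + 1) :=
      (hCD T Q v hT hQ hQM hA (hsize.trans (min_le_left _ _)) K).trans
        (mul_le_mul_of_nonneg_right (le_abs_self _) (by positivity))
    refine (norm_correction_le F Q v K (hs K).1 (hs K).2 hdef σ).trans ?_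
    rw [div_le_iff₀ (hs K).1]
    calc |CD| * T.size ^ (m + 1 + k + 1) = |CD| * T.size ^ (k + (m + 1)) * T.size := by ring
      _ ≤ |CD| * T.size ^ (k + (m + 1)) * (κ * T.hElem K) :=
          mul_le_mul_of_nonneg_left (hQU K) (by positivity)
      _ = _ := by field_simp

theorem truncationError_correctedResidual (F : NumericalFlux S) (fb : E d → E p → E p → E p)
    (ub : E d → E p) (Q : Quadrature T) (v φ : DGFun FE T p) :
    truncationError S fb ub Q v (correctedResidual F Q v) φ
      = truncationError S fb ub Q v (residual F Q v) φ
        + ∑ K, ∑ σ, inner ℝ (φ K σ) (correction F Q v K σ) := by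
  simp only [truncationError, correctedResidual, inner_add_right, Finset.sum_add_distrib]
  ring

end Correction

end DGEntropy

theorem mainTheorem2 (d p k : ℕ) (hd : 1 ≤ d) (hk : 1 ≤ k)
    (Ω : Set (DGEntropy.E d)) (hΩ : IsOpen Ω) (hΩb : Bornology.IsBounded Ω)
    (S : DGEntropy.EntropySystem d p (k + 1)) (F : DGEntropy.NumericalFlux S)
    (FE : DGEntropy.FiniteElement d k)
    (W : Set (DGEntropy.E d)) (hW : IsOpen W) (hΩW : closure Ω ⊆ W)
    (V : DGEntropy.E d → DGEntropy.E p) (hV : ContDiffOn ℝ ((k + 1 : ℕ) : WithTop ℕ∞) V W)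
    (hVmem : ∀ x ∈ closure Ω, V x ∈ S.varDomain) :
    -- `∇θ = f`, and `ĝ` is consistent with the entropy flux
    (∀ v ∈ S.varDomain,
      (∀ j, HasGradientAt (S.potential j) (S.fluxV j v) v) ∧
      ∀ n : DGEntropy.E d, ‖n‖ = 1 →
        F.entropyFlux n v v = ∑ j, n j * S.entropyFlux j (S.state v)) ∧
    -- local conservation, of the conserved variables and of the entropy
    (∀ (T : DGEntropy.Mesh d Ω) (Q : DGEntropy.Quadrature T) (v : DGEntropy.DGFun FE T p),
      (∀ K, ∑ σ, DGEntropy.correctedResidual F Q v K σ = DGEntropy.totalFlux F Q v K) ∧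
      (∀ K, v.spread K ≠ 0 →
        ∑ σ, inner ℝ (v K σ) (DGEntropy.correctedResidual F Q v K σ)
          = DGEntropy.totalEntropyFlux F Q v K) ∧
      (F.Conservative → ∀ f K, T.opp f = some K →
        DGEntropy.facetEntropyFlux F Q v (T.side f) f
          + DGEntropy.facetEntropyFlux F Q v K f = 0)) ∧
    -- the entropy defect is `O(h^(d+k+1))`
    (∀ κ > 0, ∀ A M : ℝ, ∃ C h₀ : ℝ, 0 < h₀ ∧
      ∀ (T : DGEntropy.Mesh d Ω) (Q : DGEntropy.Quadrature T) (v : DGEntropy.DGFun FE T p),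
        T.ShapeRegular κ → Q.HasOrder k (k + 1) → Q.Stable M → v.Approximates V A →
        T.size ≤ h₀ →
        ∀ K, |DGEntropy.defect F Q v K| ≤ C * T.size ^ (d + k + 1)) ∧
    -- the corrected scheme keeps the order `k + 1`
    ((∀ x ∈ closure Ω, fderiv ℝ V x ≠ 0) →
      ∀ κ > 0, ∀ A M B : ℝ, ∃ C h₀ : ℝ, 0 < h₀ ∧
      ∀ (T : DGEntropy.Mesh d Ω) (Q : DGEntropy.Quadrature T) (v : DGEntropy.DGFun FE T p),
        T.ShapeRegular κ → T.QuasiUniform κ → Q.HasOrder k (k + 1) → Q.Stable M →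
        v.Approximates V A → T.size ≤ h₀ →
        (∀ K, v.spread K ≠ 0) ∧
        (∀ K σ, ‖DGEntropy.correction F Q v K σ‖ ≤ C * T.size ^ (k + d)) ∧
        ((∀ K σ, ‖DGEntropy.residual F Q v K σ‖ ≤ B * T.size ^ (k + d)) →
          ∀ K σ, ‖DGEntropy.correctedResidual F Q v K σ‖ ≤ C * T.size ^ (k + d)) ∧
        (∀ (fb : DGEntropy.E d → DGEntropy.E p → DGEntropy.E p → DGEntropy.E p)
            (ub : DGEntropy.E d → DGEntropy.E p),
          (∀ φ : DGEntropy.DGFun FE T p, φ.IsContinuous →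
            |DGEntropy.truncationError S fb ub Q v (DGEntropy.residual F Q v) φ|
              ≤ B * φ.normH1 * T.size ^ (k + 1)) →
          ∀ φ : DGEntropy.DGFun FE T p, φ.IsContinuous →
            |DGEntropy.truncationError S fb ub Q v (DGEntropy.correctedResidual F Q v) φ|
              ≤ C * φ.normH1 * T.size ^ (k + 1))) := by
  have hsize : ∀ T : DGEntropy.Mesh d Ω, 0 ≤ T.size := fun T => T.size_nonneg
  obtain ⟨m, rfl⟩ : ∃ m, d = m + 1 := ⟨d - 1, by omega⟩
  refine ⟨fun v hv => ⟨fun j => S.hasGradientAt_potential j hv,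
    fun n hn => F.entropyFlux_self hn hv⟩, fun T Q v => ⟨DGEntropy.sum_correctedResidual F Q v,
    fun K hK => DGEntropy.sum_inner_correctedResidual F Q v K hK,
    fun hF f K hf => DGEntropy.facetEntropyFlux_add_eq_zero F Q hF v hf⟩, fun κ hκ A M => ?_,
    fun hV' κ hκ A M B => ?_⟩
  · exact DGEntropy.exists_defect_le hΩb S F FE hW hΩW hV hVmem hκ A M
  · obtain ⟨C₁, h₀, hC₁, hh₀, H⟩ :=
      DGEntropy.exists_correction_le hk hΩb S F FE hW hΩW hV hVmem hV' hκ A M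
    obtain ⟨C₂, hC₂, H₂⟩ := DGEntropy.exists_sum_inner_correction_le hd hΩb F FE hκ hC₁
    refine ⟨|B| + C₁ + C₂, h₀, hh₀, fun T Q v hT hqu hQ hM hv hs => ?_⟩
    obtain ⟨hspread, hr⟩ := H T Q v hT hqu hQ hM hv hs
    have hB := le_abs_self B
    have hB0 := abs_nonneg B
    have hpow (n : ℕ) : 0 ≤ T.size ^ n := pow_nonneg (hsize T) n
    refine ⟨hspread, fun K σ => (hr K σ).trans ?_, fun hΦ K σ => ?_, fun fb ub hE φ hφ => ?_⟩
    · exact mul_le_mul_of_nonneg_right (by linarith) (hpow _)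
    · calc _ ≤ _ := norm_add_le _ _
        _ ≤ B * T.size ^ (k + (m + 1)) + C₁ * T.size ^ (k + (m + 1)) :=
          add_le_add (hΦ K σ) (hr K σ)
        _ = (B + C₁) * T.size ^ (k + (m + 1)) := by ring
        _ ≤ _ := mul_le_mul_of_nonneg_right (by linarith) (hpow _)
    · rw [DGEntropy.truncationError_correctedResidual]
      calc _ ≤ _ := abs_add_le _ _
        _ ≤ B * φ.normH1 * T.size ^ (k + 1) + C₂ * φ.normH1 * T.size ^ (k + 1) :=
          add_le_add (hE φ hφ) (H₂ T Q v hT hqu hr φ)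
        _ = (B + C₂) * (φ.normH1 * T.size ^ (k + 1)) := by ring
        _ ≤ (|B| + C₁ + C₂) * (φ.normH1 * T.size ^ (k + 1)) :=
          mul_le_mul_of_nonneg_right (by linarith) (mul_nonneg φ.normH1_nonneg (hpow _))
        _ = _ := by ring
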